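/- **Conventions.** All spaces are over $\mathbb C$. A *superalgebra* is an algebra with a $\mathbb Z_2$-grading $A=A_0\oplus A_1$, $A_iA_j\subseteq A_{i+j}$; it is of *type* $(m,n)$ if $\dim A_0=m$, $\dim A_1=n$. It is a *Jordan superalgebra* if for all homogeneous $x,y,z,t$ (with parities $|x|,|y|,|z|,|t|$) one has $xy=(-1)^{|x||y|}yx$ and $$((xy)z)t+(-1)^{|y||z|+|y||t|+|z||t|}((xt)z)y+(-1)^{|x||y|+|x||z|+|x||t|+|z||t|}((yt)z)x=(xy)(zt)+(-1)^{|t|(|y|+|z|)}(xt)(yz)+(-1)^{|y||z|}(xz)(yt).$$ Isomorphisms are multiplicative linear bijections that preserve the even and the odd parts. A nonzero superalgebra is *indecomposable* if it is not the direct sum of two nonzero graded ideals. $\mathrm{Der}(A)=\mathrm{Der}_0(A)\oplus\mathrm{Der}_1(A)$, where $\mathrm{Der}_d(A)$ consists of the linear maps $D$ of parity $d$ with $D(xy)=D(x)y+(-1)^{d|x|}xD(y)$ for homogeneous $x$; the *orbit dimension* of a 4-dimensional superalgebra $A$ is the number $4^2-\dim\mathrm{Der}(A)$. In the lists below $e,e_1,e_2$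 form a basis of the even part and $f,f_1,f_2$ a basis of the odd part; products of basis vectors that do not follow from the given ones by supercommutativity are zero. **Theorem.** The superalgebras $\mathcal J_1,\dots,\mathcal J_{71}$ listed below, where $\mathcal J_{16}^t$ $(t\in\mathbb C)$ is a one-parameter family, are Jordan superalgebras of type $(2,2)$ with nonzero multiplication, and every complex Jordan superalgebra of type $(2,2)$ with nonzero multiplication is isomorphic to one of them. They are pairwise non-isomorphic, except that $\mathcal J_{16}^s\cong\mathcal J_{16}^t$ if and only if $s=t$ or $st=1$. Thus, counting the family $\mathcal J_{16}^t$ as one, there are exactly 71 of them up to isomorphism. The list also gives, for each of them (for $\mathcal J_{16}^t$: for every $t$), the orbit dimension (in parentheses) and either a direct sum of superalgebras to which it is isomorphic or the fact that it is indecomposable. - $\mathcal J_{1}$ (12): $e_1^2=e_1,\ e_2^2=e_2$; $\mathcal U_1\oplus \mathcal U_1\oplus \mathcal S_{1}^{1}\oplus \mathcal S_{1}^{1}$. - $\mathcal J_{2}$ (13): $e_1^2=e_1,\ e_2^2=e_2,\ e_2f_2=f_2$; $\mathcal U_1\oplus \mathcal S_{2}^{2}\oplus \mathcal S_{1}^{1}$.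 - $\mathcal J_{3}$ (13): $e_1^2=e_1,\ e_2^2=e_2,\ e_2f_2=\tfrac12 f_2$; $\mathcal U_1\oplus \mathcal S_{1}^{2}\oplus \mathcal S_{1}^{1}$. - $\mathcal J_{4}$ (12): $e_1^2=e_1,\ e_2^2=e_2,\ e_2f_1=f_1,\ e_2f_2=f_2$; $\mathcal U_1\oplus \mathcal S_{6}^{3}$. - $\mathcal J_{5}$ (13): $e_1^2=e_1,\ e_2^2=e_2,\ e_2f_1=f_1,\ e_2f_2=\tfrac12 f_2$; $\mathcal U_1\oplus \mathcal S_{4}^{3}$. - $\mathcal J_{6}$ (13): $e_1^2=e_1,\ e_2^2=e_2,\ e_2f_1=f_1,\ e_2f_2=f_2,\ f_1f_2=e_2$; $\mathcal U_1\oplus \mathcal S_{8}^{3}$. - $\mathcal J_{7}$ (10): $e_1^2=e_1,\ e_2^2=e_2,\ e_2f_1=\tfrac12 f_1,\ e_2f_2=\tfrac12 f_2$; $\mathcal U_1\oplus \mathcal S_{5}^{3}$. - $\mathcal J_{8}$ (11): $e_1^2=e_1,\ e_2^2=e_2,\ e_2f_1=\tfrac12 f_1,\ e_2f_2=\tfrac12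 f_2,\ f_1f_2=e_2$; $\mathcal U_1\oplus \mathcal S_{7}^{3}$. - $\mathcal J_{9}$ (13): $e_1^2=e_1,\ e_2^2=e_2,\ e_1f_2=\tfrac12 f_2,\ e_2f_2=\tfrac12 f_2$; $\mathcal S_{13}^{3}\oplus \mathcal S_{1}^{1}$. - $\mathcal J_{10}$ (12): $e_1^2=e_1,\ e_2^2=e_2,\ e_1f_2=\tfrac12 f_2,\ e_2f_1=f_1$; $\mathcal S_{1}^{2}\oplus \mathcal S_{2}^{2}$. - $\mathcal J_{11}$ (13): $e_1^2=e_1,\ e_2^2=e_2,\ e_1f_2=\tfrac12 f_2,\ e_2f_1=f_1,\ e_2f_2=\tfrac12 f_2$; indecomposable. - $\mathcal J_{12}$ (12): $e_1^2=e_1,\ e_2^2=e_2,\ e_1f_2=\tfrac12 f_2,\ e_2f_1=\tfrac12 f_1$; $\mathcal S_{1}^{2}\oplus \mathcal S_{1}^{2}$. - $\mathcal J_{13}$ (12): $e_1^2=e_1,\ e_2^2=e_2,\ e_1f_2=\tfrac12 f_2,\ e_2f_1=\tfrac12 f_1,\ e_2f_2=\tfrac12 f_2$; indecomposable. - $\mathcal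 J_{14}$ (12): $e_1^2=e_1,\ e_2^2=e_2,\ e_1f_2=f_2,\ e_2f_1=f_1$; $\mathcal S_{2}^{2}\oplus \mathcal S_{2}^{2}$. - $\mathcal J_{15}$ (10): $e_1^2=e_1,\ e_2^2=e_2,\ e_1f_1=\tfrac12 f_1,\ e_1f_2=\tfrac12 f_2,\ e_2f_1=\tfrac12 f_1,\ e_2f_2=\tfrac12 f_2$; indecomposable. - $\mathcal J_{16}^t$ (11): $e_1^2=e_1,\ e_2^2=e_2,\ e_1f_1=\tfrac12 f_1,\ e_1f_2=\tfrac12 f_2,\ e_2f_1=\tfrac12 f_1,\ e_2f_2=\tfrac12 f_2,\ f_1f_2=e_1+te_2$; indecomposable. - $\mathcal J_{17}$ (6): $f_1f_2=e_1$; $\mathcal U_2\oplus \mathcal S_{2}^{3}$. - $\mathcal J_{18}$ (7): $e_2f_1=f_2$; $\mathcal U_2\oplus \mathcal S_{3}^{3}$. - $\mathcal J_{19}$ (9): $e_2f_1=f_2,\ f_1f_2=e_1$; indecomposable. - $\mathcal J_{20}$ (10): $e_2f_1=f_2,\ f_1f_2=e_2$; $\mathcal U_2\oplus \mathcal S_{1}^{3}$.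 - $\mathcal J_{21}$ (7): $e_1^2=e_1$; $\mathcal U_1\oplus \mathcal U_2\oplus \mathcal S_{1}^{1}\oplus \mathcal S_{1}^{1}$. - $\mathcal J_{22}$ (10): $e_1^2=e_1,\ f_1f_2=e_2$; $\mathcal U_1\oplus \mathcal S_{2}^{3}$. - $\mathcal J_{23}$ (11): $e_1^2=e_1,\ e_2f_1=f_2$; $\mathcal U_1\oplus \mathcal S_{3}^{3}$. - $\mathcal J_{24}$ (12): $e_1^2=e_1,\ e_2f_1=f_2,\ f_1f_2=e_2$; $\mathcal U_1\oplus \mathcal S_{1}^{3}$. - $\mathcal J_{25}$ (10): $e_1^2=e_1,\ e_1f_2=\tfrac12 f_2$; $\mathcal U_2\oplus \mathcal S_{1}^{2}\oplus \mathcal S_{1}^{1}$. - $\mathcal J_{26}$ (10): $e_1^2=e_1,\ e_1f_2=f_2$; $\mathcal U_2\oplus \mathcal S_{2}^{2}\oplus \mathcal S_{1}^{1}$. - $\mathcal J_{27}$ (9): $e_1^2=e_1,\ e_1f_1=\tfrac12 f_1,\ e_1f_2=\tfrac12 f_2$; $\mathcal U_2\oplus \mathcal S_{5}^{3}$. - $\mathcal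 J_{28}$ (10): $e_1^2=e_1,\ e_1f_1=\tfrac12 f_1,\ e_1f_2=\tfrac12 f_2,\ f_1f_2=e_2$; indecomposable. - $\mathcal J_{29}$ (10): $e_1^2=e_1,\ e_1f_1=\tfrac12 f_1,\ e_1f_2=\tfrac12 f_2,\ f_1f_2=e_1$; $\mathcal U_2\oplus \mathcal S_{7}^{3}$. - $\mathcal J_{30}$ (11): $e_1^2=e_1,\ e_1f_1=\tfrac12 f_1,\ e_1f_2=\tfrac12 f_2,\ f_1f_2=e_1+e_2$; indecomposable. - $\mathcal J_{31}$ (11): $e_1^2=e_1,\ e_1f_1=\tfrac12 f_1,\ e_1f_2=\tfrac12 f_2,\ e_2f_1=f_2$; indecomposable. - $\mathcal J_{32}$ (12): $e_1^2=e_1,\ e_1f_1=\tfrac12 f_1,\ e_1f_2=\tfrac12 f_2,\ e_2f_1=f_2,\ f_1f_2=e_2$; indecomposable. - $\mathcal J_{33}$ (12): $e_1^2=e_1,\ e_1f_1=\tfrac12 f_1,\ e_1f_2=f_2$; $\mathcal U_2\oplus \mathcal S_{4}^{3}$. - $\mathcal J_{34}$ (11): $e_1^2=e_1,\ e_1f_1=f_1,\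 e_1f_2=f_2$; $\mathcal U_2\oplus \mathcal S_{6}^{3}$. - $\mathcal J_{35}$ (12): $e_1^2=e_1,\ e_1f_1=f_1,\ e_1f_2=f_2,\ f_1f_2=e_1$; $\mathcal U_2\oplus \mathcal S_{8}^{3}$. - $\mathcal J_{36}$ (11): $e_1^2=e_1,\ e_1e_2=e_2$; $\mathcal B_1\oplus \mathcal S_{1}^{1}\oplus \mathcal S_{1}^{1}$. - $\mathcal J_{37}$ (12): $e_1^2=e_1,\ e_1e_2=e_2,\ e_1f_2=\tfrac12 f_2$; $\mathcal S_{9}^{3}\oplus \mathcal S_{1}^{1}$. - $\mathcal J_{38}$ (11): $e_1^2=e_1,\ e_1e_2=e_2,\ e_1f_2=f_2$; $\mathcal S_{10}^{3}\oplus \mathcal S_{1}^{1}$. - $\mathcal J_{39}$ (9): $e_1^2=e_1,\ e_1e_2=e_2,\ e_1f_1=\tfrac12 f_1,\ e_1f_2=\tfrac12 f_2$; indecomposable. - $\mathcal J_{40}$ (10): $e_1^2=e_1,\ e_1e_2=e_2,\ e_1f_1=\tfrac12 f_1,\ e_1f_2=\tfrac12 f_2,\ f_1f_2=e_2$; indecomposable.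 - $\mathcal J_{41}$ (11): $e_1^2=e_1,\ e_1e_2=e_2,\ e_1f_1=\tfrac12 f_1,\ e_1f_2=\tfrac12 f_2,\ e_2f_1=f_2$; indecomposable. - $\mathcal J_{42}$ (12): $e_1^2=e_1,\ e_1e_2=e_2,\ e_1f_1=\tfrac12 f_1,\ e_1f_2=\tfrac12 f_2,\ e_2f_1=f_2,\ f_1f_2=e_2$; indecomposable. - $\mathcal J_{43}$ (10): $e_1^2=e_1,\ e_1e_2=e_2,\ e_1f_1=\tfrac12 f_1,\ e_1f_2=f_2$; indecomposable. - $\mathcal J_{44}$ (7): $e_1^2=e_1,\ e_1e_2=e_2,\ e_1f_1=f_1,\ e_1f_2=f_2$; indecomposable. - $\mathcal J_{45}$ (8): $e_1^2=e_1,\ e_1e_2=e_2,\ e_1f_1=f_1,\ e_1f_2=f_2,\ f_1f_2=e_2$; indecomposable. - $\mathcal J_{46}$ (10): $e_1^2=e_1,\ e_1e_2=e_2,\ e_1f_1=f_1,\ e_1f_2=f_2,\ f_1f_2=e_1$; indecomposable. - $\mathcal J_{47}$ (11): $e_1^2=e_1,\ e_1e_2=e_2,\ e_1f_1=f_1,\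 e_1f_2=f_2,\ f_1f_2=e_1+e_2$; indecomposable. - $\mathcal J_{48}$ (10): $e_1^2=e_1,\ e_1e_2=e_2,\ e_1f_1=f_1,\ e_1f_2=f_2,\ e_2f_1=f_2$; indecomposable. - $\mathcal J_{49}$ (11): $e_1^2=e_1,\ e_1e_2=e_2,\ e_1f_1=f_1,\ e_1f_2=f_2,\ e_2f_1=f_2,\ f_1f_2=e_2$; indecomposable. - $\mathcal J_{50}$ (10): $e_1^2=e_1,\ e_1e_2=\tfrac12 e_2$; $\mathcal B_2\oplus \mathcal S_{1}^{1}\oplus \mathcal S_{1}^{1}$. - $\mathcal J_{51}$ (9): $e_1^2=e_1,\ e_1e_2=\tfrac12 e_2,\ e_1f_2=\tfrac12 f_2$; $\mathcal S_{11}^{3}\oplus \mathcal S_{1}^{1}$. - $\mathcal J_{52}$ (11): $e_1^2=e_1,\ e_1e_2=\tfrac12 e_2,\ e_1f_2=\tfrac12 f_2,\ f_1f_2=e_2$; indecomposable. - $\mathcal J_{53}$ (11): $e_1^2=e_1,\ e_1e_2=\tfrac12 e_2,\ e_1f_2=\tfrac12 f_2,\ e_2f_2=f_1$; indecomposable. -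 $\mathcal J_{54}$ (12): $e_1^2=e_1,\ e_1e_2=\tfrac12 e_2,\ e_1f_2=\tfrac12 f_2,\ e_2f_2=f_1,\ f_1f_2=e_2$; indecomposable. - $\mathcal J_{55}$ (11): $e_1^2=e_1,\ e_1e_2=\tfrac12 e_2,\ e_1f_2=\tfrac12 f_2,\ e_2f_1=f_2$; indecomposable. - $\mathcal J_{56}$ (12): $e_1^2=e_1,\ e_1e_2=\tfrac12 e_2,\ e_1f_2=\tfrac12 f_2,\ e_2f_1=f_2,\ f_1f_2=e_2$; indecomposable. - $\mathcal J_{57}$ (12): $e_1^2=e_1,\ e_1e_2=\tfrac12 e_2,\ e_1f_2=f_2$; $\mathcal S_{12}^{3}\oplus \mathcal S_{1}^{1}$. - $\mathcal J_{58}$ (4): $e_1^2=e_1,\ e_1e_2=\tfrac12 e_2,\ e_1f_1=\tfrac12 f_1,\ e_1f_2=\tfrac12 f_2$; indecomposable. - $\mathcal J_{59}$ (9): $e_1^2=e_1,\ e_1e_2=\tfrac12 e_2,\ e_1f_1=\tfrac12 f_1,\ e_1f_2=f_2$; indecomposable. - $\mathcal J_{60}$ (10): $e_1^2=e_1,\ e_1e_2=\tfrac12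 e_2,\ e_1f_1=\tfrac12 f_1,\ e_1f_2=f_2,\ f_1f_2=e_2$; indecomposable. - $\mathcal J_{61}$ (10): $e_1^2=e_1,\ e_1e_2=\tfrac12 e_2,\ e_1f_1=\tfrac12 f_1,\ e_1f_2=f_2,\ e_2f_2=f_1$; indecomposable. - $\mathcal J_{62}$ (11): $e_1^2=e_1,\ e_1e_2=\tfrac12 e_2,\ e_1f_1=\tfrac12 f_1,\ e_1f_2=f_2,\ e_2f_2=f_1,\ f_1f_2=e_2$; indecomposable. - $\mathcal J_{63}$ (11): $e_1^2=e_1,\ e_1e_2=\tfrac12 e_2,\ e_1f_1=\tfrac12 f_1,\ e_1f_2=f_2,\ e_2f_1=f_2$; indecomposable. - $\mathcal J_{64}$ (12): $e_1^2=e_1,\ e_1e_2=\tfrac12 e_2,\ e_1f_1=\tfrac12 f_1,\ e_1f_2=f_2,\ e_2f_1=f_2,\ f_1f_2=e_2$; indecomposable. - $\mathcal J_{65}$ (10): $e_1^2=e_1,\ e_1e_2=\tfrac12 e_2,\ e_1f_1=f_1,\ e_1f_2=f_2$; indecomposable. - $\mathcal J_{66}$ (6): $e_1^2=e_2$; $\mathcal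 B_3\oplus \mathcal S_{1}^{1}\oplus \mathcal S_{1}^{1}$. - $\mathcal J_{67}$ (7): $e_1^2=e_2,\ f_1f_2=e_2$; indecomposable. - $\mathcal J_{68}$ (10): $e_1^2=e_2,\ f_1f_2=e_1$; indecomposable. - $\mathcal J_{69}$ (11): $e_1^2=e_2,\ e_2f_1=f_2$; indecomposable. - $\mathcal J_{70}$ (8): $e_1^2=e_2,\ e_1f_1=f_2$; indecomposable. - $\mathcal J_{71}$ (10): $e_1^2=e_2,\ e_1f_1=f_2,\ f_1f_2=e_2$; indecomposable. The summands are: $\mathcal U_1$: $e^2=e$; $\mathcal U_2$: $e^2=0$ (both of type $(1,0)$); $\mathcal B_1$: $e_1^2=e_1,\ e_1e_2=e_2$; $\mathcal B_2$: $e_1^2=e_1,\ e_1e_2=\tfrac12e_2$; $\mathcal B_3$: $e_1^2=e_2$ (of type $(2,0)$); $\mathcal S_1^1$: $f^2=0$ (of type $(0,1)$); $\mathcal S_1^2$: $e^2=e,\ ef=\tfrac12f$; $\mathcal S_2^2$: $e^2=e,\ ef=f$ (of type $(1,1)$); of type $(1,2)$: $\mathcal S_1^3$: $ef_1=f_2,\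 f_1f_2=e$; $\mathcal S_2^3$: $f_1f_2=e$; $\mathcal S_3^3$: $ef_1=f_2$; $\mathcal S_4^3$: $e^2=e,\ ef_1=f_1,\ ef_2=\tfrac12f_2$; $\mathcal S_5^3$: $e^2=e,\ ef_1=\tfrac12f_1,\ ef_2=\tfrac12f_2$; $\mathcal S_6^3$: $e^2=e,\ ef_1=f_1,\ ef_2=f_2$; $\mathcal S_7^3$: $e^2=e,\ ef_1=\tfrac12f_1,\ ef_2=\tfrac12f_2,\ f_1f_2=e$; $\mathcal S_8^3$: $e^2=e,\ ef_1=f_1,\ ef_2=f_2,\ f_1f_2=e$; of type $(2,1)$: $\mathcal S_9^3$: $e_1^2=e_1,\ e_1e_2=e_2,\ e_1f=\tfrac12f$; $\mathcal S_{10}^3$: $e_1^2=e_1,\ e_1e_2=e_2,\ e_1f=f$; $\mathcal S_{11}^3$: $e_1^2=e_1,\ e_1e_2=\tfrac12e_2,\ e_1f=\tfrac12f$; $\mathcal S_{12}^3$: $e_1^2=e_1,\ e_1e_2=\tfrac12e_2,\ e_1f=f$; $\mathcal S_{13}^3$: $e_1^2=e_1,\ e_2^2=e_2,\ e_1f=\tfrac12f,\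 e_2f=\tfrac12f$. -/

import Mathlib

namespace JordanSuper

noncomputable section

/-- The sign `(-1)^i` of a parity `i`. -/
def sign (i : ZMod 2) : ℂ := (-1) ^ i.val

/-- A complex superalgebra on the vector space `A`: a bilinear product together with a
`ℤ/2`-grading `A = A₀ ⊕ A₁` such that `Aᵢ Aⱼ ⊆ Aᵢ₊ⱼ`. -/
structure Superalgebra (A : Type*) [AddCommGroup A] [Module ℂ A] where
  mul : A →ₗ[ℂ] A →ₗ[ℂ] A
  part : ZMod 2 → Submodule ℂ A
  isCompl : IsCompl (part 0) (part 1)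
  mul_mem : ∀ {i j : ZMod 2} {x y : A}, x ∈ part i → y ∈ part j → mul x y ∈ part (i + j)

namespace Superalgebra

variable {A : Type*} [AddCommGroup A] [Module ℂ A]
variable {B : Type*} [AddCommGroup B] [Module ℂ B]

/-- Jordan superalgebras: supercommutativity and the graded Jordan identity on homogeneous
elements `x, y, z, t` of parities `i, j, k, l`. -/
def IsJordan (S : Superalgebra A) : Prop :=
  (∀ i j : ZMod 2, ∀ x ∈ S.part i, ∀ y ∈ S.part j,
    S.mul x y = sign (i * j) • S.mul y x) ∧
  (∀ i j k l : ZMod 2, ∀ x ∈ S.part i, ∀ y ∈ S.part j, ∀ z ∈ S.part k, ∀ t ∈ S.part l,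
    S.mul (S.mul (S.mul x y) z) t
      + sign (j * k + j * l + k * l) • S.mul (S.mul (S.mul x t) z) y
      + sign (i * j + i * k + i * l + k * l) • S.mul (S.mul (S.mul y t) z) x
    = S.mul (S.mul x y) (S.mul z t)
      + sign (l * (j + k)) • S.mul (S.mul x t) (S.mul y z)
      + sign (j * k) • S.mul (S.mul x z) (S.mul y t))

/-- Type `(m, n)`: the even part has dimension `m`, the odd part has dimension `n`. -/
def HasType (S : Superalgebra A) (m n : ℕ) : Prop :=
  Module.Finite ℂ A ∧ Module.finrank ℂ (S.part 0) = m ∧ Module.finrank ℂ (S.part 1) = n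

/-- Isomorphism of superalgebras: a linear bijection which is multiplicative and maps the
even part onto the even part and the odd part onto the odd part. -/
def Isomorphic (S : Superalgebra A) (T : Superalgebra B) : Prop :=
  ∃ φ : A ≃ₗ[ℂ] B, (∀ x y, φ (S.mul x y) = T.mul (φ x) (φ y)) ∧
    ∀ i, (S.part i).map (φ : A →ₗ[ℂ] B) = T.part i

/-- The direct sum of two superalgebras. -/
def prod (S : Superalgebra A) (T : Superalgebra B) : Superalgebra (A × B) where
  mul := LinearMap.mk₂ ℂ (fun x y => (S.mul x.1 y.1, T.mul x.2 y.2))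
    (by intros; simp) (by intros; simp) (by intros; simp) (by intros; simp)
  part i := (S.part i).prod (T.part i)
  isCompl := by
    constructor
    · rw [disjoint_iff, Submodule.prod_inf_prod, disjoint_iff.1 S.isCompl.1,
        disjoint_iff.1 T.isCompl.1, Submodule.prod_bot]
    · rw [codisjoint_iff, Submodule.prod_sup_prod, codisjoint_iff.1 S.isCompl.2,
        codisjoint_iff.1 T.isCompl.2, Submodule.prod_top]
  mul_mem := by
    rintro i j x y ⟨hx, hx'⟩ ⟨hy, hy'⟩
    exact ⟨S.mul_mem hx hy, T.mul_mem hx' hy'⟩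

/-- Two-sided graded ideals. -/
def IsGradedIdeal (S : Superalgebra A) (I : Submodule ℂ A) : Prop :=
  (∀ x ∈ I, ∀ y, S.mul x y ∈ I ∧ S.mul y x ∈ I) ∧
  I = (I ⊓ S.part 0) ⊔ (I ⊓ S.part 1)

/-- A nonzero superalgebra is indecomposable if it is not the direct sum of two nonzero
graded ideals. -/
def Indecomposable (S : Superalgebra A) : Prop :=
  Nontrivial A ∧
  ∀ I J : Submodule ℂ A, S.IsGradedIdeal I → S.IsGradedIdeal J → IsCompl I J → I = ⊥ ∨ J = ⊥

/-- The space of superderivations of parity `d`: the linear maps `D` of parity `d` with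
`D(xy) = D(x)y + (-1)^{d|x|} x D(y)` for homogeneous `x`. -/
def derivations (S : Superalgebra A) (d : ZMod 2) : Submodule ℂ (A →ₗ[ℂ] A) where
  carrier := {D | ∀ i : ZMod 2, ∀ x ∈ S.part i, D x ∈ S.part (i + d) ∧
    ∀ y, D (S.mul x y) = S.mul (D x) y + sign (d * i) • S.mul x (D y)}
  add_mem' := by
    intro D E hD hE i x hx
    refine ⟨add_mem (hD i x hx).1 (hE i x hx).1, fun y => ?_⟩
    simp only [LinearMap.add_apply, (hD i x hx).2 y, (hE i x hx).2 y, map_add, smul_add]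
    abel
  zero_mem' := by
    intro i x hx
    simp
  smul_mem' := by
    intro c D hD i x hx
    refine ⟨Submodule.smul_mem _ c (hD i x hx).1, fun y => ?_⟩
    simp only [LinearMap.smul_apply, (hD i x hx).2 y, map_smul, smul_add]
    rw [smul_comm c]

/-- The dimension of the Lie superalgebra `Der = Der₀ ⊕ Der₁` of all superderivations. -/
def dimDer (S : Superalgebra A) : ℕ :=
  Module.finrank ℂ (S.derivations 0) + Module.finrank ℂ (S.derivations 1)

end Superalgebra

/-- A multiplication table for an even basis `e₁, …, eₘ` and an odd basis `f₁, …, fₙ`: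
`ee i j`, `ef i p`, `ff p q` are the coordinate vectors of `eᵢeⱼ`, `eᵢfₚ`, `fₚf_q`.
Products that are not mentioned vanish. -/
structure Table (m n : ℕ) where
  ee : Fin m → Fin m → (Fin m → ℂ) := 0
  ef : Fin m → Fin n → (Fin n → ℂ) := 0
  ff : Fin n → Fin n → (Fin m → ℂ) := 0

/-- The underlying space of the superalgebra of a multiplication table. -/
abbrev Model (m n : ℕ) : Type := (Fin m → ℂ) × (Fin n → ℂ)

/-- The superalgebra with even part `ℂᵐ`, odd part `ℂⁿ` and the given multiplication table,
where `fₚeᵢ = eᵢfₚ`. -/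
def Table.alg {m n : ℕ} (c : Table m n) : Superalgebra (Model m n) where
  mul := LinearMap.mk₂ ℂ (fun x y =>
      ((∑ i, ∑ j, (x.1 i * y.1 j) • c.ee i j) + ∑ p, ∑ q, (x.2 p * y.2 q) • c.ff p q,
        ∑ i, ∑ p, (x.1 i * y.2 p + y.1 i * x.2 p) • c.ef i p))
    (by
      intro x x' y
      ext k
      · simp [add_mul, Finset.sum_add_distrib]; ring
      · simp only [Prod.fst_add, Prod.snd_add, Pi.add_apply, Finset.sum_apply, Pi.smul_apply,
          smul_eq_mul, ← Finset.sum_add_distrib]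
        exact Finset.sum_congr rfl fun i _ => Finset.sum_congr rfl fun p _ => by ring)
    (by
      intro a x y
      ext k
      · simp [Finset.mul_sum, mul_assoc]
      · simp only [Prod.smul_fst, Prod.smul_snd, Finset.sum_apply, Pi.smul_apply,
          smul_eq_mul, Finset.mul_sum]
        exact Finset.sum_congr rfl fun i _ => Finset.sum_congr rfl fun p _ => by ring)
    (by
      intro x y y'
      ext k
      · simp [mul_add, add_mul, Finset.sum_add_distrib]; ring
      · simp only [Prod.fst_add, Prod.snd_add, Pi.add_apply, Finset.sum_apply, Pi.smul_apply,
          smul_eq_mul, ← Finset.sum_add_distrib]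
        exact Finset.sum_congr rfl fun i _ => Finset.sum_congr rfl fun p _ => by ring)
    (by
      intro a x y
      ext k
      · simp only [Prod.smul_fst, Prod.smul_snd, Pi.add_apply, Finset.sum_apply,
          Pi.smul_apply, smul_eq_mul, mul_add, Finset.mul_sum]
        congr 1 <;>
        exact Finset.sum_congr rfl fun i _ => Finset.sum_congr rfl fun p _ => by ring
      · simp only [Prod.smul_fst, Prod.smul_snd, Finset.sum_apply, Pi.smul_apply,
          smul_eq_mul, Finset.mul_sum]
        exact Finset.sum_congr rfl fun i _ => Finset.sum_congr rfl fun p _ => by ring)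
  part i := if i = 0 then Submodule.prod ⊤ ⊥ else Submodule.prod ⊥ ⊤
  isCompl := by
    constructor
    · rw [disjoint_iff]; simp [Submodule.prod_inf_prod]
    · rw [codisjoint_iff]; simp [Submodule.prod_sup_prod]
  mul_mem := by
    intro i j x y hx hy
    have h2 : (1 + 1 : ZMod 2) = 0 := by decide
    have h01 : ∀ i : ZMod 2, i = 0 ∨ i = 1 := by decide
    rcases h01 i with rfl | rfl <;> rcases h01 j with rfl | rfl <;>
      simp_all [Submodule.mem_prod]

/-! The indecomposable Jordan (super)algebras of dimension at most three that occur as direct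
summands: `U1, U2, B1, B2, B3` are purely even, and `Sd_j` has total dimension `d`. -/

/-- The basis vectors: `e₁, e₂` of the even part and `f₁, f₂` of the odd part, by their
coordinates. -/
abbrev e₁ : Fin 2 → ℂ := ![1, 0]
abbrev e₂ : Fin 2 → ℂ := ![0, 1]
abbrev f₁ : Fin 2 → ℂ := ![1, 0]
abbrev f₂ : Fin 2 → ℂ := ![0, 1]
abbrev half : ℂ := 1 / 2

/-- `e² = e`. -/
def U1 : Superalgebra (Model 1 0) := Table.alg { ee := ![![ ![1] ]] }
/-- `e² = 0`. -/
def U2 : Superalgebra (Model 1 0) := Table.alg {}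
/-- `e₁² = e₁, e₁e₂ = e₂`. -/
def B1 : Superalgebra (Model 2 0) := Table.alg { ee := ![![e₁, e₂], ![e₂, 0]] }
/-- `e₁² = e₁, e₁e₂ = ½e₂`. -/
def B2 : Superalgebra (Model 2 0) := Table.alg { ee := ![![e₁, half • e₂], ![half • e₂, 0]] }
/-- `e₁² = e₂`. -/
def B3 : Superalgebra (Model 2 0) := Table.alg { ee := ![![e₂, 0], ![0, 0]] }
/-- `f² = 0`. -/
def S1_1 : Superalgebra (Model 0 1) := Table.alg {}
/-- `e² = e, ef = ½f`. -/
def S2_1 : Superalgebra (Model 1 1) := Table.alg { ee := ![![ ![1] ]], ef := ![![ ![half] ]] }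
/-- `e² = e, ef = f`. -/
def S2_2 : Superalgebra (Model 1 1) := Table.alg { ee := ![![ ![1] ]], ef := ![![ ![1] ]] }
/-- `ef₁ = f₂, f₁f₂ = e`. -/
def S3_1 : Superalgebra (Model 1 2) :=
  Table.alg { ef := ![![f₂, 0]], ff := ![![0, ![1]], ![![-1], 0]] }
/-- `f₁f₂ = e`. -/
def S3_2 : Superalgebra (Model 1 2) := Table.alg { ff := ![![0, ![1]], ![![-1], 0]] }
/-- `ef₁ = f₂`. -/
def S3_3 : Superalgebra (Model 1 2) := Table.alg { ef := ![![f₂, 0]] }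
/-- `e² = e, ef₁ = f₁, ef₂ = ½f₂`. -/
def S3_4 : Superalgebra (Model 1 2) :=
  Table.alg { ee := ![![ ![1] ]], ef := ![![f₁, half • f₂]] }
/-- `e² = e, ef₁ = ½f₁, ef₂ = ½f₂`. -/
def S3_5 : Superalgebra (Model 1 2) :=
  Table.alg { ee := ![![ ![1] ]], ef := ![![half • f₁, half • f₂]] }
/-- `e² = e, ef₁ = f₁, ef₂ = f₂`. -/
def S3_6 : Superalgebra (Model 1 2) :=
  Table.alg { ee := ![![ ![1] ]], ef := ![![f₁, f₂]] }
/-- `e² = e, ef₁ = ½f₁, ef₂ = ½f₂, f₁f₂ = e`. -/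
def S3_7 : Superalgebra (Model 1 2) :=
  Table.alg { ee := ![![ ![1] ]], ef := ![![half • f₁, half • f₂]],
              ff := ![![0, ![1]], ![![-1], 0]] }
/-- `e² = e, ef₁ = f₁, ef₂ = f₂, f₁f₂ = e`. -/
def S3_8 : Superalgebra (Model 1 2) :=
  Table.alg { ee := ![![ ![1] ]], ef := ![![f₁, f₂]], ff := ![![0, ![1]], ![![-1], 0]] }
/-- `e₁² = e₁, e₁e₂ = e₂, e₁f = ½f`. -/
def S3_9 : Superalgebra (Model 2 1) :=
  Table.alg { ee := ![![e₁, e₂], ![e₂, 0]], ef := ![![ ![half] ], 0] }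
/-- `e₁² = e₁, e₁e₂ = e₂, e₁f = f`. -/
def S3_10 : Superalgebra (Model 2 1) :=
  Table.alg { ee := ![![e₁, e₂], ![e₂, 0]], ef := ![![ ![1] ], 0] }
/-- `e₁² = e₁, e₁e₂ = ½e₂, e₁f = ½f`. -/
def S3_11 : Superalgebra (Model 2 1) :=
  Table.alg { ee := ![![e₁, half • e₂], ![half • e₂, 0]], ef := ![![ ![half] ], 0] }
/-- `e₁² = e₁, e₁e₂ = ½e₂, e₁f = f`. -/
def S3_12 : Superalgebra (Model 2 1) :=
  Table.alg { ee := ![![e₁, half • e₂], ![half • e₂, 0]], ef := ![![ ![1] ], 0] }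
/-- `e₁² = e₁, e₂² = e₂, e₁f = ½f, e₂f = ½f`. -/
def S3_13 : Superalgebra (Model 2 1) :=
  Table.alg { ee := ![![e₁, 0], ![0, e₂]], ef := ![![ ![half] ], ![ ![half] ]] }

/-- The multiplication table of type `(2, 2)` with the given products of basis vectors, extended
by supercommutativity (so `e₂e₁ = e₁e₂`, `f₂f₁ = -f₁f₂`, `f₁² = f₂² = 0`); products that are not
given are zero. -/
def mult (e₁e₁ : Fin 2 → ℂ := 0) (e₁e₂ : Fin 2 → ℂ := 0) (e₂e₂ : Fin 2 → ℂ := 0)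
    (e₁f₁ : Fin 2 → ℂ := 0) (e₁f₂ : Fin 2 → ℂ := 0) (e₂f₁ : Fin 2 → ℂ := 0)
    (e₂f₂ : Fin 2 → ℂ := 0) (f₁f₂ : Fin 2 → ℂ := 0) : Table 2 2 where
  ee := ![![e₁e₁, e₁e₂], ![e₁e₂, e₂e₂]]
  ef := ![![e₁f₁, e₁f₂], ![e₂f₁, e₂f₂]]
  ff := ![![0, f₁f₂], ![-f₁f₂, 0]]

/-- The multiplication tables of the list. The parameter `t` is used for number `16` only. -/
def table : ℕ → ℂ → Table 2 2
  | 1, _ => mult (e₁e₁ := e₁) (e₂e₂ := e₂)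
  | 2, _ => mult (e₁e₁ := e₁) (e₂e₂ := e₂) (e₂f₂ := f₂)
  | 3, _ => mult (e₁e₁ := e₁) (e₂e₂ := e₂) (e₂f₂ := half • f₂)
  | 4, _ => mult (e₁e₁ := e₁) (e₂e₂ := e₂) (e₂f₁ := f₁) (e₂f₂ := f₂)
  | 5, _ => mult (e₁e₁ := e₁) (e₂e₂ := e₂) (e₂f₁ := f₁) (e₂f₂ := half • f₂)
  | 6, _ => mult (e₁e₁ := e₁) (e₂e₂ := e₂) (e₂f₁ := f₁) (e₂f₂ := f₂) (f₁f₂ := e₂)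
  | 7, _ => mult (e₁e₁ := e₁) (e₂e₂ := e₂) (e₂f₁ := half • f₁) (e₂f₂ := half • f₂)
  | 8, _ => mult (e₁e₁ := e₁) (e₂e₂ := e₂) (e₂f₁ := half • f₁) (e₂f₂ := half • f₂) (f₁f₂ := e₂)
  | 9, _ => mult (e₁e₁ := e₁) (e₂e₂ := e₂) (e₁f₂ := half • f₂) (e₂f₂ := half • f₂)
  | 10, _ => mult (e₁e₁ := e₁) (e₂e₂ := e₂) (e₁f₂ := half • f₂) (e₂f₁ := f₁)
  | 11, _ => mult (e₁e₁ := e₁) (e₂e₂ := e₂) (e₁f₂ := half • f₂) (e₂f₁ := f₁) (e₂f₂ := half • f₂)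
  | 12, _ => mult (e₁e₁ := e₁) (e₂e₂ := e₂) (e₁f₂ := half • f₂) (e₂f₁ := half • f₁)
  | 13, _ => mult (e₁e₁ := e₁) (e₂e₂ := e₂) (e₁f₂ := half • f₂) (e₂f₁ := half • f₁) (e₂f₂ := half • f₂)
  | 14, _ => mult (e₁e₁ := e₁) (e₂e₂ := e₂) (e₁f₂ := f₂) (e₂f₁ := f₁)
  | 15, _ => mult (e₁e₁ := e₁) (e₂e₂ := e₂) (e₁f₁ := half • f₁) (e₁f₂ := half • f₂) (e₂f₁ := half • f₁) (e₂f₂ := half • f₂)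
  | 16, t => mult (e₁e₁ := e₁) (e₂e₂ := e₂) (e₁f₁ := half • f₁) (e₁f₂ := half • f₂) (e₂f₁ := half • f₁) (e₂f₂ := half • f₂) (f₁f₂ := e₁ + t • e₂)
  | 17, _ => mult (f₁f₂ := e₁)
  | 18, _ => mult (e₂f₁ := f₂)
  | 19, _ => mult (e₂f₁ := f₂) (f₁f₂ := e₁)
  | 20, _ => mult (e₂f₁ := f₂) (f₁f₂ := e₂)
  | 21, _ => mult (e₁e₁ := e₁)
  | 22, _ => mult (e₁e₁ := e₁) (f₁f₂ := e₂)
  | 23, _ => mult (e₁e₁ := e₁) (e₂f₁ := f₂)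
  | 24, _ => mult (e₁e₁ := e₁) (e₂f₁ := f₂) (f₁f₂ := e₂)
  | 25, _ => mult (e₁e₁ := e₁) (e₁f₂ := half • f₂)
  | 26, _ => mult (e₁e₁ := e₁) (e₁f₂ := f₂)
  | 27, _ => mult (e₁e₁ := e₁) (e₁f₁ := half • f₁) (e₁f₂ := half • f₂)
  | 28, _ => mult (e₁e₁ := e₁) (e₁f₁ := half • f₁) (e₁f₂ := half • f₂) (f₁f₂ := e₂)
  | 29, _ => mult (e₁e₁ := e₁) (e₁f₁ := half • f₁) (e₁f₂ := half • f₂) (f₁f₂ := e₁)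
  | 30, _ => mult (e₁e₁ := e₁) (e₁f₁ := half • f₁) (e₁f₂ := half • f₂) (f₁f₂ := e₁ + e₂)
  | 31, _ => mult (e₁e₁ := e₁) (e₁f₁ := half • f₁) (e₁f₂ := half • f₂) (e₂f₁ := f₂)
  | 32, _ => mult (e₁e₁ := e₁) (e₁f₁ := half • f₁) (e₁f₂ := half • f₂) (e₂f₁ := f₂) (f₁f₂ := e₂)
  | 33, _ => mult (e₁e₁ := e₁) (e₁f₁ := half • f₁) (e₁f₂ := f₂)
  | 34, _ => mult (e₁e₁ := e₁) (e₁f₁ := f₁) (e₁f₂ := f₂)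
  | 35, _ => mult (e₁e₁ := e₁) (e₁f₁ := f₁) (e₁f₂ := f₂) (f₁f₂ := e₁)
  | 36, _ => mult (e₁e₁ := e₁) (e₁e₂ := e₂)
  | 37, _ => mult (e₁e₁ := e₁) (e₁e₂ := e₂) (e₁f₂ := half • f₂)
  | 38, _ => mult (e₁e₁ := e₁) (e₁e₂ := e₂) (e₁f₂ := f₂)
  | 39, _ => mult (e₁e₁ := e₁) (e₁e₂ := e₂) (e₁f₁ := half • f₁) (e₁f₂ := half • f₂)
  | 40, _ => mult (e₁e₁ := e₁) (e₁e₂ := e₂) (e₁f₁ := half • f₁) (e₁f₂ := half • f₂) (f₁f₂ := e₂)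
  | 41, _ => mult (e₁e₁ := e₁) (e₁e₂ := e₂) (e₁f₁ := half • f₁) (e₁f₂ := half • f₂) (e₂f₁ := f₂)
  | 42, _ => mult (e₁e₁ := e₁) (e₁e₂ := e₂) (e₁f₁ := half • f₁) (e₁f₂ := half • f₂) (e₂f₁ := f₂) (f₁f₂ := e₂)
  | 43, _ => mult (e₁e₁ := e₁) (e₁e₂ := e₂) (e₁f₁ := half • f₁) (e₁f₂ := f₂)
  | 44, _ => mult (e₁e₁ := e₁) (e₁e₂ := e₂) (e₁f₁ := f₁) (e₁f₂ := f₂)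
  | 45, _ => mult (e₁e₁ := e₁) (e₁e₂ := e₂) (e₁f₁ := f₁) (e₁f₂ := f₂) (f₁f₂ := e₂)
  | 46, _ => mult (e₁e₁ := e₁) (e₁e₂ := e₂) (e₁f₁ := f₁) (e₁f₂ := f₂) (f₁f₂ := e₁)
  | 47, _ => mult (e₁e₁ := e₁) (e₁e₂ := e₂) (e₁f₁ := f₁) (e₁f₂ := f₂) (f₁f₂ := e₁ + e₂)
  | 48, _ => mult (e₁e₁ := e₁) (e₁e₂ := e₂) (e₁f₁ := f₁) (e₁f₂ := f₂) (e₂f₁ := f₂)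
  | 49, _ => mult (e₁e₁ := e₁) (e₁e₂ := e₂) (e₁f₁ := f₁) (e₁f₂ := f₂) (e₂f₁ := f₂) (f₁f₂ := e₂)
  | 50, _ => mult (e₁e₁ := e₁) (e₁e₂ := half • e₂)
  | 51, _ => mult (e₁e₁ := e₁) (e₁e₂ := half • e₂) (e₁f₂ := half • f₂)
  | 52, _ => mult (e₁e₁ := e₁) (e₁e₂ := half • e₂) (e₁f₂ := half • f₂) (f₁f₂ := e₂)
  | 53, _ => mult (e₁e₁ := e₁) (e₁e₂ := half • e₂) (e₁f₂ := half • f₂) (e₂f₂ := f₁)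
  | 54, _ => mult (e₁e₁ := e₁) (e₁e₂ := half • e₂) (e₁f₂ := half • f₂) (e₂f₂ := f₁) (f₁f₂ := e₂)
  | 55, _ => mult (e₁e₁ := e₁) (e₁e₂ := half • e₂) (e₁f₂ := half • f₂) (e₂f₁ := f₂)
  | 56, _ => mult (e₁e₁ := e₁) (e₁e₂ := half • e₂) (e₁f₂ := half • f₂) (e₂f₁ := f₂) (f₁f₂ := e₂)
  | 57, _ => mult (e₁e₁ := e₁) (e₁e₂ := half • e₂) (e₁f₂ := f₂)
  | 58, _ => mult (e₁e₁ := e₁) (e₁e₂ := half • e₂) (e₁f₁ := half • f₁) (e₁f₂ := half • f₂)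
  | 59, _ => mult (e₁e₁ := e₁) (e₁e₂ := half • e₂) (e₁f₁ := half • f₁) (e₁f₂ := f₂)
  | 60, _ => mult (e₁e₁ := e₁) (e₁e₂ := half • e₂) (e₁f₁ := half • f₁) (e₁f₂ := f₂) (f₁f₂ := e₂)
  | 61, _ => mult (e₁e₁ := e₁) (e₁e₂ := half • e₂) (e₁f₁ := half • f₁) (e₁f₂ := f₂) (e₂f₂ := f₁)
  | 62, _ => mult (e₁e₁ := e₁) (e₁e₂ := half • e₂) (e₁f₁ := half • f₁) (e₁f₂ := f₂) (e₂f₂ := f₁) (f₁f₂ := e₂)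
  | 63, _ => mult (e₁e₁ := e₁) (e₁e₂ := half • e₂) (e₁f₁ := half • f₁) (e₁f₂ := f₂) (e₂f₁ := f₂)
  | 64, _ => mult (e₁e₁ := e₁) (e₁e₂ := half • e₂) (e₁f₁ := half • f₁) (e₁f₂ := f₂) (e₂f₁ := f₂) (f₁f₂ := e₂)
  | 65, _ => mult (e₁e₁ := e₁) (e₁e₂ := half • e₂) (e₁f₁ := f₁) (e₁f₂ := f₂)
  | 66, _ => mult (e₁e₁ := e₂)
  | 67, _ => mult (e₁e₁ := e₂) (f₁f₂ := e₂)
  | 68, _ => mult (e₁e₁ := e₂) (f₁f₂ := e₁)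
  | 69, _ => mult (e₁e₁ := e₂) (e₂f₁ := f₂)
  | 70, _ => mult (e₁e₁ := e₂) (e₁f₁ := f₂)
  | 71, _ => mult (e₁e₁ := e₂) (e₁f₁ := f₂) (f₁f₂ := e₂)
  | _, _ => mult

/-- The superalgebras of the list: `𝒥 k t` is the `k`-th one for `1 ≤ k ≤ 71`; for `k = 16` it is
the member with parameter `t` of the one-parameter family, otherwise it does not depend on `t`. -/
def 𝒥 (k : ℕ) (t : ℂ) : Superalgebra (Model 2 2) := (table k t).alg

/-- The orbit dimensions `4² - dim Der` of the members of the list, by number (starting with a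
dummy value for number `0`). -/
def orbitDim (k : ℕ) : ℕ :=
  [0,
    12, 13, 13, 12, 13, 13, 10, 11, 13, 12, 13, 12, 12, 12, 10, 11,
    6, 7, 9, 10,
    7, 10, 11, 12, 10, 10, 9, 10, 10, 11, 11, 12, 12, 11, 12,
    11, 12, 11, 9, 10, 11, 12, 10, 7, 8, 10, 11, 10, 11,
    10, 9, 11, 11, 12, 11, 12, 12, 4, 9, 10, 10, 11, 11, 12, 10,
    6, 7, 10, 11, 8, 10].getD k 0

/-- `HasDecomposition S k` says that `S` decomposes as indicated in the list for number `k`: as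
the given direct sum, or that it is indecomposable. -/
def HasDecomposition {A : Type*} [AddCommGroup A] [Module ℂ A] (S : Superalgebra A) : ℕ → Prop
  | 1 => S.Isomorphic (U1.prod (U1.prod (S1_1.prod S1_1)))
  | 2 => S.Isomorphic (U1.prod (S2_2.prod S1_1))
  | 3 => S.Isomorphic (U1.prod (S2_1.prod S1_1))
  | 4 => S.Isomorphic (U1.prod S3_6)
  | 5 => S.Isomorphic (U1.prod S3_4)
  | 6 => S.Isomorphic (U1.prod S3_8)
  | 7 => S.Isomorphic (U1.prod S3_5)
  | 8 => S.Isomorphic (U1.prod S3_7)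
  | 9 => S.Isomorphic (S3_13.prod S1_1)
  | 10 => S.Isomorphic (S2_1.prod S2_2)
  | 12 => S.Isomorphic (S2_1.prod S2_1)
  | 14 => S.Isomorphic (S2_2.prod S2_2)
  | 17 => S.Isomorphic (U2.prod S3_2)
  | 18 => S.Isomorphic (U2.prod S3_3)
  | 20 => S.Isomorphic (U2.prod S3_1)
  | 21 => S.Isomorphic (U1.prod (U2.prod (S1_1.prod S1_1)))
  | 22 => S.Isomorphic (U1.prod S3_2)
  | 23 => S.Isomorphic (U1.prod S3_3)
  | 24 => S.Isomorphic (U1.prod S3_1)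
  | 25 => S.Isomorphic (U2.prod (S2_1.prod S1_1))
  | 26 => S.Isomorphic (U2.prod (S2_2.prod S1_1))
  | 27 => S.Isomorphic (U2.prod S3_5)
  | 29 => S.Isomorphic (U2.prod S3_7)
  | 33 => S.Isomorphic (U2.prod S3_4)
  | 34 => S.Isomorphic (U2.prod S3_6)
  | 35 => S.Isomorphic (U2.prod S3_8)
  | 36 => S.Isomorphic (B1.prod (S1_1.prod S1_1))
  | 37 => S.Isomorphic (S3_9.prod S1_1)
  | 38 => S.Isomorphic (S3_10.prod S1_1)
  | 50 => S.Isomorphic (B2.prod (S1_1.prod S1_1))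
  | 51 => S.Isomorphic (S3_11.prod S1_1)
  | 57 => S.Isomorphic (S3_12.prod S1_1)
  | 66 => S.Isomorphic (B3.prod (S1_1.prod S1_1))
  | _ => S.Indecomposable

end

end JordanSuper

/-! Completeness. The even part is a two-dimensional Jordan algebra, and degree-four power
associativity is enough to normalise it. If some even `x` is independent of `x²`, the even part is
spanned by `x, x²`. It is then the algebra of polynomials without constant term modulo a cubic `X(X²
- βX - α)`, and the roots of the cubic decide its shape. Otherwise every square is a multiple of its
root, and polarisation determines all products. So `exists_evenNormal` leaves the null algebra, `e₁²
= e₂`, two orthogonal idempotents, or an idempotent `e₁` with `e₁e₂ = κe₂`, `e₂² = 0`, `κ ∈ {0, 1/2,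
1}`.

An even idempotent acts on the odd part by an operator `E` with `2E³ - 3E² + E = 0`. Hence it is
diagonalisable with eigenvalues among `0, 1/2, 1` (`exists_eigenbasis`). The remaining structure
constants satisfy polynomial equations read off from the Jordan identity on basis vectors
(`tab_linear`, `tab_quadratic`, `tab_cubic`, `tab_odd_linear`, `tab_odd_mixed`). These are
Peirce-type rules and kill most constants. The basis element `e₂` with `e₂² = 0` acts on the odd
part with cube zero, so its operator has a Jordan basis whenever `e₁` acts as a scalar. Rescaling
over `ℂ` then turns the surviving constants into `0` or `1`. The only parameter that cannot be
scaled away is the ratio of the two coordinates of `f₁f₂` when both idempotents act as `1/2`. If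
there is no idempotent in the normal form, the nilpotent operators of `e₁` and `e₂` are normalised
in the same way (`listed_nilTab_zero`, `listed_nilTab_one`).

Distinctness and numerical data. For fixed coefficients depending on parities, the homogeneous maps
`D` with `αD(xy) = βD(x)y + γxD(y)` form a space whose dimension is an isomorphism invariant
(`finrank_genDer_eq`). For a table with half-integral constants this space is the kernel of an
integer matrix. Its dimension is therefore computable by a verified elimination
(`finrank_zeroSpace`, `finrank_genDer`). Six such dimensions, the first two being those of the even
and odd superderivations, separate all members outside the family; the first two also give the orbit
dimensions.

A decomposition into graded ideals gives an idempotent in the even centroid. If a rank computation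
shows that all even centroid maps are triangular with a single eigenvalue, such an idempotent is `0`
or the identity, so the algebra is indecomposable.

The family has a complex parameter and is treated by hand. Invariants that ignore products of odd
elements agree with those of number 15, which is excluded by its larger space of even derivations.
Inside the family an isomorphism either fixes or exchanges the two primitive idempotents, which
gives `s = t` or `st = 1`. -/

namespace JordanSuper

/-! ### Ranks of integer matrices -/

/-- The rank of an integer matrix with `n` columns, given by its rows, by fraction-free
elimination. -/
def rankZ : ℕ → List (List ℤ) → ℕ
  | 0, _ => 0
  | n + 1, rows => match rows.find? (fun r => decide (r.headD 0 ≠ 0)) with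
    | none => rankZ n (rows.map List.tail)
    | some p => rankZ n (rows.map fun r =>
        if r.headD 0 = 0 then r.tail else
        List.zipWith (fun a b => p.headD 0 * a - r.headD 0 * b) r.tail p.tail) + 1

/-- The value at `x` of the linear form with the given integer coefficients. -/
def evalRow {n : ℕ} (r : List ℤ) (x : Fin n → ℂ) : ℂ := ∑ i : Fin n, (r.getD i 0 : ℂ) * x i

/-- The space of common zeros of linear forms with integer coefficients. -/
def zeroSpace (n : ℕ) (rows : List (List ℤ)) : Submodule ℂ (Fin n → ℂ) where
  carrier := {x | ∀ r ∈ rows, evalRow r x = 0}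
  add_mem' := by
    intro x y hx hy r hr
    have h1 := hx r hr
    have h2 := hy r hr
    simp only [evalRow] at h1 h2 ⊢
    simp only [Pi.add_apply, mul_add, Finset.sum_add_distrib, h1, h2, add_zero]
  zero_mem' := by intro r _; simp [evalRow]
  smul_mem' := by
    intro c x hx r hr
    have h1 := hx r hr
    simp only [evalRow] at h1 ⊢
    simp only [Pi.smul_apply, smul_eq_mul, mul_left_comm _ c, ← Finset.mul_sum, h1, mul_zero]

theorem mem_zeroSpace {n : ℕ} {rows : List (List ℤ)} {x : Fin n → ℂ} :
    x ∈ zeroSpace n rows ↔ ∀ r ∈ rows, evalRow r x = 0 := Iff.rfl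

theorem evalRow_succ {n : ℕ} (r : List ℤ) (x : Fin (n + 1) → ℂ) :
    evalRow r x = (r.headD 0 : ℂ) * x 0 + evalRow r.tail (Fin.tail x) := by
  cases r <;> simp [evalRow, Fin.sum_univ_succ, Fin.tail]

theorem evalRow_zipWith {n : ℕ} {r p : List ℤ} (hr : r.length = n) (hp : p.length = n) (a b : ℤ)
    (x : Fin n → ℂ) : evalRow (List.zipWith (fun u v => a * u - b * v) r p) x
      = a * evalRow r x - b * evalRow p x := by
  simp only [evalRow, Finset.mul_sum, ← Finset.sum_sub_distrib]
  refine Finset.sum_congr rfl fun i _ => ?_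
  have h1 : (i : ℕ) < r.length := by omega
  have h2 : (i : ℕ) < p.length := by omega
  rw [List.getD_eq_getElem _ _ (by simp; omega), List.getD_eq_getElem _ _ h1,
    List.getD_eq_getElem _ _ h2, List.getElem_zipWith]
  push_cast
  ring

/-- Induction on the number of columns. Without a pivot the first coordinate is free and contributes
a factor `ℂ`. With a pivot row the first coordinate is a function of the others, so forgetting it is
an isomorphism onto the solutions of the eliminated system. -/
theorem finrank_zeroSpace (n : ℕ) (rows : List (List ℤ)) (h : ∀ r ∈ rows, r.length = n) :
    Module.finrank ℂ (zeroSpace n rows) + rankZ n rows = n := by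
  induction n generalizing rows with
  | zero => simp [rankZ, Module.finrank_zero_of_subsingleton]
  | succ n ih =>
    rw [rankZ]
    cases hf : rows.find? (fun r => decide (r.headD 0 ≠ 0)) with
    | none =>
      have h0 : ∀ r ∈ rows, r.headD 0 = 0 := by
        intro r hr
        simpa using List.find?_eq_none.1 hf r hr
      have hz : ∀ r ∈ rows, ∀ x : Fin (n + 1) → ℂ,
          evalRow r x = evalRow r.tail (Fin.tail x) := by
        intro r hr x
        rw [evalRow_succ, h0 r hr]
        simp
      have ih' := ih (rows.map List.tail) (by simp +contextual [h])
      let φ : zeroSpace (n + 1) rows ≃ₗ[ℂ] ℂ × zeroSpace n (rows.map List.tail) :=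
        { toFun := fun x => (x.1 0, ⟨Fin.tail x.1, by
            rw [mem_zeroSpace, List.forall_mem_map]
            intro r hr
            rw [← hz r hr]
            exact x.2 r hr⟩)
          map_add' := fun x y => rfl
          map_smul' := fun c x => rfl
          invFun := fun y => ⟨Fin.cons y.1 y.2.1, by
            intro r hr
            rw [hz r hr, Fin.tail_cons]
            exact (List.forall_mem_map.1 y.2.2) r hr⟩
          left_inv := fun x => Subtype.ext (Fin.cons_self_tail _)
          right_inv := fun y => by simp }
      have := φ.finrank_eq
      rw [Module.finrank_prod, Module.finrank_self] at this
      simp only [this]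
      omega
    | some p =>
      have hp := List.mem_of_find?_eq_some hf
      have hp0 : p.headD 0 ≠ 0 := by simpa using List.find?_some hf
      have hp0' : (p.headD 0 : ℂ) ≠ 0 := by exact_mod_cast hp0
      set q : List ℤ → List ℤ := fun r => if r.headD 0 = 0 then r.tail else
        List.zipWith (fun a b => p.headD 0 * a - r.headD 0 * b) r.tail p.tail with hq
      have hlen : ∀ r ∈ rows, r.tail.length = n := fun r hr => by simp [h r hr]
      -- Modulo the pivot equation, an eliminated row is a row of the original system up to the
      -- nonzero pivot entry, so no solutions are gained or lost.
      have key : ∀ r ∈ rows, ∀ x : Fin (n + 1) → ℂ, evalRow p x = 0 →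
          (evalRow r x = 0 ↔ evalRow (q r) (Fin.tail x) = 0) := by
        intro r hr x hx
        by_cases hr0 : r.headD 0 = 0
        · rw [evalRow_succ]
          simp only [hq, hr0, if_true]
          simp
        · simp only [hq, hr0, if_false]
          rw [evalRow_zipWith (hlen r hr) (hlen p hp)]
          have e : (p.headD 0 : ℂ) * evalRow r.tail (Fin.tail x)
              - r.headD 0 * evalRow p.tail (Fin.tail x) = p.headD 0 * evalRow r x := by
            rw [evalRow_succ] at hx
            rw [evalRow_succ]
            linear_combination (-(r.headD 0 : ℂ)) * hx
          rw [e, mul_eq_zero, or_iff_right hp0']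
      -- The first coordinate that solves the pivot equation when the others are prescribed.
      have hsol : ∀ y : Fin n → ℂ, evalRow p (Fin.cons (-(evalRow p.tail y) / p.headD 0) y :
          Fin (n + 1) → ℂ) = 0 := by
        intro y
        rw [evalRow_succ, Fin.tail_cons, Fin.cons_zero]
        field_simp
        ring
      have ih' := ih (rows.map q) (by
        rw [List.forall_mem_map]
        intro r hr
        simp only [hq]
        split_ifs
        · exact hlen r hr
        · rw [List.length_zipWith, hlen r hr, hlen p hp, min_self])
      let φ : zeroSpace (n + 1) rows ≃ₗ[ℂ] zeroSpace n (rows.map q) :=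
        { toFun := fun x => ⟨Fin.tail x.1, by
            rw [mem_zeroSpace, List.forall_mem_map]
            exact fun r hr => (key r hr _ (x.2 p hp)).1 (x.2 r hr)⟩
          map_add' := fun x y => rfl
          map_smul' := fun c x => rfl
          invFun := fun y => ⟨Fin.cons (-(evalRow p.tail y.1) / p.headD 0) y.1, by
            intro r hr
            rw [key r hr _ (hsol _), Fin.tail_cons]
            exact (List.forall_mem_map.1 y.2) r hr⟩
          left_inv := fun x => by
            apply Subtype.ext
            have hx := x.2 p hp
            rw [evalRow_succ] at hx
            have : -(evalRow p.tail (Fin.tail x.1)) / p.headD 0 = x.1 0 := by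
              field_simp
              linear_combination -hx
            simp only [this]
            exact Fin.cons_self_tail _
          right_inv := fun y => by simp }
      rw [φ.finrank_eq]
      change _ + (rankZ n (rows.map q) + 1) = _
      omega

/-- If adding linear forms does not raise the rank, they vanish on the common zeros of the
others. -/
theorem evalRow_eq_zero_of_rankZ {n : ℕ} {rows extra : List (List ℤ)}
    (h : ∀ r ∈ rows, r.length = n) (h' : ∀ r ∈ extra, r.length = n)
    (hr : rankZ n (extra ++ rows) = rankZ n rows) {x : Fin n → ℂ} (hx : x ∈ zeroSpace n rows) :
    ∀ r ∈ extra, evalRow r x = 0 := by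
  have h1 := finrank_zeroSpace n rows h
  have h2 := finrank_zeroSpace n (extra ++ rows) (by
    intro r hr
    rcases List.mem_append.1 hr with hr | hr
    exacts [h' r hr, h r hr])
  have hle : zeroSpace n (extra ++ rows) ≤ zeroSpace n rows :=
    fun y hy r hr => hy r (List.mem_append_right _ hr)
  have := Submodule.eq_of_le_of_finrank_eq hle (by omega)
  intro r hr
  rw [← this] at hx
  exact hx r (List.mem_append_left _ hr)

end JordanSuper

namespace JordanSuper

/-! ### Superalgebras of type `(2, 2)` in coordinates -/

/-- The basis vectors `e₁, e₂` (for `g = 0`) and `f₁, f₂` (for `g = 1`) of the model space. -/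
def bas (g : ZMod 2) (i : Fin 2) : Model 2 2 :=
  if g = 0 then (Pi.single i 1, 0) else (0, Pi.single i 1)

/-- The coordinate functions dual to `bas`. -/
def coord (g : ZMod 2) (i : Fin 2) : Model 2 2 →ₗ[ℂ] ℂ :=
  if g = 0 then LinearMap.proj i ∘ₗ LinearMap.fst ℂ _ _ else LinearMap.proj i ∘ₗ LinearMap.snd ℂ _ _

theorem zmod_two_cases : ∀ g : ZMod 2, g = 0 ∨ g = 1 := by decide

theorem coord_bas (g h : ZMod 2) (i j : Fin 2) :
    coord g i (bas h j) = if g = h ∧ i = j then 1 else 0 := by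
  rcases zmod_two_cases g with rfl | rfl <;> rcases zmod_two_cases h with rfl | rfl <;>
    simp [coord, bas, Pi.single_apply]

theorem sum_zmod_two {M : Type*} [AddCommMonoid M] (f : ZMod 2 → M) : ∑ g, f g = f 0 + f 1 :=
  Fin.sum_univ_two f

theorem eq_sum_bas (x : Model 2 2) : x = ∑ g, ∑ i, coord g i x • bas g i := by
  rw [sum_zmod_two]
  ext i <;> fin_cases i <;> simp [coord, bas, Fin.sum_univ_two]

theorem ext_bas {M : Type*} [AddCommGroup M] [Module ℂ M] {D E : Model 2 2 →ₗ[ℂ] M}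
    (h : ∀ g i, D (bas g i) = E (bas g i)) : D = E := by
  ext1
  all_goals
    apply LinearMap.pi_ext'
    intro i
    ext
  · simpa [bas] using h 0 i
  · simpa [bas] using h 1 i

theorem sum_smul_bas_eq_zero {g : ZMod 2} {a : Fin 2 → ℂ} :
    ∑ k, a k • bas g k = 0 ↔ ∀ k, a k = 0 := by
  constructor
  · intro h k
    have := congrArg (coord g k) h
    fin_cases k <;> simpa [coord_bas] using this
  · intro h
    simp [h]

theorem mem_part_iff (c : Table 2 2) (g : ZMod 2) (x : Model 2 2) :
    x ∈ c.alg.part g ↔ x = coord g 0 x • bas g 0 + coord g 1 x • bas g 1 := by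
  rcases zmod_two_cases g with rfl | rfl <;>
    simp [Table.alg, coord, bas, Submodule.mem_prod, Prod.ext_iff, funext_iff, Fin.forall_fin_two]

theorem bas_mem (c : Table 2 2) (g : ZMod 2) (i : Fin 2) : bas g i ∈ c.alg.part g := by
  rcases zmod_two_cases g with rfl | rfl <;> simp [Table.alg, bas, Submodule.mem_prod]

/-- The structure constants of a multiplication table: the coordinates of the product of two
basis vectors of parities `g` and `h`. -/
def Table.coef (c : Table 2 2) (g h : ZMod 2) (i j k : Fin 2) : ℂ :=
  if g = 0 then if h = 0 then c.ee i j k else c.ef i j k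
  else if h = 0 then c.ef j i k else c.ff i j k

theorem mul_bas (c : Table 2 2) (g h : ZMod 2) (i j : Fin 2) :
    c.alg.mul (bas g i) (bas h j) = ∑ k, c.coef g h i j k • bas (g + h) k := by
  have h2 : (1 + 1 : ZMod 2) = 0 := by decide
  have hs : ∀ v : Fin 2 → ℂ, v 0 • (Pi.single 0 1 : Fin 2 → ℂ) + v 1 • Pi.single 1 1 = v := by
    intro v
    ext k
    fin_cases k <;> simp
  rcases zmod_two_cases g with rfl | rfl <;> rcases zmod_two_cases h with rfl | rfl <;>
    fin_cases i <;> fin_cases j <;>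
    simp [Table.alg, bas, Table.coef, Fin.sum_univ_two, h2, hs]

/-! ### Generalized derivations -/

/-- The data of a space of generalized derivations: a parity and three families of
coefficients. -/
structure Spec where
  d : ZMod 2
  α : ZMod 2 → ZMod 2 → ℤ
  β : ZMod 2 → ZMod 2 → ℤ
  γ : ZMod 2 → ZMod 2 → ℤ

section

variable {A : Type*} [AddCommGroup A] [Module ℂ A] {B : Type*} [AddCommGroup B] [Module ℂ B]

/-- The linear maps `D` of parity `d` with `α D(xy) = β D(x)y + γ xD(y)` for homogeneous `x`, `y`,
where the coefficients depend on the parities of `x` and `y`. -/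
def Superalgebra.genDer (S : Superalgebra A) (s : Spec) : Submodule ℂ (A →ₗ[ℂ] A) where
  carrier := {D | (∀ g, ∀ x ∈ S.part g, D x ∈ S.part (g + s.d)) ∧
    ∀ g h, ∀ x ∈ S.part g, ∀ y ∈ S.part h,
      (s.α g h : ℂ) • D (S.mul x y)
        = (s.β g h : ℂ) • S.mul (D x) y + (s.γ g h : ℂ) • S.mul x (D y)}
  add_mem' := by
    intro D E hD hE
    refine ⟨fun g x hx => add_mem (hD.1 g x hx) (hE.1 g x hx), fun g h x hx y hy => ?_⟩
    have h1 := hD.2 g h x hx y hy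
    have h2 := hE.2 g h x hx y hy
    simp only [LinearMap.add_apply, map_add, smul_add, h1, h2]
    abel
  zero_mem' := by
    refine ⟨fun g x hx => ?_, fun g h x hx y hy => ?_⟩ <;> simp
  smul_mem' := by
    intro c D hD
    refine ⟨fun g x hx => Submodule.smul_mem _ c (hD.1 g x hx), fun g h x hx y hy => ?_⟩
    have h1 := hD.2 g h x hx y hy
    simp only [LinearMap.smul_apply, map_smul]
    rw [smul_comm _ c, h1, smul_add, smul_comm _ c, smul_comm _ c]

theorem Superalgebra.mem_genDer {S : Superalgebra A} {s : Spec} {D : A →ₗ[ℂ] A} :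
    D ∈ S.genDer s ↔ (∀ g, ∀ x ∈ S.part g, D x ∈ S.part (g + s.d)) ∧
    ∀ g h, ∀ x ∈ S.part g, ∀ y ∈ S.part h,
      (s.α g h : ℂ) • D (S.mul x y)
        = (s.β g h : ℂ) • S.mul (D x) y + (s.γ g h : ℂ) • S.mul x (D y) := Iff.rfl

theorem Superalgebra.Isomorphic.symm {S : Superalgebra A} {T : Superalgebra B}
    (h : S.Isomorphic T) : T.Isomorphic S := by
  obtain ⟨φ, hm, hp⟩ := h
  refine ⟨φ.symm, fun x y => ?_, fun i => ?_⟩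
  · rw [LinearEquiv.symm_apply_eq, hm]
    simp
  · rw [← hp i]
    ext x
    simp

theorem Superalgebra.Isomorphic.trans {C : Type*} [AddCommGroup C] [Module ℂ C]
    {S : Superalgebra A} {T : Superalgebra B} {U : Superalgebra C}
    (h : S.Isomorphic T) (h' : T.Isomorphic U) : S.Isomorphic U := by
  obtain ⟨φ, hm, hp⟩ := h
  obtain ⟨ψ, hm', hp'⟩ := h'
  refine ⟨φ.trans ψ, fun x y => by simp [hm, hm'], fun i => ?_⟩
  rw [← hp' i, ← hp i, ← Submodule.map_comp]
  rfl

theorem Superalgebra.Isomorphic.refl (S : Superalgebra A) : S.Isomorphic S :=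
  ⟨LinearEquiv.refl ℂ A, fun _ _ => rfl, fun i => by simp⟩

theorem Superalgebra.conj_mem_genDer {S : Superalgebra A} {T : Superalgebra B} {s : Spec}
    {φ : A ≃ₗ[ℂ] B} (hm : ∀ x y, φ (S.mul x y) = T.mul (φ x) (φ y))
    (hp : ∀ i, (S.part i).map (φ : A →ₗ[ℂ] B) = T.part i) {D : A →ₗ[ℂ] A}
    (hD : D ∈ S.genDer s) : φ.conj D ∈ T.genDer s := by
  have hmem : ∀ {g x}, x ∈ S.part g → φ x ∈ T.part g := fun {g x} hx => by
    rw [← hp g]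
    exact Submodule.mem_map_of_mem hx
  have hmem' : ∀ {g x}, x ∈ T.part g → φ.symm x ∈ S.part g := fun {g x} hx => by
    rw [← hp g] at hx
    obtain ⟨y, hy, rfl⟩ := hx
    simpa using hy
  have hm' : ∀ x y, φ.symm (T.mul x y) = S.mul (φ.symm x) (φ.symm y) := fun x y => by
    rw [LinearEquiv.symm_apply_eq, hm]
    simp
  refine ⟨fun g x hx => ?_, fun g h x hx y hy => ?_⟩
  · rw [LinearEquiv.conj_apply_apply]
    exact hmem (hD.1 g _ (hmem' hx))
  · have h1 := congrArg φ (hD.2 g h _ (hmem' hx) _ (hmem' hy))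
    simp only [map_add, map_smul, hm, LinearEquiv.apply_symm_apply] at h1
    simp only [LinearEquiv.conj_apply_apply, hm', h1]

/-- Conjugation by an isomorphism carries one space onto the other. This makes every choice of
coefficients a source of numerical invariants. -/
theorem Superalgebra.Isomorphic.finrank_genDer_eq {S : Superalgebra A} {T : Superalgebra B}
    (h : S.Isomorphic T) (s : Spec) :
    Module.finrank ℂ (S.genDer s) = Module.finrank ℂ (T.genDer s) := by
  obtain ⟨φ, hm, hp⟩ := h
  have : (S.genDer s).map (φ.conj : (A →ₗ[ℂ] A) →ₗ[ℂ] (B →ₗ[ℂ] B)) = T.genDer s := by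
    ext D
    constructor
    · rintro ⟨E, hE, rfl⟩
      exact conj_mem_genDer hm hp hE
    · intro hD
      refine ⟨φ.symm.conj D, conj_mem_genDer (φ := φ.symm) (fun x y => ?_) (fun i => ?_) hD, ?_⟩
      · rw [LinearEquiv.symm_apply_eq, hm]
        simp
      · rw [← hp i]
        ext x
        simp
      · ext x
        simp
  rw [← this]
  exact (LinearEquiv.finrank_map_eq φ.conj _).symm

end

/-- Position of the entry of a homogeneous linear map that gives the coefficient of the `l`-th
basis vector in the image of the `i`-th one of parity `g`. -/
def pos (g : ZMod 2) (l i : Fin 2) : Fin 8 :=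
  ⟨4 * g.val + 2 * l.val + i.val, by
    have := g.val_lt
    omega⟩

/-- The linear map of parity `d` with the given entries. -/
def ofEntries (d : ZMod 2) : (Fin 8 → ℂ) →ₗ[ℂ] Model 2 2 →ₗ[ℂ] Model 2 2 :=
  ∑ g, ∑ i, ∑ l, (LinearMap.proj (pos g l i)).smulRight ((coord g i).smulRight (bas (g + d) l))

theorem ofEntries_bas (d : ZMod 2) (x : Fin 8 → ℂ) (g : ZMod 2) (i : Fin 2) :
    ofEntries d x (bas g i) = ∑ l, x (pos g l i) • bas (g + d) l := by
  rcases zmod_two_cases g with rfl | rfl <;> fin_cases i <;>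
    simp [ofEntries, sum_zmod_two, Fin.sum_univ_two, coord_bas]

theorem ofEntries_injective (d : ZMod 2) : Function.Injective (ofEntries d) := by
  rw [← LinearMap.ker_eq_bot, LinearMap.ker_eq_bot']
  intro x hx
  have : ∀ g l i, x (pos g l i) = 0 := fun g l i => by
    have h1 := ofEntries_bas d x g i
    rw [hx, LinearMap.zero_apply, eq_comm, sum_smul_bas_eq_zero] at h1
    exact h1 l
  have hs : ∀ n : Fin 8, ∃ g l i, n = pos g l i := by decide
  ext n
  obtain ⟨g, l, i, rfl⟩ := hs n
  exact this g l i

theorem exists_ofEntries {c : Table 2 2} {d : ZMod 2} {D : Model 2 2 →ₗ[ℂ] Model 2 2}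
    (h : ∀ g, ∀ x ∈ c.alg.part g, D x ∈ c.alg.part (g + d)) : ∃ x, ofEntries d x = D := by
  -- A left inverse of `pos`: the binary digits of a position are the parity, the row and the
  -- column.
  have hp : ∃ f : Fin 8 → ZMod 2 × Fin 2 × Fin 2, ∀ g l i, f (pos g l i) = (g, l, i) :=
    ⟨fun n => (((n.val / 4 : ℕ) : ZMod 2), ⟨n.val / 2 % 2, by omega⟩, ⟨n.val % 2, by omega⟩),
      by decide⟩
  obtain ⟨f, hf⟩ := hp
  refine ⟨fun n => coord ((f n).1 + d) (f n).2.1 (D (bas (f n).1 (f n).2.2)), ext_bas ?_⟩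
  intro g i
  rw [ofEntries_bas]
  simp only [hf, Fin.sum_univ_two]
  exact ((mem_part_iff c _ _).1 (h g _ (bas_mem c g i))).symm

theorem ofEntries_mem_part (c : Table 2 2) (d : ZMod 2) (x : Fin 8 → ℂ) (g : ZMod 2)
    (v : Model 2 2) (hv : v ∈ c.alg.part g) : ofEntries d x v ∈ c.alg.part (g + d) := by
  rw [(mem_part_iff c g v).1 hv]
  simp only [map_add, map_smul, ofEntries_bas]
  refine add_mem (Submodule.smul_mem _ _ (sum_mem fun l _ => Submodule.smul_mem _ _ ?_))
    (Submodule.smul_mem _ _ (sum_mem fun l _ => Submodule.smul_mem _ _ ?_)) <;>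
  exact bas_mem c _ l

/-- Membership in a space of generalized derivations in terms of entries. -/
theorem ofEntries_mem_genDer (c : Table 2 2) (s : Spec) (x : Fin 8 → ℂ) :
    ofEntries s.d x ∈ c.alg.genDer s ↔ ∀ g h i j k,
      s.α g h * ∑ l, c.coef g h i j l * x (pos (g + h) k l)
        - s.β g h * ∑ l, c.coef (g + s.d) h l j k * x (pos g l i)
        - s.γ g h * ∑ l, c.coef g (h + s.d) i l k * x (pos h l j) = 0 := by
  rw [Superalgebra.mem_genDer, and_iff_right (ofEntries_mem_part c s.d x)]
  -- The defect of the identity on two basis vectors, expanded in the basis of the parity component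
  -- in which it lies. By bilinearity these defects decide membership.
  have hb : ∀ g h i j,
      (s.α g h : ℂ) • ofEntries s.d x (c.alg.mul (bas g i) (bas h j))
        - ((s.β g h : ℂ) • c.alg.mul (ofEntries s.d x (bas g i)) (bas h j)
          + (s.γ g h : ℂ) • c.alg.mul (bas g i) (ofEntries s.d x (bas h j)))
      = ∑ k, (s.α g h * ∑ l, c.coef g h i j l * x (pos (g + h) k l)
        - s.β g h * ∑ l, c.coef (g + s.d) h l j k * x (pos g l i)
        - s.γ g h * ∑ l, c.coef g (h + s.d) i l k * x (pos h l j)) • bas (g + h + s.d) k := by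
    intro g h i j
    have e1 : g + s.d + h = g + h + s.d := by ring
    have e2 : g + (h + s.d) = g + h + s.d := by ring
    simp only [mul_bas, ofEntries_bas, map_add, map_smul, LinearMap.add_apply,
      LinearMap.smul_apply, e1, e2, Fin.sum_univ_two]
    module
  constructor
  · intro h g h' i j
    rw [← sum_smul_bas_eq_zero (g := g + h' + s.d), ← hb, sub_eq_zero]
    exact h g h' _ (bas_mem c g i) _ (bas_mem c h' j)
  · intro H g h v hv w hw
    have hb' : ∀ i j, (s.α g h : ℂ) • ofEntries s.d x (c.alg.mul (bas g i) (bas h j))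
        = (s.β g h : ℂ) • c.alg.mul (ofEntries s.d x (bas g i)) (bas h j)
          + (s.γ g h : ℂ) • c.alg.mul (bas g i) (ofEntries s.d x (bas h j)) := by
      intro i j
      rw [← sub_eq_zero, hb, sum_smul_bas_eq_zero]
      exact H g h i j
    rw [(mem_part_iff c g v).1 hv, (mem_part_iff c h w).1 hw]
    generalize coord g 0 v = v0, coord g 1 v = v1, coord h 0 w = w0, coord h 1 w = w1

    simp only [map_add, map_smul, LinearMap.add_apply, LinearMap.smul_apply]
    linear_combination (norm := module) (v0 * w0) • hb' 0 0 + (v0 * w1) • hb' 0 1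
      + (v1 * w0) • hb' 1 0 + (v1 * w1) • hb' 1 1

end JordanSuper

namespace JordanSuper

/-! ### Multiplication tables with half-integral structure constants -/

/-- The structure constants, times two, of the product with the given doubled coordinates of
`e₁e₁`, `e₁e₂`, `e₂e₂`, `e₁f₁`, `e₁f₂`, `e₂f₁`, `e₂f₂`, `f₁f₂`. -/
def icoef (L : List ℤ) (g h : ZMod 2) (i j k : Fin 2) : ℤ :=
  match (g : Fin 2), (h : Fin 2) with
  -- By symmetry an even product depends only on `i + j`, so three slots of length two suffice.
  | 0, 0 => L.getD (2 * (i + j : ℕ) + k) 0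
  | 0, 1 => L.getD (6 + 4 * i + 2 * j + k) 0
  | 1, 0 => L.getD (6 + 4 * j + 2 * i + k) 0
  | 1, 1 => if i = j then 0 else if i = 0 then L.getD (14 + k) 0 else - L.getD (14 + k) 0

/-- The vector with the doubled coordinates at positions `n`, `n + 1` of a list. -/
noncomputable def halfVec (L : List ℤ) (n : ℕ) : Fin 2 → ℂ :=
  ![(L.getD n 0 : ℂ) / 2, (L.getD (n + 1) 0 : ℂ) / 2]

theorem two_mul_halfVec (L : List ℤ) (n : ℕ) (k : Fin 2) :
    2 * halfVec L n k = (L.getD (n + k) 0 : ℂ) := by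
  fin_cases k <;> simp [halfVec, mul_div_cancel₀]

/-- The multiplication table with the given doubled coordinates. -/
noncomputable def tableOf (L : List ℤ) : Table 2 2 :=
  mult (halfVec L 0) (halfVec L 2) (halfVec L 4) (halfVec L 6) (halfVec L 8) (halfVec L 10)
    (halfVec L 12) (halfVec L 14)

theorem icoef_eq (L : List ℤ) (g h : ZMod 2) (i j k : Fin 2) :
    (icoef L g h i j k : ℂ) = 2 * (tableOf L).coef g h i j k := by
  rcases zmod_two_cases g with rfl | rfl <;> rcases zmod_two_cases h with rfl | rfl <;>
    fin_cases i <;> fin_cases j <;>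
    simp [icoef, Table.coef, tableOf, mult, two_mul_halfVec]

/-- The triples of a parity and two indices, in the order of `pos`. -/
def entryList : List (ZMod 2 × Fin 2 × Fin 2) :=
  [(0, 0, 0), (0, 0, 1), (0, 1, 0), (0, 1, 1), (1, 0, 0), (1, 0, 1), (1, 1, 0), (1, 1, 1)]

theorem mem_entryList : ∀ p, p ∈ entryList := by decide

/-- The coefficients of one of the linear equations for the entries of a generalized
derivation. -/
def row (L : List ℤ) (s : Spec) (g h : ZMod 2) (i j k : Fin 2) : List ℤ :=
  entryList.map fun (g', l, m) =>
    (if g' = g + h ∧ l = k then s.α g h * icoef L g h i j m else 0)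
    - (if g' = g ∧ m = i then s.β g h * icoef L (g + s.d) h l j k else 0)
    - (if g' = h ∧ m = j then s.γ g h * icoef L g (h + s.d) i l k else 0)

/-- The linear equations for the entries of a generalized derivation. -/
def rowsOf (L : List ℤ) (s : Spec) : List (List ℤ) :=
  entryList.flatMap fun (g, i, j) => [(0, 0), (0, 1), (1, 0), (1, 1)].map fun (h, k) =>
    row L s g h i j k

theorem length_of_mem_rowsOf {L : List ℤ} {s : Spec} {r : List ℤ} (h : r ∈ rowsOf L s) :
    r.length = 8 := by
  simp only [rowsOf, List.mem_flatMap, List.mem_map] at h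
  obtain ⟨_, _, _, _, rfl⟩ := h
  rfl

theorem mem_rowsOf {L : List ℤ} {s : Spec} {r : List ℤ} :
    r ∈ rowsOf L s ↔ ∃ g h i j k, r = row L s g h i j k := by
  have hm : ∀ p : ZMod 2 × Fin 2, p ∈ ([(0, 0), (0, 1), (1, 0), (1, 1)] : List _) := by decide
  simp only [rowsOf, List.mem_flatMap, List.mem_map]
  constructor
  · rintro ⟨⟨g, i, j⟩, _, ⟨h, k⟩, _, rfl⟩
    exact ⟨g, h, i, j, k, rfl⟩
  · rintro ⟨g, h, i, j, k, rfl⟩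
    exact ⟨⟨g, i, j⟩, mem_entryList _, ⟨h, k⟩, hm _, rfl⟩

theorem evalRow_map (f : ZMod 2 × Fin 2 × Fin 2 → ℤ) (x : Fin 8 → ℂ) :
    evalRow (entryList.map f) x = ∑ g, ∑ l, ∑ i, (f (g, l, i) : ℂ) * x (pos g l i) := by
  simp only [evalRow, entryList, Fin.sum_univ_eight, sum_zmod_two, Fin.sum_univ_two, List.map]
  have h1 : ZMod.val (1 : ZMod 2) = 1 := rfl
  simp [pos, h1]
  ring

theorem evalRow_row (L : List ℤ) (s : Spec) (g h : ZMod 2) (i j k : Fin 2) (x : Fin 8 → ℂ) :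
    evalRow (row L s g h i j k) x
      = 2 * (s.α g h * ∑ l, (tableOf L).coef g h i j l * x (pos (g + h) k l)
        - s.β g h * ∑ l, (tableOf L).coef (g + s.d) h l j k * x (pos g l i)
        - s.γ g h * ∑ l, (tableOf L).coef g (h + s.d) i l k * x (pos h l j)) := by
  rw [row, evalRow_map]
  have h1 : ∀ (g₀ : ZMod 2) (k₀ : Fin 2) (F : Fin 2 → ℂ), ∑ g', ∑ l : Fin 2, ∑ m : Fin 2,
      (if g' = g₀ ∧ l = k₀ then F m else 0) * x (pos g' l m) = ∑ m, F m * x (pos g₀ k₀ m) := by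
    intro g₀ k₀ F
    rcases zmod_two_cases g₀ with rfl | rfl <;> fin_cases k₀ <;>
      simp [Fin.sum_univ_two]
  have h2 : ∀ (g₀ : ZMod 2) (k₀ : Fin 2) (F : Fin 2 → ℂ), ∑ g', ∑ l : Fin 2, ∑ m : Fin 2,
      (if g' = g₀ ∧ m = k₀ then F l else 0) * x (pos g' l m) = ∑ l, F l * x (pos g₀ l k₀) := by
    intro g₀ k₀ F
    rcases zmod_two_cases g₀ with rfl | rfl <;> fin_cases k₀ <;>
      simp [Fin.sum_univ_two]
  push_cast
  simp only [sub_mul, Finset.sum_sub_distrib, icoef_eq, h1, h2, Finset.mul_sum, mul_sub]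
  congr 1
  · congr 1 <;> refine Finset.sum_congr rfl fun l _ => ?_ <;> ring
  · refine Finset.sum_congr rfl fun l _ => ?_
    ring

/-- The integer rows are twice the true equations, since the constants are stored doubled; over `ℂ`
this changes nothing. -/
theorem genDer_eq_map (L : List ℤ) (s : Spec) :
    (tableOf L).alg.genDer s = (zeroSpace 8 (rowsOf L s)).map (ofEntries s.d) := by
  have key : ∀ x, ofEntries s.d x ∈ (tableOf L).alg.genDer s ↔ x ∈ zeroSpace 8 (rowsOf L s) := by
    intro x
    rw [ofEntries_mem_genDer, mem_zeroSpace]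
    simp only [mem_rowsOf]
    constructor
    · rintro H r ⟨g, h, i, j, k, rfl⟩
      rw [evalRow_row, H, mul_zero]
    · intro H g h i j k
      have := H _ ⟨g, h, i, j, k, rfl⟩
      rw [evalRow_row] at this
      exact (mul_eq_zero.1 this).resolve_left two_ne_zero
  ext D
  constructor
  · intro hD
    obtain ⟨x, rfl⟩ := exists_ofEntries hD.1
    exact ⟨x, (key x).1 hD, rfl⟩
  · rintro ⟨x, hx, rfl⟩
    exact (key x).2 hx

/-- The homogeneous maps of a fixed parity have eight entries, so the integer rank is the
codimension of the space. -/
theorem finrank_genDer (L : List ℤ) (s : Spec) :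
    Module.finrank ℂ ((tableOf L).alg.genDer s) + rankZ 8 (rowsOf L s) = 8 := by
  rw [genDer_eq_map, ← LinearEquiv.finrank_eq
    (Submodule.equivMapOfInjective _ (ofEntries_injective s.d) _)]
  exact finrank_zeroSpace 8 (rowsOf L s) fun r => length_of_mem_rowsOf

/-! ### The Jordan identity on basis vectors -/

/-- For fixed parities the signs are constants and both identities are multilinear, so they may be
checked on homogeneous bases, extending one argument at a time. -/
theorem Superalgebra.isJordan_of_basis {A : Type*} [AddCommGroup A] [Module ℂ A]
    {S : Superalgebra A} (b : ZMod 2 → Fin 2 → A)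
    (hb : ∀ g, ∀ x ∈ S.part g, ∃ v w : ℂ, x = v • b g 0 + w • b g 1)
    (hc : ∀ g h i j, S.mul (b g i) (b h j) = sign (g * h) • S.mul (b h j) (b g i))
    (hj : ∀ i j k l p q r s,
      S.mul (S.mul (S.mul (b i p) (b j q)) (b k r)) (b l s)
        + sign (j * k + j * l + k * l) • S.mul (S.mul (S.mul (b i p) (b l s)) (b k r)) (b j q)
        + sign (i * j + i * k + i * l + k * l) •
          S.mul (S.mul (S.mul (b j q) (b l s)) (b k r)) (b i p)
      = S.mul (S.mul (b i p) (b j q)) (S.mul (b k r) (b l s))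
        + sign (l * (j + k)) • S.mul (S.mul (b i p) (b l s)) (S.mul (b j q) (b k r))
        + sign (j * k) • S.mul (S.mul (b i p) (b k r)) (S.mul (b j q) (b l s))) : S.IsJordan := by
  constructor
  · intro g h x hx y hy
    obtain ⟨v, w, rfl⟩ := hb g x hx
    obtain ⟨v', w', rfl⟩ := hb h y hy
    simp only [map_add, map_smul, LinearMap.add_apply, LinearMap.smul_apply]
    linear_combination (norm := module) (v * v') • hc g h 0 0 + (v * w') • hc g h 0 1
      + (w * v') • hc g h 1 0 + (w * w') • hc g h 1 1
  · intro i j k l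
    have h1 := hj i j k l
    -- Only multilinearity matters from here on, not the values of the signs.
    generalize sign (j * k + j * l + k * l) = a₁, sign (i * j + i * k + i * l + k * l) = a₂,
      sign (l * (j + k)) = a₃, sign (j * k) = a₄ at h1 ⊢
    let P : A → A → A → A → Prop := fun x y z t =>
      S.mul (S.mul (S.mul x y) z) t + a₁ • S.mul (S.mul (S.mul x t) z) y
        + a₂ • S.mul (S.mul (S.mul y t) z) x
      = S.mul (S.mul x y) (S.mul z t) + a₃ • S.mul (S.mul x t) (S.mul y z)
        + a₄ • S.mul (S.mul x z) (S.mul y t)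
    have h2 : ∀ x ∈ S.part i, ∀ q r s, P x (b j q) (b k r) (b l s) := by
      intro x hx q r s
      obtain ⟨v, w, rfl⟩ := hb i x hx
      simp only [P, map_add, map_smul, LinearMap.add_apply, LinearMap.smul_apply]
      linear_combination (norm := module) v • h1 0 q r s + w • h1 1 q r s
    have h3 : ∀ x ∈ S.part i, ∀ y ∈ S.part j, ∀ r s, P x y (b k r) (b l s) := by
      intro x hx y hy r s
      obtain ⟨v, w, rfl⟩ := hb j y hy
      have e₁ := h2 x hx 0 r s
      have e₂ := h2 x hx 1 r s
      simp only [P, map_add, map_smul, LinearMap.add_apply, LinearMap.smul_apply] at e₁ e₂ ⊢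
      linear_combination (norm := module) v • e₁ + w • e₂
    have h4 : ∀ x ∈ S.part i, ∀ y ∈ S.part j, ∀ z ∈ S.part k, ∀ s, P x y z (b l s) := by
      intro x hx y hy z hz s
      obtain ⟨v, w, rfl⟩ := hb k z hz
      have e₁ := h3 x hx y hy 0 s
      have e₂ := h3 x hx y hy 1 s
      simp only [P, map_add, map_smul, LinearMap.add_apply, LinearMap.smul_apply] at e₁ e₂ ⊢
      linear_combination (norm := module) v • e₁ + w • e₂
    intro x hx y hy z hz t ht
    obtain ⟨v, w, rfl⟩ := hb l t ht
    have e₁ := h4 x hx y hy z hz 0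
    have e₂ := h4 x hx y hy z hz 1
    simp only [P, map_add, map_smul, LinearMap.add_apply, LinearMap.smul_apply] at e₁ e₂ ⊢
    linear_combination (norm := module) v • e₁ + w • e₂

/-- The product of two integers, in a form that does not evaluate the second factor if the first
one is zero. -/
def lazyMul (a b : ℤ) : ℤ := if a = 0 then 0 else a * b

theorem lazyMul_eq (a b : ℤ) : lazyMul a b = a * b := by
  rw [lazyMul]
  split_ifs with h <;> simp [h]

/-- The sign of a parity as an integer. -/
def isign (i : ZMod 2) : ℤ := if i = 0 then 1 else -1

theorem isign_eq (i : ZMod 2) : (isign i : ℂ) = sign i := by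
  have h1 : ZMod.val (1 : ZMod 2) = 1 := rfl
  rcases zmod_two_cases i with rfl | rfl <;> simp [isign, sign, h1]

/-- Eight times a coordinate of the product `((xy)z)t` of basis vectors. -/
def leftProd (L : List ℤ) (g h m n : ZMod 2) (i j k l r : Fin 2) : ℤ :=
  let f (a b : Fin 2) := lazyMul (icoef L (g + h) m a k b) (icoef L (g + h + m) n b l r)
  lazyMul (icoef L g h i j 0) (f 0 0 + f 0 1) + lazyMul (icoef L g h i j 1) (f 1 0 + f 1 1)

/-- Eight times a coordinate of the product `(xy)(zt)` of basis vectors. -/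
def midProd (L : List ℤ) (g h m n : ZMod 2) (i j k l r : Fin 2) : ℤ :=
  let f (a b : Fin 2) := lazyMul (icoef L m n k l b) (icoef L (g + h) (m + n) a b r)
  lazyMul (icoef L g h i j 0) (f 0 0 + f 0 1) + lazyMul (icoef L g h i j 1) (f 1 0 + f 1 1)

theorem mul_left_bas (L : List ℤ) (g h m n : ZMod 2) (i j k l : Fin 2) :
    (tableOf L).alg.mul ((tableOf L).alg.mul ((tableOf L).alg.mul (bas g i) (bas h j)) (bas m k))
      (bas n l) = ∑ r, (leftProd L g h m n i j k l r / 8 : ℂ) • bas (g + h + m + n) r := by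
  simp only [mul_bas, Fin.sum_univ_two, map_add, map_smul, LinearMap.add_apply,
    LinearMap.smul_apply, leftProd, lazyMul_eq]
  push_cast
  simp only [icoef_eq]
  module

theorem mul_mid_bas (L : List ℤ) (g h m n : ZMod 2) (i j k l : Fin 2) :
    (tableOf L).alg.mul ((tableOf L).alg.mul (bas g i) (bas h j))
      ((tableOf L).alg.mul (bas m k) (bas n l))
      = ∑ r, (midProd L g h m n i j k l r / 8 : ℂ) • bas (g + h + m + n) r := by
  simp only [mul_bas, Fin.sum_univ_two, map_add, map_smul, LinearMap.add_apply,
    LinearMap.smul_apply, midProd, lazyMul_eq, ← add_assoc]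
  push_cast
  simp only [icoef_eq]
  module

/-- The Jordan identity for all basis vectors, in terms of structure constants. -/
def jordanCheck (L : List ℤ) : Bool :=
  entryList.all fun (g, i, j) => entryList.all fun (h, k, l) =>
    [(0, 0, 0), (0, 0, 1), (0, 1, 0), (0, 1, 1), (1, 0, 0), (1, 0, 1), (1, 1, 0), (1, 1, 1)].all
      fun ((m, n, r) : ZMod 2 × ZMod 2 × Fin 2) =>
    decide (leftProd L g h m n i j k l r
      + isign (h * m + h * n + m * n) * leftProd L g n m h i l k j r
      + isign (g * h + g * m + g * n + m * n) * leftProd L h n m g j l k i r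
      = midProd L g h m n i j k l r
      + isign (n * (h + m)) * midProd L g n h m i l j k r
      + isign (h * m) * midProd L g m h n i k j l r)

/-- Every product of four basis vectors involves three doubled constants, so both sides of the
identity are scaled by the same factor eight and the comparison is one of integers. -/
theorem isJordan_of_jordanCheck {L : List ℤ} (hL : jordanCheck L = true) :
    (tableOf L).alg.IsJordan := by
  have hm : ∀ p : ZMod 2 × ZMod 2 × Fin 2, p ∈ [(0, 0, 0), (0, 0, 1), (0, 1, 0), (0, 1, 1),
      (1, 0, 0), (1, 0, 1), (1, 1, 0), (1, 1, 1)] := by decide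
  simp only [jordanCheck, List.all_eq_true, decide_eq_true_eq] at hL
  refine Superalgebra.isJordan_of_basis bas
    (fun g x hx => ⟨_, _, (mem_part_iff _ g x).1 hx⟩) ?_ ?_
  · intro g h i j
    rw [mul_bas, mul_bas, add_comm h g, Finset.smul_sum]
    refine Finset.sum_congr rfl fun k _ => ?_
    rw [smul_smul]
    congr 1
    have h1 : ZMod.val (1 : ZMod 2) = 1 := rfl
    rcases zmod_two_cases g with rfl | rfl <;> rcases zmod_two_cases h with rfl | rfl <;>
      fin_cases i <;> fin_cases j <;> simp [Table.coef, tableOf, mult, sign, h1]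
  · intro g h m n i j k l
    have H := fun r => congrArg (Int.cast : ℤ → ℂ)
      (hL (g, i, j) (mem_entryList _) (h, k, l) (mem_entryList _) (m, n, r) (hm _))
    push_cast [isign_eq] at H
    -- The permuted terms lie in the same component, but their parities are summed in a different
    -- order and have to be brought to a common form.
    rw [mul_left_bas, mul_left_bas, mul_left_bas, mul_mid_bas, mul_mid_bas, mul_mid_bas,
      show g + n + m + h = g + h + m + n by ring, show h + n + m + g = g + h + m + n by ring,
      show g + n + h + m = g + h + m + n by ring, show g + m + h + n = g + h + m + n by ring]
    simp only [Finset.smul_sum, ← Finset.sum_add_distrib, smul_smul, ← add_smul]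
    refine Finset.sum_congr rfl fun r _ => ?_
    congr 1
    linear_combination H r / 8

end JordanSuper

/-! ### Integer data for the members of the list -/

namespace JordanSuper
set_option linter.unusedVariables false

/-- Doubled coordinates of the products `e₁e₁`, `e₁e₂`, `e₂e₂`, `e₁f₁`, `e₁f₂`, `e₂f₁`, `e₂f₂`,
`f₁f₂` for the members of the list, starting with a dummy for number `0`. For number `16`, the
product `f₁f₂` is replaced by zero. -/
def tableData : List (List ℤ) := [[],
  [2, 0, 0, 0, 0, 2, 0, 0, 0, 0, 0, 0, 0, 0, 0, 0],
  [2, 0, 0, 0, 0, 2, 0, 0, 0, 0, 0, 0, 0, 2, 0, 0],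
  [2, 0, 0, 0, 0, 2, 0, 0, 0, 0, 0, 0, 0, 1, 0, 0],
  [2, 0, 0, 0, 0, 2, 0, 0, 0, 0, 2, 0, 0, 2, 0, 0],
  [2, 0, 0, 0, 0, 2, 0, 0, 0, 0, 2, 0, 0, 1, 0, 0],
  [2, 0, 0, 0, 0, 2, 0, 0, 0, 0, 2, 0, 0, 2, 0, 2],
  [2, 0, 0, 0, 0, 2, 0, 0, 0, 0, 1, 0, 0, 1, 0, 0],
  [2, 0, 0, 0, 0, 2, 0, 0, 0, 0, 1, 0, 0, 1, 0, 2],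
  [2, 0, 0, 0, 0, 2, 0, 0, 0, 1, 0, 0, 0, 1, 0, 0],
  [2, 0, 0, 0, 0, 2, 0, 0, 0, 1, 2, 0, 0, 0, 0, 0],
  [2, 0, 0, 0, 0, 2, 0, 0, 0, 1, 2, 0, 0, 1, 0, 0],
  [2, 0, 0, 0, 0, 2, 0, 0, 0, 1, 1, 0, 0, 0, 0, 0],
  [2, 0, 0, 0, 0, 2, 0, 0, 0, 1, 1, 0, 0, 1, 0, 0],
  [2, 0, 0, 0, 0, 2, 0, 0, 0, 2, 2, 0, 0, 0, 0, 0],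
  [2, 0, 0, 0, 0, 2, 1, 0, 0, 1, 1, 0, 0, 1, 0, 0],
  [2, 0, 0, 0, 0, 2, 1, 0, 0, 1, 1, 0, 0, 1, 0, 0],
  [0, 0, 0, 0, 0, 0, 0, 0, 0, 0, 0, 0, 0, 0, 2, 0],
  [0, 0, 0, 0, 0, 0, 0, 0, 0, 0, 0, 2, 0, 0, 0, 0],
  [0, 0, 0, 0, 0, 0, 0, 0, 0, 0, 0, 2, 0, 0, 2, 0],
  [0, 0, 0, 0, 0, 0, 0, 0, 0, 0, 0, 2, 0, 0, 0, 2],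
  [2, 0, 0, 0, 0, 0, 0, 0, 0, 0, 0, 0, 0, 0, 0, 0],
  [2, 0, 0, 0, 0, 0, 0, 0, 0, 0, 0, 0, 0, 0, 0, 2],
  [2, 0, 0, 0, 0, 0, 0, 0, 0, 0, 0, 2, 0, 0, 0, 0],
  [2, 0, 0, 0, 0, 0, 0, 0, 0, 0, 0, 2, 0, 0, 0, 2],
  [2, 0, 0, 0, 0, 0, 0, 0, 0, 1, 0, 0, 0, 0, 0, 0],
  [2, 0, 0, 0, 0, 0, 0, 0, 0, 2, 0, 0, 0, 0, 0, 0],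
  [2, 0, 0, 0, 0, 0, 1, 0, 0, 1, 0, 0, 0, 0, 0, 0],
  [2, 0, 0, 0, 0, 0, 1, 0, 0, 1, 0, 0, 0, 0, 0, 2],
  [2, 0, 0, 0, 0, 0, 1, 0, 0, 1, 0, 0, 0, 0, 2, 0],
  [2, 0, 0, 0, 0, 0, 1, 0, 0, 1, 0, 0, 0, 0, 2, 2],
  [2, 0, 0, 0, 0, 0, 1, 0, 0, 1, 0, 2, 0, 0, 0, 0],
  [2, 0, 0, 0, 0, 0, 1, 0, 0, 1, 0, 2, 0, 0, 0, 2],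
  [2, 0, 0, 0, 0, 0, 1, 0, 0, 2, 0, 0, 0, 0, 0, 0],
  [2, 0, 0, 0, 0, 0, 2, 0, 0, 2, 0, 0, 0, 0, 0, 0],
  [2, 0, 0, 0, 0, 0, 2, 0, 0, 2, 0, 0, 0, 0, 2, 0],
  [2, 0, 0, 2, 0, 0, 0, 0, 0, 0, 0, 0, 0, 0, 0, 0],
  [2, 0, 0, 2, 0, 0, 0, 0, 0, 1, 0, 0, 0, 0, 0, 0],
  [2, 0, 0, 2, 0, 0, 0, 0, 0, 2, 0, 0, 0, 0, 0, 0],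
  [2, 0, 0, 2, 0, 0, 1, 0, 0, 1, 0, 0, 0, 0, 0, 0],
  [2, 0, 0, 2, 0, 0, 1, 0, 0, 1, 0, 0, 0, 0, 0, 2],
  [2, 0, 0, 2, 0, 0, 1, 0, 0, 1, 0, 2, 0, 0, 0, 0],
  [2, 0, 0, 2, 0, 0, 1, 0, 0, 1, 0, 2, 0, 0, 0, 2],
  [2, 0, 0, 2, 0, 0, 1, 0, 0, 2, 0, 0, 0, 0, 0, 0],
  [2, 0, 0, 2, 0, 0, 2, 0, 0, 2, 0, 0, 0, 0, 0, 0],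
  [2, 0, 0, 2, 0, 0, 2, 0, 0, 2, 0, 0, 0, 0, 0, 2],
  [2, 0, 0, 2, 0, 0, 2, 0, 0, 2, 0, 0, 0, 0, 2, 0],
  [2, 0, 0, 2, 0, 0, 2, 0, 0, 2, 0, 0, 0, 0, 2, 2],
  [2, 0, 0, 2, 0, 0, 2, 0, 0, 2, 0, 2, 0, 0, 0, 0],
  [2, 0, 0, 2, 0, 0, 2, 0, 0, 2, 0, 2, 0, 0, 0, 2],
  [2, 0, 0, 1, 0, 0, 0, 0, 0, 0, 0, 0, 0, 0, 0, 0],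
  [2, 0, 0, 1, 0, 0, 0, 0, 0, 1, 0, 0, 0, 0, 0, 0],
  [2, 0, 0, 1, 0, 0, 0, 0, 0, 1, 0, 0, 0, 0, 0, 2],
  [2, 0, 0, 1, 0, 0, 0, 0, 0, 1, 0, 0, 2, 0, 0, 0],
  [2, 0, 0, 1, 0, 0, 0, 0, 0, 1, 0, 0, 2, 0, 0, 2],
  [2, 0, 0, 1, 0, 0, 0, 0, 0, 1, 0, 2, 0, 0, 0, 0],
  [2, 0, 0, 1, 0, 0, 0, 0, 0, 1, 0, 2, 0, 0, 0, 2],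
  [2, 0, 0, 1, 0, 0, 0, 0, 0, 2, 0, 0, 0, 0, 0, 0],
  [2, 0, 0, 1, 0, 0, 1, 0, 0, 1, 0, 0, 0, 0, 0, 0],
  [2, 0, 0, 1, 0, 0, 1, 0, 0, 2, 0, 0, 0, 0, 0, 0],
  [2, 0, 0, 1, 0, 0, 1, 0, 0, 2, 0, 0, 0, 0, 0, 2],
  [2, 0, 0, 1, 0, 0, 1, 0, 0, 2, 0, 0, 2, 0, 0, 0],
  [2, 0, 0, 1, 0, 0, 1, 0, 0, 2, 0, 0, 2, 0, 0, 2],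
  [2, 0, 0, 1, 0, 0, 1, 0, 0, 2, 0, 2, 0, 0, 0, 0],
  [2, 0, 0, 1, 0, 0, 1, 0, 0, 2, 0, 2, 0, 0, 0, 2],
  [2, 0, 0, 1, 0, 0, 2, 0, 0, 2, 0, 0, 0, 0, 0, 0],
  [0, 2, 0, 0, 0, 0, 0, 0, 0, 0, 0, 0, 0, 0, 0, 0],
  [0, 2, 0, 0, 0, 0, 0, 0, 0, 0, 0, 0, 0, 0, 0, 2],
  [0, 2, 0, 0, 0, 0, 0, 0, 0, 0, 0, 0, 0, 0, 2, 0],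
  [0, 2, 0, 0, 0, 0, 0, 0, 0, 0, 0, 2, 0, 0, 0, 0],
  [0, 2, 0, 0, 0, 0, 0, 2, 0, 0, 0, 0, 0, 0, 0, 0],
  [0, 2, 0, 0, 0, 0, 0, 2, 0, 0, 0, 0, 0, 0, 0, 2]]

theorem eq_halfVec {L : List ℤ} {n : ℕ} {a b : ℂ} {u v : ℤ} (hu : L.getD n 0 = u)
    (hv : L.getD (n + 1) 0 = v) (ha : a = u / 2) (hb : b = v / 2) : ![a, b] = halfVec L n := by
  rw [halfVec, hu, hv, ha, hb]

theorem zero_eq_halfVec {L : List ℤ} {n : ℕ} (hu : L.getD n 0 = 0) (hv : L.getD (n + 1) 0 = 0) :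
    0 = halfVec L n := by
  rw [← eq_halfVec hu hv (a := 0) (b := 0) (by simp) (by simp)]
  ext i
  fin_cases i <;> rfl

theorem e₁_eq_halfVec {L : List ℤ} {n : ℕ} (hu : L.getD n 0 = 2) (hv : L.getD (n + 1) 0 = 0) :
    e₁ = halfVec L n := eq_halfVec hu hv (by norm_num) (by norm_num)

theorem e₂_eq_halfVec {L : List ℤ} {n : ℕ} (hu : L.getD n 0 = 0) (hv : L.getD (n + 1) 0 = 2) :
    e₂ = halfVec L n := eq_halfVec hu hv (by norm_num) (by norm_num)

theorem half_e₁_eq_halfVec {L : List ℤ} {n : ℕ} (hu : L.getD n 0 = 1)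
    (hv : L.getD (n + 1) 0 = 0) : half • e₁ = halfVec L n := by
  rw [← eq_halfVec hu hv (a := half) (b := 0) (by norm_num) (by norm_num)]
  simp

theorem half_e₂_eq_halfVec {L : List ℤ} {n : ℕ} (hu : L.getD n 0 = 0)
    (hv : L.getD (n + 1) 0 = 1) : half • e₂ = halfVec L n := by
  rw [← eq_halfVec hu hv (a := 0) (b := half) (by norm_num) (by norm_num)]
  simp

theorem e₁_add_e₂_eq_halfVec {L : List ℤ} {n : ℕ} (hu : L.getD n 0 = 2)
    (hv : L.getD (n + 1) 0 = 2) : e₁ + e₂ = halfVec L n := by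
  rw [← eq_halfVec hu hv (a := 1) (b := 1) (by norm_num) (by norm_num)]
  simp

theorem mult_eq_tableOf {L : List ℤ} {a b c d e f g h : Fin 2 → ℂ} (h₁ : a = halfVec L 0)
    (h₂ : b = halfVec L 2) (h₃ : c = halfVec L 4) (h₄ : d = halfVec L 6) (h₅ : e = halfVec L 8)
    (h₆ : f = halfVec L 10) (h₇ : g = halfVec L 12) (h₈ : h = halfVec L 14) :
    mult a b c d e f g h = tableOf L := by
  rw [tableOf, h₁, h₂, h₃, h₄, h₅, h₆, h₇, h₈]

set_option maxHeartbeats 1000000 in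
theorem table_eq_tableOf {k : ℕ} (hk : k ∈ Finset.Icc 1 71) (h16 : k ≠ 16) (t : ℂ) :
    table k t = tableOf (tableData.getD k []) := by
  rw [Finset.mem_Icc] at hk
  obtain ⟨h1, h2⟩ := hk
  interval_cases k <;> first
    | exact absurd rfl h16
    | (simp only [table]
       refine mult_eq_tableOf ?_ ?_ ?_ ?_ ?_ ?_ ?_ ?_ <;> first
        -- Outside the family, only six vectors occur as products of basis vectors in the list:
        -- zero, the two basis vectors, their halves, and their sum.
        | (with_reducible refine zero_eq_halfVec ?_ ?_) <;> rfl
        | (with_reducible refine e₁_eq_halfVec ?_ ?_) <;> rfl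
        | (with_reducible refine e₂_eq_halfVec ?_ ?_) <;> rfl
        | (with_reducible refine half_e₁_eq_halfVec ?_ ?_) <;> rfl
        | (with_reducible refine half_e₂_eq_halfVec ?_ ?_) <;> rfl
        | (with_reducible refine e₁_add_e₂_eq_halfVec ?_ ?_) <;> rfl)

end JordanSuper

namespace JordanSuper

/-! ### Superderivations, the centroid, and invariants -/

/-- A family of coefficients with the given values at `(0, 0)`, `(0, 1)`, `(1, 0)`, `(1, 1)`. -/
def quad (a b c d : ℤ) (g h : ZMod 2) : ℤ :=
  if g = 0 then if h = 0 then a else b else if h = 0 then c else d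

/-- The data of the space of superderivations of parity `d`. -/
def derSpec (d : ZMod 2) : Spec :=
  ⟨d, quad 1 1 1 1, quad 1 1 1 1, fun g _ => isign (d * g)⟩

theorem quad_one (g h : ZMod 2) : quad 1 1 1 1 g h = 1 := by
  simp [quad]

theorem derivations_eq_genDer {A : Type*} [AddCommGroup A] [Module ℂ A] (S : Superalgebra A)
    (d : ZMod 2) : S.derivations d = S.genDer (derSpec d) := by
  ext D
  rw [Superalgebra.mem_genDer]
  simp only [derSpec, quad_one, isign_eq, Int.cast_one, one_smul]
  constructor
  · intro h
    exact ⟨fun g x hx => (h g x hx).1, fun g _ x hx y _ => (h g x hx).2 y⟩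
  · rintro ⟨h1, h2⟩ i x hx
    refine ⟨h1 i x hx, fun y => ?_⟩
    -- The Leibniz rule of `derivations` allows an inhomogeneous second factor, which is split into
    -- its even and odd components.
    have hy : y ∈ S.part 0 ⊔ S.part 1 := by
      rw [codisjoint_iff.1 S.isCompl.2]
      trivial
    obtain ⟨y₀, hy₀, y₁, hy₁, rfl⟩ := Submodule.mem_sup.1 hy
    simp only [map_add, h2 i 0 x hx y₀ hy₀, h2 i 1 x hx y₁ hy₁, smul_add]
    abel

/-- The data of the even part of the centroid. -/
def centroidSpec : Spec := ⟨0, quad 1 1 1 1, quad 1 1 1 1, quad 0 0 0 0⟩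

/-- The data of the space of even maps that commute with the multiplication by even elements. -/
def evenCentroidSpec : Spec := ⟨0, quad 1 1 1 0, quad 1 1 1 0, quad 0 0 0 0⟩

section

variable {A : Type*} [AddCommGroup A] [Module ℂ A]

/-- A decomposition into graded ideals gives an idempotent of the centroid. -/
theorem exists_centroid_of_isCompl {S : Superalgebra A} {I J : Submodule ℂ A}
    (hI : S.IsGradedIdeal I) (hJ : S.IsGradedIdeal J) (hIJ : IsCompl I J) :
    ∃ D ∈ S.genDer centroidSpec, D ∘ₗ D = D ∧ (D = 0 → I = ⊥) ∧ (D = LinearMap.id → J = ⊥) := by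
  have hdec : ∀ x, ∃ a ∈ I, ∃ b ∈ J, a + b = x := fun x => by
    apply Submodule.mem_sup.1
    rw [codisjoint_iff.1 hIJ.2]
    trivial
  have hzero : ∀ x ∈ I, x ∈ J → x = 0 := fun x h1 h2 =>
    (Submodule.mem_bot ℂ).1 ((disjoint_iff.1 hIJ.1) ▸ Submodule.mem_inf.2 ⟨h1, h2⟩)
  have hpart : ∀ x ∈ S.part 0, x ∈ S.part 1 → x = 0 := fun x h1 h2 =>
    (Submodule.mem_bot ℂ).1 ((disjoint_iff.1 S.isCompl.1) ▸ Submodule.mem_inf.2 ⟨h1, h2⟩)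
  set D : A →ₗ[ℂ] A := I.projection J hIJ with hD
  have hDI : ∀ a ∈ I, D a = a := fun a ha =>
    Submodule.projection_apply_of_mem_left hIJ ha
  have hDJ : ∀ b ∈ J, D b = 0 := fun b hb =>
    (Submodule.projection_apply_eq_zero_iff hIJ).2 hb
  -- The projection preserves parity: the components of the wrong parity of `a` and `b` cancel,
  -- hence lie in `I ∩ J` because both ideals are graded, and so vanish.
  have hgr : ∀ a ∈ I, ∀ b ∈ J, ∀ g, a + b ∈ S.part g → a ∈ S.part g := by
    intro a ha b hb g hg
    rw [hI.2] at ha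
    rw [hJ.2] at hb
    obtain ⟨a₀, ⟨ha₀, ha₀'⟩, a₁, ⟨ha₁, ha₁'⟩, rfl⟩ := Submodule.mem_sup.1 ha
    obtain ⟨b₀, ⟨hb₀, hb₀'⟩, b₁, ⟨hb₁, hb₁'⟩, rfl⟩ := Submodule.mem_sup.1 hb
    rcases zmod_two_cases g with rfl | rfl
    · have h1 : a₁ + b₁ = 0 := by
        refine hpart _ ?_ (add_mem ha₁' hb₁')
        have := sub_mem hg (add_mem ha₀' hb₀')
        rwa [show a₀ + a₁ + (b₀ + b₁) - (a₀ + b₀) = a₁ + b₁ by abel] at this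
      have h2 : a₁ = 0 := hzero _ ha₁ (by
        rw [eq_neg_of_add_eq_zero_left h1]
        exact neg_mem hb₁)
      rw [h2, add_zero]
      exact ha₀'
    · have h1 : a₀ + b₀ = 0 := by
        refine hpart _ (add_mem ha₀' hb₀') ?_
        have := sub_mem hg (add_mem ha₁' hb₁')
        rwa [show a₀ + a₁ + (b₀ + b₁) - (a₁ + b₁) = a₀ + b₀ by abel] at this
      have h2 : a₀ = 0 := hzero _ ha₀ (by
        rw [eq_neg_of_add_eq_zero_left h1]
        exact neg_mem hb₀)
      rw [h2, zero_add]
      exact ha₁'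
  refine ⟨D, ⟨fun g x hx => ?_, fun g h x hx y hy => ?_⟩, ?_, fun h => ?_, fun h => ?_⟩
  · obtain ⟨a, ha, b, hb, rfl⟩ := hdec x
    simp only [map_add, hDI a ha, hDJ b hb, add_zero, centroidSpec]
    exact hgr a ha b hb g hx
  · obtain ⟨a, ha, b, hb, rfl⟩ := hdec x
    simp [centroidSpec, quad_one, show quad 0 0 0 0 g h = 0 by simp [quad], hDI a ha, hDJ b hb,
      hDI _ (hI.1 a ha y).1, hDJ _ (hJ.1 b hb y).1]
  · ext x
    obtain ⟨a, ha, b, hb, rfl⟩ := hdec x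
    simp [hDI a ha, hDJ b hb]
  · rw [eq_bot_iff]
    intro a ha
    rw [Submodule.mem_bot, ← hDI a ha, h, LinearMap.zero_apply]
  · rw [eq_bot_iff]
    intro b hb
    rw [Submodule.mem_bot, ← hDJ b hb, h, LinearMap.id_apply]

end

/-- Linear equations for the entries of a homogeneous even map, which express that the map has
triangular matrices with a single eigenvalue. The choice is between upper and lower triangular
matrices on the even part. -/
def unipotentRows (p : Fin 2) : List (List ℤ) :=
  [[1, 0, 0, -1, 0, 0, 0, 0], [1, 0, 0, 0, -1, 0, 0, 0], [1, 0, 0, 0, 0, 0, 0, -1],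
    [0, 0, 0, 0, 0, 1, 0, 0], if p = 0 then [0, 1, 0, 0, 0, 0, 0, 0] else [0, 0, 1, 0, 0, 0, 0, 0]]

/-- For a triangular idempotent with the single eigenvalue `c`, one has `c² = c`, and each
off-diagonal entry `u` satisfies `2cu = u`. Since `2c ≠ 1`, the map is scalar. -/
theorem eq_zero_or_eq_id {x : Fin 8 → ℂ} {p : Fin 2} (hx : ∀ r ∈ unipotentRows p, evalRow r x = 0)
    (h : ofEntries 0 x ∘ₗ ofEntries 0 x = ofEntries 0 x) :
    ofEntries 0 x = 0 ∨ ofEntries 0 x = LinearMap.id := by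
  have hv : ZMod.val (1 : ZMod 2) = 1 := rfl
  have H : ∀ g l i, ∑ k, x (pos g k i) * x (pos g l k) = x (pos g l i) := by
    intro g l i
    have := congrArg (coord g l) (LinearMap.congr_fun h (bas g i))
    simp only [LinearMap.comp_apply, ofEntries_bas, map_sum, map_smul, add_zero, coord_bas] at this
    fin_cases l <;> simpa [coord_bas] using this
  have e₁ := H 0 0 0
  have e₂ := H 0 0 1
  have e₃ := H 0 1 0
  have e₄ := H 1 1 0
  simp only [unipotentRows, List.forall_mem_cons, evalRow, Fin.sum_univ_eight] at hx
  obtain ⟨h₁, h₂, h₃, h₄, h₅, -⟩ := hx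
  simp [pos, hv] at e₁ e₂ e₃ e₄ h₁ h₂ h₃ h₄
  have h₆ : x 1 * x 2 = 0 := by
    fin_cases p
    · simp at h₅
      simp [h₅]
    · simp at h₅
      simp [h₅]
  have hx₃ : x 3 = x 0 := by linear_combination -h₁
  have hx₄ : x 4 = x 0 := by linear_combination -h₂
  have hx₇ : x 7 = x 0 := by linear_combination -h₃
  have h0 : x 0 * (x 0 - 1) = 0 := by linear_combination e₁ - h₆
  -- From `c(c - 1) = 0` one gets `(2c - 1)² = 1`.
  have hx0 : 2 * x 0 - 1 ≠ 0 := by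
    intro h'
    have : (1 : ℂ) = 0 := by linear_combination (2 * x 0 - 1) * h' - 4 * h0
    exact one_ne_zero this
  have hx₁ : x 1 = 0 := by
    refine (mul_eq_zero.1 (?_ : (2 * x 0 - 1) * x 1 = 0)).resolve_left hx0
    linear_combination e₂ - x 1 * hx₃
  have hx₂ : x 2 = 0 := by
    refine (mul_eq_zero.1 (?_ : (2 * x 0 - 1) * x 2 = 0)).resolve_left hx0
    linear_combination e₃ - x 2 * hx₃
  have hx₆ : x 6 = 0 := by
    refine (mul_eq_zero.1 (?_ : (2 * x 0 - 1) * x 6 = 0)).resolve_left hx0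
    linear_combination e₄ - x 6 * hx₄ - x 6 * hx₇
  have hD : ∀ g i, ofEntries 0 x (bas g i) = x 0 • bas g i := by
    intro g i
    rw [ofEntries_bas]
    rcases zmod_two_cases g with rfl | rfl <;> fin_cases i <;>
      simp [pos, hv, hx₁, hx₂, hx₃, hx₄, h₄, hx₆, hx₇]
  rcases mul_eq_zero.1 h0 with h' | h'
  · left
    exact ext_bas fun g i => by simp [hD, h']
  · right
    exact ext_bas fun g i => by simp [hD, sub_eq_zero.1 h']

/-- The projection onto one of two complementary graded ideals lies in the even centroid. If all
elements of the latter have the triangular form, the projection is trivial and one of the ideals is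
zero. -/
theorem indecomposable_of_rows {c : Table 2 2} {p : Fin 2} (h : ∀ x : Fin 8 → ℂ,
      ofEntries 0 x ∈ c.alg.genDer centroidSpec → ∀ r ∈ unipotentRows p, evalRow r x = 0) :
    c.alg.Indecomposable := by
  refine ⟨inferInstance, fun I J hI hJ hIJ => ?_⟩
  obtain ⟨D, hD, hDD, h0, h1⟩ := exists_centroid_of_isCompl hI hJ hIJ
  obtain ⟨x, rfl⟩ := exists_ofEntries (c := c) (d := 0) hD.1
  exact (eq_zero_or_eq_id (h x hD) hDD).imp h0 h1

theorem length_of_mem_unipotentRows {p : Fin 2} : ∀ r ∈ unipotentRows p, r.length = 8 := by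
  revert p
  decide

/-- The rank condition says that the triangular shape is a linear consequence of the centroid
equations. -/
theorem indecomposable_tableOf {L : List ℤ} {p : Fin 2}
    (h : rankZ 8 (unipotentRows p ++ rowsOf L centroidSpec) = rankZ 8 (rowsOf L centroidSpec)) :
    (tableOf L).alg.Indecomposable := by
  refine indecomposable_of_rows (p := p) fun x hx => ?_
  rw [genDer_eq_map] at hx
  obtain ⟨y, hy, hxy⟩ := hx
  obtain rfl := ofEntries_injective _ hxy
  exact evalRow_eq_zero_of_rankZ (fun r => length_of_mem_rowsOf) length_of_mem_unipotentRows h hy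

/-- Multiplication tables with the same products of even elements with arbitrary ones. -/
def Table.AgreeOffOdd (c c' : Table 2 2) : Prop := c.ee = c'.ee ∧ c.ef = c'.ef

/-- The products of odd elements do not matter for even generalized derivations whose conditions
do not involve them. -/
theorem Table.AgreeOffOdd.genDer_eq {c c' : Table 2 2} (h : c.AgreeOffOdd c') {s : Spec}
    (hd : s.d = 0) (hα : s.α 1 1 = 0) (hβ : s.β 1 1 = 0) (hγ : s.γ 1 1 = 0) :
    c.alg.genDer s = c'.alg.genDer s := by
  have hc : ∀ g h', g = 0 ∨ h' = 0 → c.coef g h' = c'.coef g h' := by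
    intro g h' hg
    ext i j k
    rcases hg with rfl | rfl <;> simp [Table.coef, h.1, h.2]
  have key : ∀ x, ofEntries s.d x ∈ c.alg.genDer s ↔ ofEntries s.d x ∈ c'.alg.genDer s := by
    intro x
    rw [ofEntries_mem_genDer, ofEntries_mem_genDer]
    refine forall_congr' fun g => forall_congr' fun h' => forall_congr' fun i =>
      forall_congr' fun j => forall_congr' fun k => ?_
    by_cases hg : g = 0 ∨ h' = 0
    · rw [hd, add_zero, add_zero, hc g h' hg]
    · obtain ⟨h1, h2⟩ := not_or.1 hg
      rw [(zmod_two_cases g).resolve_left h1, (zmod_two_cases h').resolve_left h2, hα, hβ, hγ]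
      simp
  ext D
  constructor
  · intro hD
    obtain ⟨x, rfl⟩ := exists_ofEntries (c := c) hD.1
    exact (key x).1 hD
  · intro hD
    obtain ⟨x, rfl⟩ := exists_ofEntries (c := c') hD.1
    exact (key x).2 hD

/-- Dropping the centroid conditions on pairs of odd elements only enlarges the space, and the
enlarged space does not see `f₁f₂`. This removes the complex parameter of the family and permits an
integer rank computation. -/
theorem indecomposable_of_agreeOffOdd {c : Table 2 2} {L : List ℤ} {p : Fin 2}
    (hc : c.AgreeOffOdd (tableOf L)) (h : rankZ 8 (unipotentRows p ++ rowsOf L evenCentroidSpec)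
      = rankZ 8 (rowsOf L evenCentroidSpec)) : c.alg.Indecomposable := by
  refine indecomposable_of_rows (p := p) fun x hx => ?_
  have hx' : ofEntries 0 x ∈ c.alg.genDer evenCentroidSpec := by
    refine ⟨hx.1, fun g h' y hy z hz => ?_⟩
    have := hx.2 g h' y hy z hz
    rcases zmod_two_cases g with rfl | rfl <;> rcases zmod_two_cases h' with rfl | rfl <;>
      simp_all [centroidSpec, evenCentroidSpec, quad]
  rw [hc.genDer_eq rfl rfl rfl rfl, genDer_eq_map] at hx'
  obtain ⟨y, hy, hxy⟩ := hx'
  obtain rfl := ofEntries_injective _ hxy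
  exact evalRow_eq_zero_of_rankZ (fun r => length_of_mem_rowsOf) length_of_mem_unipotentRows h hy

end JordanSuper

namespace JordanSuper

/-! ### Evaluation for the members of the list -/

/-- Spaces of generalized derivations whose dimensions distinguish the members of the list. The
last two do not involve products of odd elements. -/
def invSpecs : List Spec :=
  [derSpec 0, derSpec 1,
    ⟨1, quad (-1) 0 (-1) 0, quad 0 0 1 (-1), quad (-1) 1 0 (-1)⟩,
    ⟨0, quad 0 1 0 (-1), quad 1 1 0 1, quad 1 1 0 1⟩,
    ⟨0, quad 1 0 1 0, quad 2 0 0 0, quad (-1) 0 2 0⟩,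
    ⟨0, quad 1 0 (-1) 0, quad 2 0 (-1) 0, quad 0 0 0 0⟩]

/-- The codimensions of the spaces given by `invSpecs`, as the digits of a number. -/
def codimCode (L : List ℤ) : ℕ :=
  invSpecs.foldl (fun a s => 10 * a + rankZ 8 (rowsOf L s)) 0

/-- The values of `codimCode` for the members of the list. -/
def codimCodes : List ℕ :=
  0 :: [488424, 677646, 678646, 486464, 677666, 586564, 468464, 568564, 678656, 667666, 677676,
668666, 668676, 666666, 468474, 468474, 240200, 345332, 455432, 555532, 344223, 464323,
567545, 667645, 556445, 555445, 368263, 468363, 468463, 568463, 568575, 668675, 577465,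
386263, 486463, 388424, 578646, 567646, 368464, 468564, 568666, 668766, 557666, 346464,
446564, 466564, 566564, 556666, 656766, 288433, 458655, 568755, 568776, 668876, 568756,
668856, 487655, 228473, 457675, 557775, 557776, 657876, 567776, 667876, 286473, 244222,
344322, 464422, 567554, 445444, 555544]

theorem codimCode_tableData : ∀ k < 71,
    codimCode (tableData.getD (k + 1) []) = codimCodes.getD (k + 1) 0 := by
  decide +kernel

theorem jordanCheck_tableData : ∀ k < 71, jordanCheck (tableData.getD (k + 1) []) = true := by
  decide +kernel

end JordanSuper

/-! ### Consequences of the computed codimensions -/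

namespace JordanSuper

theorem mem_Icc_iff_lt {k : ℕ} : k ∈ Finset.Icc 1 71 ↔ ∃ n < 71, k = n + 1 := by
  rw [Finset.mem_Icc]
  constructor
  · rintro ⟨h1, h2⟩
    exact ⟨k - 1, by omega, by omega⟩
  · rintro ⟨n, hn, rfl⟩
    omega

theorem 𝒥_eq {k : ℕ} (hk : k ∈ Finset.Icc 1 71) (h16 : k ≠ 16) (t : ℂ) :
    𝒥 k t = (tableOf (tableData.getD k [])).alg := by
  rw [𝒥, table_eq_tableOf hk h16]

theorem codimCode_eq_of_finrank_eq {L L' : List ℤ} (h : ∀ s ∈ invSpecs,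
      Module.finrank ℂ ((tableOf L).alg.genDer s) = Module.finrank ℂ ((tableOf L').alg.genDer s)) :
    codimCode L = codimCode L' := by
  have h' : ∀ s ∈ invSpecs, rankZ 8 (rowsOf L s) = rankZ 8 (rowsOf L' s) := fun s hs => by
    have h1 := finrank_genDer L s
    have h2 := finrank_genDer L' s
    have h3 := h s hs
    omega
  simp only [invSpecs, List.forall_mem_cons] at h'
  obtain ⟨e1, e2, e3, e4, e5, e6, -⟩ := h'
  simp only [codimCode, invSpecs, List.foldl, e1, e2, e3, e4, e5, e6]

/-- The last two digits belong to the invariants that ignore products of odd elements; they are the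
ones available for comparison with the family. -/
theorem codimCode_mod_eq_of_finrank_eq {L L' : List ℤ} (h : ∀ s ∈ invSpecs.drop 4,
      Module.finrank ℂ ((tableOf L).alg.genDer s) = Module.finrank ℂ ((tableOf L').alg.genDer s)) :
    codimCode L % 100 = codimCode L' % 100 := by
  have h' : ∀ s ∈ invSpecs.drop 4, rankZ 8 (rowsOf L s) = rankZ 8 (rowsOf L' s) := fun s hs => by
    have h1 := finrank_genDer L s
    have h2 := finrank_genDer L' s
    have h3 := h s hs
    omega
  simp only [invSpecs, List.drop, List.forall_mem_cons] at h'
  obtain ⟨e5, e6, -⟩ := h'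
  simp only [codimCode, invSpecs, List.foldl, e5, e6]
  omega

/-- Number 16 is left out because its data, with `f₁f₂` set to zero, repeat those of number 15.
Recovering the position by the first occurrence proves injectivity without comparing all pairs. -/
theorem idxOf_codimCodes : ∀ k < 71, k ≠ 15 →
    codimCodes.idxOf (codimCodes.getD (k + 1) 0) = k + 1 := by
  decide +kernel

theorem codimCodes_injective {k l : ℕ} (hk : k < 71) (hl : l < 71) (hk' : k ≠ 15) (hl' : l ≠ 15)
    (h : codimCodes.getD (k + 1) 0 = codimCodes.getD (l + 1) 0) : k = l := by
  have := idxOf_codimCodes k hk hk'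
  rw [h, idxOf_codimCodes l hl hl'] at this
  omega

theorem codimCodes_mod_fifteen : ∀ l < 71, codimCodes.getD (l + 1) 0 % 100 = 74 →
    l = 14 ∨ l = 15 := by
  decide +kernel

/-- The two leading digits of the code are the codimensions of the even and the odd
superderivations. -/
theorem codim_derivations (L : List ℤ) :
    Module.finrank ℂ ((tableOf L).alg.derivations 0) + codimCode L / 100000 = 8 ∧
    Module.finrank ℂ ((tableOf L).alg.derivations 1) + codimCode L / 10000 % 10 = 8 := by
  have h := finrank_genDer L
  rw [derivations_eq_genDer, derivations_eq_genDer]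
  have h1 := h (derSpec 0)
  have h2 := h (derSpec 1)
  -- The other four ranks enter only through the bound eight, which rules out carries between the
  -- digits.
  have h3 := h ⟨1, quad (-1) 0 (-1) 0, quad 0 0 1 (-1), quad (-1) 1 0 (-1)⟩
  have h4 := h ⟨0, quad 0 1 0 (-1), quad 1 1 0 1, quad 1 1 0 1⟩
  have h5 := h ⟨0, quad 1 0 1 0, quad 2 0 0 0, quad (-1) 0 2 0⟩
  have h6 := h ⟨0, quad 1 0 (-1) 0, quad 2 0 (-1) 0, quad 0 0 0 0⟩
  simp only [codimCode, invSpecs, List.foldl]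
  omega

/-- The sixteen matrix entries split into eight even and eight odd ones, so the orbit dimension is
the sum of the two codimensions. -/
theorem orbitDim_eq : ∀ k < 71, k ≠ 15 → codimCodes.getD (k + 1) 0 / 100000
    + codimCodes.getD (k + 1) 0 / 10000 % 10 = orbitDim (k + 1) := by
  decide +kernel

/-! ### The one-parameter family -/

/-- The multiplication table of the one-parameter family. -/
noncomputable abbrev famTable (t : ℂ) : Table 2 2 :=
  mult (e₁e₁ := e₁) (e₂e₂ := e₂) (e₁f₁ := half • f₁) (e₁f₂ := half • f₂) (e₂f₁ := half • f₁)
    (e₂f₂ := half • f₂) (f₁f₂ := e₁ + t • e₂)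

theorem 𝒥_sixteen (t : ℂ) : 𝒥 16 t = (famTable t).alg := rfl

theorem famTable_agreeOffOdd (t : ℂ) : (famTable t).AgreeOffOdd (tableOf (tableData.getD 15 [])) := by
  rw [← table_eq_tableOf (by simp) (by simp) 0]
  exact ⟨rfl, rfl⟩

theorem famTable_mul (t a b c d a' b' c' d' : ℂ) :
    (famTable t).alg.mul (![a, b], ![c, d]) (![a', b'], ![c', d']) =
      (![a * a' + (c * d' - d * c'), b * b' + t * (c * d' - d * c')],
        ![((a + b) * c' + (a' + b') * c) / 2, ((a + b) * d' + (a' + b') * d) / 2]) := by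
  ext i <;> fin_cases i <;> simp [Table.alg, mult, Fin.sum_univ_two] <;> ring

theorem exists_of_mem_part {c : Table 2 2} {g : ZMod 2} {x : Model 2 2} (h : x ∈ c.alg.part g) :
    ∃ a b, g = 0 ∧ x = (![a, b], ![0, 0]) ∨ g = 1 ∧ x = (![0, 0], ![a, b]) := by
  refine ⟨coord g 0 x, coord g 1 x, ?_⟩
  have := (mem_part_iff c g x).1 h
  rcases zmod_two_cases g with rfl | rfl
  · left
    refine ⟨rfl, ?_⟩
    conv_lhs => rw [this]
    ext n <;> fin_cases n <;> simp [bas]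
  · right
    refine ⟨rfl, ?_⟩
    conv_lhs => rw [this]
    ext n <;> fin_cases n <;> simp [bas]

theorem model_ext {a b c d a' b' c' d' : ℂ} (h₁ : a = a') (h₂ : b = b') (h₃ : c = c')
    (h₄ : d = d') : ((![a, b], ![c, d]) : Model 2 2) = (![a', b'], ![c', d']) := by
  rw [h₁, h₂, h₃, h₄]

theorem famTable_isJordan (t : ℂ) : (famTable t).alg.IsJordan := by
  have hs : sign 0 = 1 := by simp [sign]
  have hs' : sign 1 = -1 := by simp [sign, show ZMod.val (1 : ZMod 2) = 1 from rfl]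
  have h2 : (1 + 1 : ZMod 2) = 0 := by decide
  constructor
  · intro i j x hx y hy
    obtain ⟨a, b, ⟨rfl, rfl⟩ | ⟨rfl, rfl⟩⟩ := exists_of_mem_part hx <;>
    obtain ⟨c, d, ⟨rfl, rfl⟩ | ⟨rfl, rfl⟩⟩ := exists_of_mem_part hy <;>
    simp only [famTable_mul, hs, hs', mul_zero, mul_one, Prod.smul_mk, Matrix.smul_cons,
      Matrix.smul_empty, smul_eq_mul] <;>
    apply model_ext <;> ring
  · intro i j k l x hx y hy z hz w hw
    obtain ⟨a, b, ⟨rfl, rfl⟩ | ⟨rfl, rfl⟩⟩ := exists_of_mem_part hx <;>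
    obtain ⟨c, d, ⟨rfl, rfl⟩ | ⟨rfl, rfl⟩⟩ := exists_of_mem_part hy <;>
    obtain ⟨e, f, ⟨rfl, rfl⟩ | ⟨rfl, rfl⟩⟩ := exists_of_mem_part hz <;>
    obtain ⟨g, h, ⟨rfl, rfl⟩ | ⟨rfl, rfl⟩⟩ := exists_of_mem_part hw <;>
    simp only [famTable_mul, hs, hs', h2, mul_zero, mul_one, add_zero, zero_add, Prod.smul_mk,
      Matrix.smul_cons, Matrix.smul_empty, smul_eq_mul, Prod.mk_add_mk, Matrix.cons_add_cons,
      Matrix.empty_add_empty] <;>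
    apply model_ext <;> ring

theorem famTable_coef (t : ℂ) (g h : ZMod 2) (i j k : Fin 2) : (famTable t).coef g h i j k =
    if g = 0 then if h = 0 then (if i = j ∧ j = k then 1 else 0) else (if j = k then 1 / 2 else 0)
    else if h = 0 then (if i = k then 1 / 2 else 0)
    else ((if i = 0 then if j = 0 then 0 else 1 else if j = 0 then -1 else 0)
      * if k = 0 then 1 else t) := by
  rcases zmod_two_cases g with rfl | rfl <;> rcases zmod_two_cases h with rfl | rfl <;>
    fin_cases i <;> fin_cases j <;> fin_cases k <;> simp [Table.coef, mult]

theorem ofEntries_zero_apply (x : Fin 8 → ℂ) (a b c d : ℂ) :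
    ofEntries 0 x (![a, b], ![c, d]) = (![a * x 0 + b * x 1, a * x 2 + b * x 3],
      ![c * x 4 + d * x 5, c * x 6 + d * x 7]) := by
  have hv : ZMod.val (1 : ZMod 2) = 1 := rfl
  ext n <;> fin_cases n <;>
    simp [ofEntries, sum_zmod_two, Fin.sum_univ_two, pos, hv, bas, coord] <;> ring

theorem ofEntries_one_apply (x : Fin 8 → ℂ) (a b c d : ℂ) :
    ofEntries 1 x (![a, b], ![c, d]) = (![c * x 4 + d * x 5, c * x 6 + d * x 7],
      ![a * x 0 + b * x 1, a * x 2 + b * x 3]) := by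
  have hv : ZMod.val (1 : ZMod 2) = 1 := rfl
  have h2 : (1 + 1 : ZMod 2) = 0 := by decide
  ext n <;> fin_cases n <;>
    simp [ofEntries, sum_zmod_two, Fin.sum_univ_two, pos, hv, h2, bas, coord] <;> ring

/-- An even derivation kills both idempotents and acts on the odd part by a matrix that annihilates
`f₁f₂`, that is, of trace zero. No further condition arises, and the result is a copy of `sl₂` for
every `t`. -/
theorem famTable_finrank_zero (t : ℂ) :
    Module.finrank ℂ ((famTable t).alg.derivations 0) = 3 := by
  have hv : ZMod.val (1 : ZMod 2) = 1 := rfl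
  have h2 : (1 + 1 : ZMod 2) = 0 := by decide
  have hs : sign 0 = 1 := by simp [sign]
  rw [derivations_eq_genDer]
  let rows : List (List ℤ) := [[1, 0, 0, 0, 0, 0, 0, 0], [0, 1, 0, 0, 0, 0, 0, 0],
    [0, 0, 1, 0, 0, 0, 0, 0], [0, 0, 0, 1, 0, 0, 0, 0], [0, 0, 0, 0, 1, 0, 0, 1]]
  have hrows : ∀ x : Fin 8 → ℂ, x ∈ zeroSpace 8 rows ↔
      x 0 = 0 ∧ x 1 = 0 ∧ x 2 = 0 ∧ x 3 = 0 ∧ x 4 + x 7 = 0 := by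
    intro x
    simp [mem_zeroSpace, rows, evalRow, Fin.sum_univ_eight]
  have key : ∀ x, ofEntries 0 x ∈ (famTable t).alg.genDer (derSpec 0) ↔ x ∈ zeroSpace 8 rows := by
    intro x
    rw [hrows]
    constructor
    · intro H
      rw [show ofEntries 0 x = ofEntries (derSpec 0).d x from rfl, ofEntries_mem_genDer] at H
      simp only [derSpec, quad_one, isign_eq, zero_mul, add_zero, famTable_coef] at H
      -- The equations come from `e₁²`, `e₂²` and `f₁f₂`. For the last one the coordinate at `e₁` is
      -- used, since it is nonzero whatever `t` is.
      have a₁ := H 0 0 0 0 0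
      have a₂ := H 0 0 0 0 1
      have a₃ := H 0 0 1 1 0
      have a₄ := H 0 0 1 1 1
      have a₅ := H 1 1 0 1 0
      simp [pos, hv, h2, sign] at a₁ a₂ a₃ a₄ a₅
      exact ⟨a₁, a₃, a₂, a₄, by linear_combination a₁ + t * a₃ - a₅⟩
    · rintro ⟨h₀, h₁, h₂, h₃, h₄⟩
      have h₇ : x 7 = - x 4 := by linear_combination h₄
      refine ⟨ofEntries_mem_part _ 0 x, fun i j y hy z hz => ?_⟩
      obtain ⟨a, b, ⟨rfl, rfl⟩ | ⟨rfl, rfl⟩⟩ := exists_of_mem_part hy <;>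
      obtain ⟨c, d, ⟨rfl, rfl⟩ | ⟨rfl, rfl⟩⟩ := exists_of_mem_part hz <;>
      simp only [derSpec, quad_one, isign_eq, Int.cast_one, hs, zero_mul, one_smul, famTable_mul,
        ofEntries_zero_apply, Prod.mk_add_mk, Matrix.cons_add_cons, Matrix.empty_add_empty, h₀, h₁,
        h₂, h₃, h₇] <;>
      apply model_ext <;> ring
  have hm : (famTable t).alg.genDer (derSpec 0) = (zeroSpace 8 rows).map (ofEntries 0) := by
    ext D
    constructor
    · intro hD
      obtain ⟨x, rfl⟩ := exists_ofEntries (c := famTable t) hD.1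
      exact ⟨x, (key x).1 hD, rfl⟩
    · rintro ⟨x, hx, rfl⟩
      exact (key x).2 hx
  rw [hm, ← LinearEquiv.finrank_eq (Submodule.equivMapOfInjective _ (ofEntries_injective 0) _)]
  have := finrank_zeroSpace 8 rows (by decide)
  have hr : rankZ 8 rows = 5 := by decide +kernel
  omega


/-- An odd derivation is determined by the image of `e₁`, which is an arbitrary odd vector. -/
theorem famTable_finrank_one (t : ℂ) :
    Module.finrank ℂ ((famTable t).alg.derivations 1) = 2 := by
  have hv : ZMod.val (1 : ZMod 2) = 1 := rfl
  have h2 : (1 + 1 : ZMod 2) = 0 := by decide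
  have hs : sign 0 = 1 := by simp [sign]
  have hs' : sign 1 = -1 := by simp [sign, hv]
  rw [derivations_eq_genDer]
  -- The entries of the two derivations with `e₁ ↦ f₁` and `e₁ ↦ f₂`.
  let v : Fin 8 → ℂ := ![1, -1, 0, 0, 0, -2, 0, 2 * t]
  let w : Fin 8 → ℂ := ![0, 0, 1, -1, 2, 0, -2 * t, 0]
  have hvw : ∀ a b : ℂ, a • v + b • w = ![a, -a, b, -b, 2 * b, -2 * a, -2 * t * b, 2 * t * a] := by
    intro a b
    simp only [v, w, Matrix.smul_cons, Matrix.smul_empty, Matrix.cons_add_cons,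
      Matrix.empty_add_empty, smul_eq_mul]
    ring_nf
  have hrange : ∀ x, x ∈ Submodule.span ℂ {v, w} ↔ x 1 = -x 0 ∧ x 3 = -x 2 ∧ x 4 = 2 * x 2 ∧
      x 5 = -2 * x 0 ∧ x 6 = -2 * t * x 2 ∧ x 7 = 2 * t * x 0 := by
    intro x
    rw [Submodule.mem_span_pair]
    constructor
    · rintro ⟨a, b, rfl⟩
      rw [hvw]
      exact ⟨rfl, rfl, rfl, rfl, rfl, rfl⟩
    · rintro ⟨h₁, h₂, h₃, h₄, h₅, h₆⟩
      refine ⟨x 0, x 2, ?_⟩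
      rw [hvw, ← h₁, ← h₂, ← h₃, ← h₄, ← h₅, ← h₆]
      ext n
      fin_cases n <;> rfl
  have hli : Module.finrank ℂ (Submodule.span ℂ {v, w}) = 2 := by
    have : LinearIndependent ℂ ![v, w] := by
      rw [LinearIndependent.pair_iff]
      intro a b hab
      rw [hvw] at hab
      exact ⟨congrFun hab 0, congrFun hab 2⟩
    have h := finrank_span_eq_card this
    rwa [Matrix.range_cons, Matrix.range_cons, Matrix.range_empty, Set.union_empty] at h
  have key : ∀ x, ofEntries 1 x ∈ (famTable t).alg.genDer (derSpec 1) ↔ x ∈ Submodule.span ℂ {v, w} := by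
    intro x
    rw [hrange]
    constructor
    · intro H
      rw [show ofEntries 1 x = ofEntries (derSpec 1).d x from rfl, ofEntries_mem_genDer] at H
      simp only [derSpec, quad_one, isign_eq, one_mul, famTable_coef] at H
      -- The product `e₁e₂ = 0` gives `D(e₂) = -D(e₁)`; the products `e₁fₚ = ½fₚ` then fix the
      -- images of the odd basis vectors.
      have a₁ := H 0 0 0 1 0
      have a₂ := H 0 0 0 1 1
      have a₃ := H 0 1 0 0 0
      have a₄ := H 0 1 0 1 0
      have a₅ := H 0 1 0 0 1
      have a₆ := H 0 1 0 1 1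
      simp [pos, hv, h2, sign] at a₁ a₂ a₃ a₄ a₅ a₆
      refine ⟨?_, ?_, ?_, ?_, ?_, ?_⟩
      · linear_combination -2 * a₁
      · linear_combination -2 * a₂
      · linear_combination -2 * a₃
      · linear_combination -2 * a₄
      · linear_combination 2 * a₅
      · linear_combination 2 * a₆
    · rintro ⟨h₁, h₃, h₄, h₅, h₆, h₇⟩
      refine ⟨ofEntries_mem_part _ 1 x, fun i j y hy z hz => ?_⟩
      obtain ⟨a, b, ⟨rfl, rfl⟩ | ⟨rfl, rfl⟩⟩ := exists_of_mem_part hy <;>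
      obtain ⟨c, d, ⟨rfl, rfl⟩ | ⟨rfl, rfl⟩⟩ := exists_of_mem_part hz <;>
      simp only [derSpec, quad_one, isign_eq, Int.cast_one, hs, hs', one_mul, one_smul,
        famTable_mul, ofEntries_one_apply, Prod.mk_add_mk, Matrix.cons_add_cons,
        Matrix.empty_add_empty, Prod.smul_mk, Matrix.smul_cons, Matrix.smul_empty, smul_eq_mul,
        h₁, h₃, h₄, h₅, h₆, h₇] <;>
      apply model_ext <;> ring
  have hm : (famTable t).alg.genDer (derSpec 1) = (Submodule.span ℂ {v, w}).map (ofEntries 1) := by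
    ext D
    constructor
    · intro hD
      obtain ⟨x, rfl⟩ := exists_ofEntries (c := famTable t) hD.1
      exact ⟨x, (key x).1 hD, rfl⟩
    · rintro ⟨x, hx, rfl⟩
      exact (key x).2 hx
  rw [hm, ← LinearEquiv.finrank_eq (Submodule.equivMapOfInjective _ (ofEntries_injective 1) _),
    hli]

end JordanSuper

namespace JordanSuper

/-! ### Isomorphisms from bases -/

section

variable {A : Type*} [AddCommGroup A] [Module ℂ A]

/-- Supercommutativity. -/
def Superalgebra.SuperComm (S : Superalgebra A) : Prop :=
  ∀ i j : ZMod 2, ∀ x ∈ S.part i, ∀ y ∈ S.part j, S.mul x y = sign (i * j) • S.mul y x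

theorem Superalgebra.eq_zero_of_add_eq_zero (S : Superalgebra A) {x y : A} (hx : x ∈ S.part 0)
    (hy : y ∈ S.part 1) (h : x + y = 0) : x = 0 ∧ y = 0 := by
  have h1 : x = 0 := by
    refine (Submodule.mem_bot ℂ).1 ((disjoint_iff.1 S.isCompl.1) ▸ Submodule.mem_inf.2 ⟨hx, ?_⟩)
    rw [eq_neg_of_add_eq_zero_left h]
    exact neg_mem hy
  exact ⟨h1, by simpa [h1] using h⟩

/-- The linear map sending the standard basis to `b` is injective because independence may be tested
in each parity separately, and bijective by dimension. Multiplicativity needs to be checked on basis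
vectors only. -/
theorem Superalgebra.isomorphic_of_basis {S : Superalgebra A} {c : Table 2 2}
    (b : ZMod 2 → Fin 2 → A) (hmem : ∀ g i, b g i ∈ S.part g)
    (hli : ∀ g, LinearIndependent ℂ (b g)) [Module.Finite ℂ A] (hdim : Module.finrank ℂ A = 4)
    (hprod : ∀ g h i j, S.mul (b g i) (b h j) = ∑ k, c.coef g h i j k • b (g + h) k) :
    S.Isomorphic c.alg := by
  let ψ : Model 2 2 →ₗ[ℂ] A := ∑ g, ∑ i, (coord g i).smulRight (b g i)
  have hψ : ∀ g i, ψ (bas g i) = b g i := by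
    intro g i
    rcases zmod_two_cases g with rfl | rfl <;> fin_cases i <;>
      simp [ψ, sum_zmod_two, Fin.sum_univ_two, coord_bas]
  have hψ' : ∀ x, ψ x = ∑ i, coord 0 i x • b 0 i + ∑ i, coord 1 i x • b 1 i := by
    intro x
    simp [ψ, sum_zmod_two, Fin.sum_univ_two]
  have hinj : Function.Injective ψ := by
    rw [← LinearMap.ker_eq_bot, LinearMap.ker_eq_bot']
    intro x hx
    rw [hψ'] at hx
    obtain ⟨h0, h1⟩ := S.eq_zero_of_add_eq_zero
      (sum_mem fun i _ => Submodule.smul_mem _ _ (hmem 0 i))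
      (sum_mem fun i _ => Submodule.smul_mem _ _ (hmem 1 i)) hx
    have h0' := Fintype.linearIndependent_iff.1 (hli 0) _ h0
    have h1' := Fintype.linearIndependent_iff.1 (hli 1) _ h1
    rw [eq_sum_bas x, sum_zmod_two]
    simp [h0', h1']
  have hfin : Module.finrank ℂ (Model 2 2) = Module.finrank ℂ A := by
    rw [hdim, Module.finrank_prod, Module.finrank_fin_fun]
  let e : Model 2 2 ≃ₗ[ℂ] A := LinearMap.linearEquivOfInjective ψ hinj hfin
  have he : ∀ x, e x = ψ x := fun x => rfl
  refine Isomorphic.symm ⟨e, fun x y => ?_, fun g => ?_⟩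
  · have : c.alg.mul.compr₂ ψ = S.mul.compl₁₂ ψ ψ := by
      refine ext_bas fun g i => ext_bas fun h j => ?_
      simp only [LinearMap.compr₂_apply, LinearMap.compl₁₂_apply, hψ, hprod, mul_bas, map_sum,
        map_smul]
    exact LinearMap.congr_fun₂ this x y
  · have hle : ∀ g, ∀ x ∈ c.alg.part g, e x ∈ S.part g := by
      intro g x hx
      rw [(mem_part_iff c g x).1 hx, he, map_add, map_smul, map_smul, hψ, hψ]
      exact add_mem (Submodule.smul_mem _ _ (hmem g 0)) (Submodule.smul_mem _ _ (hmem g 1))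
    -- For the reverse inclusion, the component of the wrong parity of a preimage maps into both
    -- parts, hence to zero.
    apply le_antisymm
    · rintro _ ⟨x, hx, rfl⟩
      exact hle g x hx
    · intro y hy
      obtain ⟨x, rfl⟩ := e.surjective y
      obtain ⟨x₀, hx₀, x₁, hx₁, rfl⟩ : ∃ x₀ ∈ c.alg.part 0, ∃ x₁ ∈ c.alg.part 1, x₀ + x₁ = x := by
        apply Submodule.mem_sup.1
        rw [codisjoint_iff.1 c.alg.isCompl.2]
        trivial
      rw [map_add] at hy
      rcases zmod_two_cases g with rfl | rfl
      · have h1 := (Submodule.add_mem_iff_right _ (hle 0 _ hx₀)).1 hy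
        have := (S.eq_zero_of_add_eq_zero h1 (neg_mem (hle 1 _ hx₁)) (add_neg_cancel _)).1
        rw [map_add, this, add_zero]
        exact ⟨x₀, hx₀, rfl⟩
      · have h1 := (Submodule.add_mem_iff_left _ (hle 1 _ hx₁)).1 hy
        have := (S.eq_zero_of_add_eq_zero (hle 0 _ hx₀) (neg_mem h1) (add_neg_cancel _)).1
        rw [map_add, this, zero_add]
        exact ⟨x₁, hx₁, rfl⟩

/-- A supercommutative superalgebra with an even and an odd basis of length two is given by the
table of eight products. -/
theorem Superalgebra.SuperComm.isomorphic_mult {S : Superalgebra A} (hS : S.SuperComm)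
    [Module.Finite ℂ A] (hdim : Module.finrank ℂ A = 4) {a b f g : A}
    (ha : a ∈ S.part 0) (hb : b ∈ S.part 0) (hf : f ∈ S.part 1) (hg : g ∈ S.part 1)
    (hab : LinearIndependent ℂ ![a, b]) (hfg : LinearIndependent ℂ ![f, g])
    {p₁ p₂ p₃ p₄ p₅ p₆ p₇ p₈ : Fin 2 → ℂ}
    (h₁ : S.mul a a = p₁ 0 • a + p₁ 1 • b) (h₂ : S.mul a b = p₂ 0 • a + p₂ 1 • b)
    (h₃ : S.mul b b = p₃ 0 • a + p₃ 1 • b) (h₄ : S.mul a f = p₄ 0 • f + p₄ 1 • g)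
    (h₅ : S.mul a g = p₅ 0 • f + p₅ 1 • g) (h₆ : S.mul b f = p₆ 0 • f + p₆ 1 • g)
    (h₇ : S.mul b g = p₇ 0 • f + p₇ 1 • g) (h₈ : S.mul f g = p₈ 0 • a + p₈ 1 • b) :
    S.Isomorphic (mult p₁ p₂ p₃ p₄ p₅ p₆ p₇ p₈).alg := by
  have hv : ZMod.val (1 : ZMod 2) = 1 := rfl
  have h2 : (1 + 1 : ZMod 2) = 0 := by decide
  have hs : sign 0 = 1 := by simp [sign]
  have hs' : sign 1 = -1 := by simp [sign, hv]
  have k₂ := hS 0 0 b hb a ha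
  have k₄ := hS 1 0 f hf a ha
  have k₅ := hS 1 0 g hg a ha
  have k₆ := hS 1 0 f hf b hb
  have k₇ := hS 1 0 g hg b hb
  have k₈ := hS 1 1 g hg f hf
  have hsq : ∀ x ∈ S.part 1, S.mul x x = 0 := by
    intro x hx
    have h := hS 1 1 x hx x hx
    rw [mul_one, hs', neg_smul, one_smul] at h
    have : (2 : ℂ) • S.mul x x = 0 := by
      rw [two_smul]
      nth_rewrite 1 [h]
      exact neg_add_cancel _
    exact (smul_eq_zero.1 this).resolve_left two_ne_zero
  have kf := hsq f hf
  have kg := hsq g hg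
  simp only [mul_zero, mul_one, hs, hs', one_smul, neg_smul] at k₂ k₄ k₅ k₆ k₇ k₈
  refine isomorphic_of_basis (fun i => if i = 0 then ![a, b] else ![f, g]) ?_ ?_ hdim ?_
  · intro i j
    rcases zmod_two_cases i with rfl | rfl <;> fin_cases j <;> simpa
  · intro i
    rcases zmod_two_cases i with rfl | rfl
    · exact hab
    · exact hfg
  · intro i j k l
    rcases zmod_two_cases i with rfl | rfl <;> rcases zmod_two_cases j with rfl | rfl <;>
      fin_cases k <;> fin_cases l <;>
      simp [Table.coef, mult, h2, h₁, h₂, h₃, h₄, h₅, h₆, h₇, h₈, k₂, k₄, k₅, k₆, k₇, k₈, kf, kg]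

end

/-- Tables with symmetric products of even and alternating products of odd basis vectors. -/
def Table.Symm {m n : ℕ} (c : Table m n) : Prop :=
  (∀ i j, c.ee i j = c.ee j i) ∧ ∀ p q, c.ff p q = -c.ff q p

theorem Table.Symm.superComm {m n : ℕ} {c : Table m n} (h : c.Symm) : c.alg.SuperComm := by
  have hv : ZMod.val (1 : ZMod 2) = 1 := rfl
  have hee : ∀ v w : Fin m → ℂ,
      ∑ i, ∑ j, (v i * w j) • c.ee i j = ∑ i, ∑ j, (w i * v j) • c.ee i j := by
    intro v w
    rw [Finset.sum_comm]
    refine Finset.sum_congr rfl fun i _ => Finset.sum_congr rfl fun j _ => ?_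
    rw [h.1, mul_comm]
  have hff : ∀ v w : Fin n → ℂ,
      ∑ i, ∑ j, (v i * w j) • c.ff i j = -∑ i, ∑ j, (w i * v j) • c.ff i j := by
    intro v w
    rw [Finset.sum_comm, ← Finset.sum_neg_distrib]
    refine Finset.sum_congr rfl fun i _ => ?_
    rw [← Finset.sum_neg_distrib]
    refine Finset.sum_congr rfl fun j _ => ?_
    rw [h.2, smul_neg, mul_comm]
  have hp : ∀ (i : ZMod 2) (x : Model m n), x ∈ c.alg.part i →
      (i = 0 ∧ x.2 = 0) ∨ (i = 1 ∧ x.1 = 0) := by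
    intro i x hx
    rcases zmod_two_cases i with rfl | rfl <;> simpa [Table.alg, Submodule.mem_prod] using hx
  intro i j x hx y hy
  obtain ⟨x₀, x₁⟩ := x
  obtain ⟨y₀, y₁⟩ := y
  rcases hp i _ hx with ⟨rfl, h1⟩ | ⟨rfl, h1⟩ <;> rcases hp j _ hy with ⟨rfl, h2⟩ | ⟨rfl, h2⟩ <;>
    simp only at h1 h2 <;> subst h1 h2 <;> simp [Table.alg, sign, hv]
  · exact hee _ _
  · exact hff _ _

theorem Superalgebra.SuperComm.prod {A B : Type*} [AddCommGroup A] [Module ℂ A] [AddCommGroup B]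
    [Module ℂ B] {S : Superalgebra A} {T : Superalgebra B} (hS : S.SuperComm) (hT : T.SuperComm) :
    (S.prod T).SuperComm := by
  intro i j x hx y hy
  exact Prod.ext (hS i j _ hx.1 _ hy.1) (hT i j _ hx.2 _ hy.2)

end JordanSuper

namespace JordanSuper
set_option linter.unusedSimpArgs false

/-! ### Decompositions -/

/-- `SuperComm.isomorphic_mult` with all the hypotheses on the basis in one conjunction. -/
theorem Superalgebra.SuperComm.isomorphic_mult_of_products {A : Type*} [AddCommGroup A]
    [Module ℂ A] {S : Superalgebra A} (hS : S.SuperComm) [Module.Finite ℂ A]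
    (hdim : Module.finrank ℂ A = 4) {a b f g : A} {p₁ p₂ p₃ p₄ p₅ p₆ p₇ p₈ : Fin 2 → ℂ}
    (h : a ∈ S.part 0 ∧ b ∈ S.part 0 ∧ f ∈ S.part 1 ∧ g ∈ S.part 1 ∧
      LinearIndependent ℂ ![a, b] ∧ LinearIndependent ℂ ![f, g] ∧
      S.mul a a = p₁ 0 • a + p₁ 1 • b ∧ S.mul a b = p₂ 0 • a + p₂ 1 • b ∧
      S.mul b b = p₃ 0 • a + p₃ 1 • b ∧ S.mul a f = p₄ 0 • f + p₄ 1 • g ∧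
      S.mul a g = p₅ 0 • f + p₅ 1 • g ∧ S.mul b f = p₆ 0 • f + p₆ 1 • g ∧
      S.mul b g = p₇ 0 • f + p₇ 1 • g ∧ S.mul f g = p₈ 0 • a + p₈ 1 • b) :
    S.Isomorphic (mult p₁ p₂ p₃ p₄ p₅ p₆ p₇ p₈).alg := by
  obtain ⟨ha, hb, hf, hg, hab, hfg, h₁, h₂, h₃, h₄, h₅, h₆, h₇, h₈⟩ := h
  exact hS.isomorphic_mult hdim ha hb hf hg hab hfg h₁ h₂ h₃ h₄ h₅ h₆ h₇ h₈

theorem superComm_U1 : U1.SuperComm :=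
  Table.Symm.superComm ⟨by simp [Fin.forall_fin_two], by simp [Fin.forall_fin_two]⟩

theorem superComm_U2 : U2.SuperComm :=
  Table.Symm.superComm ⟨by simp [Fin.forall_fin_two], by simp [Fin.forall_fin_two]⟩

theorem superComm_B1 : B1.SuperComm :=
  Table.Symm.superComm ⟨by simp [Fin.forall_fin_two], by simp [Fin.forall_fin_two]⟩

theorem superComm_B2 : B2.SuperComm :=
  Table.Symm.superComm ⟨by simp [Fin.forall_fin_two], by simp [Fin.forall_fin_two]⟩

theorem superComm_B3 : B3.SuperComm :=
  Table.Symm.superComm ⟨by simp [Fin.forall_fin_two], by simp [Fin.forall_fin_two]⟩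

theorem superComm_S1_1 : S1_1.SuperComm :=
  Table.Symm.superComm ⟨by simp [Fin.forall_fin_two], by simp [Fin.forall_fin_two]⟩

theorem superComm_S2_1 : S2_1.SuperComm :=
  Table.Symm.superComm ⟨by simp [Fin.forall_fin_two], by simp [Fin.forall_fin_two]⟩

theorem superComm_S2_2 : S2_2.SuperComm :=
  Table.Symm.superComm ⟨by simp [Fin.forall_fin_two], by simp [Fin.forall_fin_two]⟩

theorem superComm_S3_1 : S3_1.SuperComm :=
  Table.Symm.superComm ⟨by simp [Fin.forall_fin_two], by simp [Fin.forall_fin_two]⟩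

theorem superComm_S3_2 : S3_2.SuperComm :=
  Table.Symm.superComm ⟨by simp [Fin.forall_fin_two], by simp [Fin.forall_fin_two]⟩

theorem superComm_S3_3 : S3_3.SuperComm :=
  Table.Symm.superComm ⟨by simp [Fin.forall_fin_two], by simp [Fin.forall_fin_two]⟩

theorem superComm_S3_4 : S3_4.SuperComm :=
  Table.Symm.superComm ⟨by simp [Fin.forall_fin_two], by simp [Fin.forall_fin_two]⟩

theorem superComm_S3_5 : S3_5.SuperComm :=
  Table.Symm.superComm ⟨by simp [Fin.forall_fin_two], by simp [Fin.forall_fin_two]⟩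

theorem superComm_S3_6 : S3_6.SuperComm :=
  Table.Symm.superComm ⟨by simp [Fin.forall_fin_two], by simp [Fin.forall_fin_two]⟩

theorem superComm_S3_7 : S3_7.SuperComm :=
  Table.Symm.superComm ⟨by simp [Fin.forall_fin_two], by simp [Fin.forall_fin_two]⟩

theorem superComm_S3_8 : S3_8.SuperComm :=
  Table.Symm.superComm ⟨by simp [Fin.forall_fin_two], by simp [Fin.forall_fin_two]⟩

theorem superComm_S3_9 : S3_9.SuperComm :=
  Table.Symm.superComm ⟨by simp [Fin.forall_fin_two], by simp [Fin.forall_fin_two]⟩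

theorem superComm_S3_10 : S3_10.SuperComm :=
  Table.Symm.superComm ⟨by simp [Fin.forall_fin_two], by simp [Fin.forall_fin_two]⟩

theorem superComm_S3_11 : S3_11.SuperComm :=
  Table.Symm.superComm ⟨by simp [Fin.forall_fin_two], by simp [Fin.forall_fin_two]⟩

theorem superComm_S3_12 : S3_12.SuperComm :=
  Table.Symm.superComm ⟨by simp [Fin.forall_fin_two], by simp [Fin.forall_fin_two]⟩

theorem superComm_S3_13 : S3_13.SuperComm :=
  Table.Symm.superComm ⟨by simp [Fin.forall_fin_two], by simp [Fin.forall_fin_two]⟩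

open Superalgebra Module

/-- Each of the decompositions is verified by exhibiting, inside the direct sum, a homogeneous basis
with the eight products of the table. The basis vectors are those of the summands, ordered to match
the table. -/
theorem hasDecomposition_1 (t : ℂ) : HasDecomposition (𝒥 1 t) 1 := by
  refine ((superComm_U1.prod (superComm_U1.prod (superComm_S1_1.prod superComm_S1_1))).isomorphic_mult_of_products
    (by simp [finrank_prod])
    (a := ((1, 0), 0, 0, 0)) (b := (0, (1, 0), 0, 0))
    (f := (0, 0, (0, 1), 0)) (g := (0, 0, 0, (0, 1))) ?_).symm
  simp [U1, S1_1, prod, Table.alg, Submodule.mem_prod, LinearIndependent.pair_iff, Prod.ext_iff,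
    funext_iff, Fin.forall_fin_two, Fin.sum_univ_two]

theorem hasDecomposition_2 (t : ℂ) : HasDecomposition (𝒥 2 t) 2 := by
  refine ((superComm_U1.prod (superComm_S2_2.prod superComm_S1_1)).isomorphic_mult_of_products
    (by simp [finrank_prod])
    (a := ((1, 0), 0, 0)) (b := (0, (1, 0), 0))
    (f := (0, 0, (0, 1))) (g := (0, (0, 1), 0)) ?_).symm
  simp [U1, S2_2, S1_1, prod, Table.alg, Submodule.mem_prod, LinearIndependent.pair_iff, Prod.ext_iff,
    funext_iff, Fin.forall_fin_two, Fin.sum_univ_two]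

theorem hasDecomposition_3 (t : ℂ) : HasDecomposition (𝒥 3 t) 3 := by
  refine ((superComm_U1.prod (superComm_S2_1.prod superComm_S1_1)).isomorphic_mult_of_products
    (by simp [finrank_prod])
    (a := ((1, 0), 0, 0)) (b := (0, (1, 0), 0))
    (f := (0, 0, (0, 1))) (g := (0, (0, 1), 0)) ?_).symm
  simp [U1, S2_1, S1_1, prod, Table.alg, Submodule.mem_prod, LinearIndependent.pair_iff, Prod.ext_iff,
    funext_iff, Fin.forall_fin_two, Fin.sum_univ_two]

theorem hasDecomposition_4 (t : ℂ) : HasDecomposition (𝒥 4 t) 4 := by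
  refine ((superComm_U1.prod superComm_S3_6).isomorphic_mult_of_products
    (by simp [finrank_prod])
    (a := ((1, 0), 0)) (b := (0, (1, 0)))
    (f := (0, (0, ![1, 0]))) (g := (0, (0, ![0, 1]))) ?_).symm
  simp [U1, S3_6, prod, Table.alg, Submodule.mem_prod, LinearIndependent.pair_iff, Prod.ext_iff,
    funext_iff, Fin.forall_fin_two, Fin.sum_univ_two]

theorem hasDecomposition_5 (t : ℂ) : HasDecomposition (𝒥 5 t) 5 := by
  refine ((superComm_U1.prod superComm_S3_4).isomorphic_mult_of_products
    (by simp [finrank_prod])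
    (a := ((1, 0), 0)) (b := (0, (1, 0)))
    (f := (0, (0, ![1, 0]))) (g := (0, (0, ![0, 1]))) ?_).symm
  simp [U1, S3_4, prod, Table.alg, Submodule.mem_prod, LinearIndependent.pair_iff, Prod.ext_iff,
    funext_iff, Fin.forall_fin_two, Fin.sum_univ_two]

theorem hasDecomposition_6 (t : ℂ) : HasDecomposition (𝒥 6 t) 6 := by
  refine ((superComm_U1.prod superComm_S3_8).isomorphic_mult_of_products
    (by simp [finrank_prod])
    (a := ((1, 0), 0)) (b := (0, (1, 0)))
    (f := (0, (0, ![1, 0]))) (g := (0, (0, ![0, 1]))) ?_).symm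
  simp [U1, S3_8, prod, Table.alg, Submodule.mem_prod, LinearIndependent.pair_iff, Prod.ext_iff,
    funext_iff, Fin.forall_fin_two, Fin.sum_univ_two]

theorem hasDecomposition_7 (t : ℂ) : HasDecomposition (𝒥 7 t) 7 := by
  refine ((superComm_U1.prod superComm_S3_5).isomorphic_mult_of_products
    (by simp [finrank_prod])
    (a := ((1, 0), 0)) (b := (0, (1, 0)))
    (f := (0, (0, ![1, 0]))) (g := (0, (0, ![0, 1]))) ?_).symm
  simp [U1, S3_5, prod, Table.alg, Submodule.mem_prod, LinearIndependent.pair_iff, Prod.ext_iff,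
    funext_iff, Fin.forall_fin_two, Fin.sum_univ_two]

theorem hasDecomposition_8 (t : ℂ) : HasDecomposition (𝒥 8 t) 8 := by
  refine ((superComm_U1.prod superComm_S3_7).isomorphic_mult_of_products
    (by simp [finrank_prod])
    (a := ((1, 0), 0)) (b := (0, (1, 0)))
    (f := (0, (0, ![1, 0]))) (g := (0, (0, ![0, 1]))) ?_).symm
  simp [U1, S3_7, prod, Table.alg, Submodule.mem_prod, LinearIndependent.pair_iff, Prod.ext_iff,
    funext_iff, Fin.forall_fin_two, Fin.sum_univ_two]

theorem hasDecomposition_9 (t : ℂ) : HasDecomposition (𝒥 9 t) 9 := by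
  refine ((superComm_S3_13.prod superComm_S1_1).isomorphic_mult_of_products
    (by simp [finrank_prod])
    (a := ((![1, 0], 0), 0)) (b := ((![0, 1], 0), 0))
    (f := (0, (0, 1))) (g := ((0, 1), 0)) ?_).symm
  simp [S3_13, S1_1, prod, Table.alg, Submodule.mem_prod, LinearIndependent.pair_iff, Prod.ext_iff,
    funext_iff, Fin.forall_fin_two, Fin.sum_univ_two]

theorem hasDecomposition_10 (t : ℂ) : HasDecomposition (𝒥 10 t) 10 := by
  refine ((superComm_S2_1.prod superComm_S2_2).isomorphic_mult_of_products
    (by simp [finrank_prod])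
    (a := ((1, 0), 0)) (b := (0, (1, 0)))
    (f := (0, (0, 1))) (g := ((0, 1), 0)) ?_).symm
  simp [S2_1, S2_2, prod, Table.alg, Submodule.mem_prod, LinearIndependent.pair_iff, Prod.ext_iff,
    funext_iff, Fin.forall_fin_two, Fin.sum_univ_two]

theorem hasDecomposition_12 (t : ℂ) : HasDecomposition (𝒥 12 t) 12 := by
  refine ((superComm_S2_1.prod superComm_S2_1).isomorphic_mult_of_products
    (by simp [finrank_prod])
    (a := ((1, 0), 0)) (b := (0, (1, 0)))
    (f := (0, (0, 1))) (g := ((0, 1), 0)) ?_).symm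
  simp [S2_1, prod, Table.alg, Submodule.mem_prod, LinearIndependent.pair_iff, Prod.ext_iff,
    funext_iff, Fin.forall_fin_two, Fin.sum_univ_two]

theorem hasDecomposition_14 (t : ℂ) : HasDecomposition (𝒥 14 t) 14 := by
  refine ((superComm_S2_2.prod superComm_S2_2).isomorphic_mult_of_products
    (by simp [finrank_prod])
    (a := ((1, 0), 0)) (b := (0, (1, 0)))
    (f := (0, (0, 1))) (g := ((0, 1), 0)) ?_).symm
  simp [S2_2, prod, Table.alg, Submodule.mem_prod, LinearIndependent.pair_iff, Prod.ext_iff,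
    funext_iff, Fin.forall_fin_two, Fin.sum_univ_two]

theorem hasDecomposition_17 (t : ℂ) : HasDecomposition (𝒥 17 t) 17 := by
  refine ((superComm_U2.prod superComm_S3_2).isomorphic_mult_of_products
    (by simp [finrank_prod])
    (a := (0, (1, 0))) (b := ((1, 0), 0))
    (f := (0, (0, ![1, 0]))) (g := (0, (0, ![0, 1]))) ?_).symm
  simp [U2, S3_2, prod, Table.alg, Submodule.mem_prod, LinearIndependent.pair_iff, Prod.ext_iff,
    funext_iff, Fin.forall_fin_two, Fin.sum_univ_two]

theorem hasDecomposition_18 (t : ℂ) : HasDecomposition (𝒥 18 t) 18 := by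
  refine ((superComm_U2.prod superComm_S3_3).isomorphic_mult_of_products
    (by simp [finrank_prod])
    (a := ((1, 0), 0)) (b := (0, (1, 0)))
    (f := (0, (0, ![1, 0]))) (g := (0, (0, ![0, 1]))) ?_).symm
  simp [U2, S3_3, prod, Table.alg, Submodule.mem_prod, LinearIndependent.pair_iff, Prod.ext_iff,
    funext_iff, Fin.forall_fin_two, Fin.sum_univ_two]

theorem hasDecomposition_20 (t : ℂ) : HasDecomposition (𝒥 20 t) 20 := by
  refine ((superComm_U2.prod superComm_S3_1).isomorphic_mult_of_products
    (by simp [finrank_prod])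
    (a := ((1, 0), 0)) (b := (0, (1, 0)))
    (f := (0, (0, ![1, 0]))) (g := (0, (0, ![0, 1]))) ?_).symm
  simp [U2, S3_1, prod, Table.alg, Submodule.mem_prod, LinearIndependent.pair_iff, Prod.ext_iff,
    funext_iff, Fin.forall_fin_two, Fin.sum_univ_two]

theorem hasDecomposition_21 (t : ℂ) : HasDecomposition (𝒥 21 t) 21 := by
  refine ((superComm_U1.prod (superComm_U2.prod (superComm_S1_1.prod superComm_S1_1))).isomorphic_mult_of_products
    (by simp [finrank_prod])
    (a := ((1, 0), 0, 0, 0)) (b := (0, (1, 0), 0, 0))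
    (f := (0, 0, (0, 1), 0)) (g := (0, 0, 0, (0, 1))) ?_).symm
  simp [U1, U2, S1_1, prod, Table.alg, Submodule.mem_prod, LinearIndependent.pair_iff, Prod.ext_iff,
    funext_iff, Fin.forall_fin_two, Fin.sum_univ_two]

theorem hasDecomposition_22 (t : ℂ) : HasDecomposition (𝒥 22 t) 22 := by
  refine ((superComm_U1.prod superComm_S3_2).isomorphic_mult_of_products
    (by simp [finrank_prod])
    (a := ((1, 0), 0)) (b := (0, (1, 0)))
    (f := (0, (0, ![1, 0]))) (g := (0, (0, ![0, 1]))) ?_).symm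
  simp [U1, S3_2, prod, Table.alg, Submodule.mem_prod, LinearIndependent.pair_iff, Prod.ext_iff,
    funext_iff, Fin.forall_fin_two, Fin.sum_univ_two]

theorem hasDecomposition_23 (t : ℂ) : HasDecomposition (𝒥 23 t) 23 := by
  refine ((superComm_U1.prod superComm_S3_3).isomorphic_mult_of_products
    (by simp [finrank_prod])
    (a := ((1, 0), 0)) (b := (0, (1, 0)))
    (f := (0, (0, ![1, 0]))) (g := (0, (0, ![0, 1]))) ?_).symm
  simp [U1, S3_3, prod, Table.alg, Submodule.mem_prod, LinearIndependent.pair_iff, Prod.ext_iff,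
    funext_iff, Fin.forall_fin_two, Fin.sum_univ_two]

theorem hasDecomposition_24 (t : ℂ) : HasDecomposition (𝒥 24 t) 24 := by
  refine ((superComm_U1.prod superComm_S3_1).isomorphic_mult_of_products
    (by simp [finrank_prod])
    (a := ((1, 0), 0)) (b := (0, (1, 0)))
    (f := (0, (0, ![1, 0]))) (g := (0, (0, ![0, 1]))) ?_).symm
  simp [U1, S3_1, prod, Table.alg, Submodule.mem_prod, LinearIndependent.pair_iff, Prod.ext_iff,
    funext_iff, Fin.forall_fin_two, Fin.sum_univ_two]

theorem hasDecomposition_25 (t : ℂ) : HasDecomposition (𝒥 25 t) 25 := by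
  refine ((superComm_U2.prod (superComm_S2_1.prod superComm_S1_1)).isomorphic_mult_of_products
    (by simp [finrank_prod])
    (a := (0, (1, 0), 0)) (b := ((1, 0), 0, 0))
    (f := (0, 0, (0, 1))) (g := (0, (0, 1), 0)) ?_).symm
  simp [U2, S2_1, S1_1, prod, Table.alg, Submodule.mem_prod, LinearIndependent.pair_iff, Prod.ext_iff,
    funext_iff, Fin.forall_fin_two, Fin.sum_univ_two]

theorem hasDecomposition_26 (t : ℂ) : HasDecomposition (𝒥 26 t) 26 := by
  refine ((superComm_U2.prod (superComm_S2_2.prod superComm_S1_1)).isomorphic_mult_of_products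
    (by simp [finrank_prod])
    (a := (0, (1, 0), 0)) (b := ((1, 0), 0, 0))
    (f := (0, 0, (0, 1))) (g := (0, (0, 1), 0)) ?_).symm
  simp [U2, S2_2, S1_1, prod, Table.alg, Submodule.mem_prod, LinearIndependent.pair_iff, Prod.ext_iff,
    funext_iff, Fin.forall_fin_two, Fin.sum_univ_two]

theorem hasDecomposition_27 (t : ℂ) : HasDecomposition (𝒥 27 t) 27 := by
  refine ((superComm_U2.prod superComm_S3_5).isomorphic_mult_of_products
    (by simp [finrank_prod])
    (a := (0, (1, 0))) (b := ((1, 0), 0))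
    (f := (0, (0, ![1, 0]))) (g := (0, (0, ![0, 1]))) ?_).symm
  simp [U2, S3_5, prod, Table.alg, Submodule.mem_prod, LinearIndependent.pair_iff, Prod.ext_iff,
    funext_iff, Fin.forall_fin_two, Fin.sum_univ_two]

theorem hasDecomposition_29 (t : ℂ) : HasDecomposition (𝒥 29 t) 29 := by
  refine ((superComm_U2.prod superComm_S3_7).isomorphic_mult_of_products
    (by simp [finrank_prod])
    (a := (0, (1, 0))) (b := ((1, 0), 0))
    (f := (0, (0, ![1, 0]))) (g := (0, (0, ![0, 1]))) ?_).symm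
  simp [U2, S3_7, prod, Table.alg, Submodule.mem_prod, LinearIndependent.pair_iff, Prod.ext_iff,
    funext_iff, Fin.forall_fin_two, Fin.sum_univ_two]

theorem hasDecomposition_33 (t : ℂ) : HasDecomposition (𝒥 33 t) 33 := by
  refine ((superComm_U2.prod superComm_S3_4).isomorphic_mult_of_products
    (by simp [finrank_prod])
    (a := (0, (1, 0))) (b := ((1, 0), 0))
    -- The odd vectors are exchanged: `S3_4` lists the eigenvalue `1` first, table 33 the eigenvalue
    -- `1/2`.
    (f := (0, (0, ![0, 1]))) (g := (0, (0, ![1, 0]))) ?_).symm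
  simp [U2, S3_4, prod, Table.alg, Submodule.mem_prod, LinearIndependent.pair_iff, Prod.ext_iff,
    funext_iff, Fin.forall_fin_two, Fin.sum_univ_two]

theorem hasDecomposition_34 (t : ℂ) : HasDecomposition (𝒥 34 t) 34 := by
  refine ((superComm_U2.prod superComm_S3_6).isomorphic_mult_of_products
    (by simp [finrank_prod])
    (a := (0, (1, 0))) (b := ((1, 0), 0))
    (f := (0, (0, ![1, 0]))) (g := (0, (0, ![0, 1]))) ?_).symm
  simp [U2, S3_6, prod, Table.alg, Submodule.mem_prod, LinearIndependent.pair_iff, Prod.ext_iff,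
    funext_iff, Fin.forall_fin_two, Fin.sum_univ_two]

theorem hasDecomposition_35 (t : ℂ) : HasDecomposition (𝒥 35 t) 35 := by
  refine ((superComm_U2.prod superComm_S3_8).isomorphic_mult_of_products
    (by simp [finrank_prod])
    (a := (0, (1, 0))) (b := ((1, 0), 0))
    (f := (0, (0, ![1, 0]))) (g := (0, (0, ![0, 1]))) ?_).symm
  simp [U2, S3_8, prod, Table.alg, Submodule.mem_prod, LinearIndependent.pair_iff, Prod.ext_iff,
    funext_iff, Fin.forall_fin_two, Fin.sum_univ_two]

theorem hasDecomposition_36 (t : ℂ) : HasDecomposition (𝒥 36 t) 36 := by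
  refine ((superComm_B1.prod (superComm_S1_1.prod superComm_S1_1)).isomorphic_mult_of_products
    (by simp [finrank_prod])
    (a := ((![1, 0], 0), 0, 0)) (b := ((![0, 1], 0), 0, 0))
    (f := (0, (0, 1), 0)) (g := (0, 0, (0, 1))) ?_).symm
  simp [B1, S1_1, prod, Table.alg, Submodule.mem_prod, LinearIndependent.pair_iff, Prod.ext_iff,
    funext_iff, Fin.forall_fin_two, Fin.sum_univ_two]

theorem hasDecomposition_37 (t : ℂ) : HasDecomposition (𝒥 37 t) 37 := by
  refine ((superComm_S3_9.prod superComm_S1_1).isomorphic_mult_of_products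
    (by simp [finrank_prod])
    (a := ((![1, 0], 0), 0)) (b := ((![0, 1], 0), 0))
    (f := (0, (0, 1))) (g := ((0, 1), 0)) ?_).symm
  simp [S3_9, S1_1, prod, Table.alg, Submodule.mem_prod, LinearIndependent.pair_iff, Prod.ext_iff,
    funext_iff, Fin.forall_fin_two, Fin.sum_univ_two]

theorem hasDecomposition_38 (t : ℂ) : HasDecomposition (𝒥 38 t) 38 := by
  refine ((superComm_S3_10.prod superComm_S1_1).isomorphic_mult_of_products
    (by simp [finrank_prod])
    (a := ((![1, 0], 0), 0)) (b := ((![0, 1], 0), 0))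
    (f := (0, (0, 1))) (g := ((0, 1), 0)) ?_).symm
  simp [S3_10, S1_1, prod, Table.alg, Submodule.mem_prod, LinearIndependent.pair_iff, Prod.ext_iff,
    funext_iff, Fin.forall_fin_two, Fin.sum_univ_two]

theorem hasDecomposition_50 (t : ℂ) : HasDecomposition (𝒥 50 t) 50 := by
  refine ((superComm_B2.prod (superComm_S1_1.prod superComm_S1_1)).isomorphic_mult_of_products
    (by simp [finrank_prod])
    (a := ((![1, 0], 0), 0, 0)) (b := ((![0, 1], 0), 0, 0))
    (f := (0, (0, 1), 0)) (g := (0, 0, (0, 1))) ?_).symm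
  simp [B2, S1_1, prod, Table.alg, Submodule.mem_prod, LinearIndependent.pair_iff, Prod.ext_iff,
    funext_iff, Fin.forall_fin_two, Fin.sum_univ_two]

theorem hasDecomposition_51 (t : ℂ) : HasDecomposition (𝒥 51 t) 51 := by
  refine ((superComm_S3_11.prod superComm_S1_1).isomorphic_mult_of_products
    (by simp [finrank_prod])
    (a := ((![1, 0], 0), 0)) (b := ((![0, 1], 0), 0))
    (f := (0, (0, 1))) (g := ((0, 1), 0)) ?_).symm
  simp [S3_11, S1_1, prod, Table.alg, Submodule.mem_prod, LinearIndependent.pair_iff, Prod.ext_iff,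
    funext_iff, Fin.forall_fin_two, Fin.sum_univ_two]

theorem hasDecomposition_57 (t : ℂ) : HasDecomposition (𝒥 57 t) 57 := by
  refine ((superComm_S3_12.prod superComm_S1_1).isomorphic_mult_of_products
    (by simp [finrank_prod])
    (a := ((![1, 0], 0), 0)) (b := ((![0, 1], 0), 0))
    (f := (0, (0, 1))) (g := ((0, 1), 0)) ?_).symm
  simp [S3_12, S1_1, prod, Table.alg, Submodule.mem_prod, LinearIndependent.pair_iff, Prod.ext_iff,
    funext_iff, Fin.forall_fin_two, Fin.sum_univ_two]

theorem hasDecomposition_66 (t : ℂ) : HasDecomposition (𝒥 66 t) 66 := by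
  refine ((superComm_B3.prod (superComm_S1_1.prod superComm_S1_1)).isomorphic_mult_of_products
    (by simp [finrank_prod])
    (a := ((![1, 0], 0), 0, 0)) (b := ((![0, 1], 0), 0, 0))
    (f := (0, (0, 1), 0)) (g := (0, 0, (0, 1))) ?_).symm
  simp [B3, S1_1, prod, Table.alg, Submodule.mem_prod, LinearIndependent.pair_iff, Prod.ext_iff,
    funext_iff, Fin.forall_fin_two, Fin.sum_univ_two]

/-- For all of these members every even centroid map keeps the line of `e₂`, so one triangular shape
serves them uniformly. -/
theorem rankZ_unipotentRows_tableData :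
    ∀ k ∈ [11, 13, 15, 28, 30, 31, 32, 39, 40, 41, 42, 43, 44, 45, 46, 47, 48, 49, 52, 53, 54, 55, 56, 58, 59, 60, 61, 62, 63, 64, 65, 67, 68, 69, 70, 71], rankZ 8 (unipotentRows 0 ++ rowsOf (tableData.getD k []) centroidSpec) =
      rankZ 8 (rowsOf (tableData.getD k []) centroidSpec) := by
  decide +kernel

theorem indecomposable_of_mem {k : ℕ} {t : ℂ}
    (hk : k ∈ [11, 13, 15, 28, 30, 31, 32, 39, 40, 41, 42, 43, 44, 45, 46, 47, 48, 49, 52, 53, 54, 55, 56, 58, 59, 60, 61, 62, 63, 64, 65, 67, 68, 69, 70, 71]) :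
    (𝒥 k t).Indecomposable := by
  have h : k ∈ Finset.Icc 1 71 ∧ k ≠ 16 := by
    revert k
    decide
  rw [𝒥_eq h.1 h.2]
  exact indecomposable_tableOf (rankZ_unipotentRows_tableData k hk)

/-- The other triangular shape is needed: the map `e₂ ↦ e₁` that kills the other basis vectors lies
in the centroid, while `e₁ = f₁f₂` is always sent to a multiple of itself. -/
theorem indecomposable_nineteen (t : ℂ) : (𝒥 19 t).Indecomposable := by
  rw [𝒥_eq (by decide) (by decide)]
  exact indecomposable_tableOf (p := 1) (by decide +kernel)

theorem indecomposable_sixteen (t : ℂ) : (𝒥 16 t).Indecomposable :=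
  indecomposable_of_agreeOffOdd (famTable_agreeOffOdd t) (p := 0) (by decide +kernel)

theorem hasDecomposition {k : ℕ} (hk : k ∈ Finset.Icc 1 71) (t : ℂ) :
    HasDecomposition (𝒥 k t) k := by
  obtain ⟨h1, h71⟩ := Finset.mem_Icc.1 hk
  interval_cases k
  · exact hasDecomposition_1 t
  · exact hasDecomposition_2 t
  · exact hasDecomposition_3 t
  · exact hasDecomposition_4 t
  · exact hasDecomposition_5 t
  · exact hasDecomposition_6 t
  · exact hasDecomposition_7 t
  · exact hasDecomposition_8 t
  · exact hasDecomposition_9 t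
  · exact hasDecomposition_10 t
  · exact indecomposable_of_mem (by decide)
  · exact hasDecomposition_12 t
  · exact indecomposable_of_mem (by decide)
  · exact hasDecomposition_14 t
  · exact indecomposable_of_mem (by decide)
  · exact indecomposable_sixteen t
  · exact hasDecomposition_17 t
  · exact hasDecomposition_18 t
  · exact indecomposable_nineteen t
  · exact hasDecomposition_20 t
  · exact hasDecomposition_21 t
  · exact hasDecomposition_22 t
  · exact hasDecomposition_23 t
  · exact hasDecomposition_24 t
  · exact hasDecomposition_25 t
  · exact hasDecomposition_26 t
  · exact hasDecomposition_27 t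
  · exact indecomposable_of_mem (by decide)
  · exact hasDecomposition_29 t
  · exact indecomposable_of_mem (by decide)
  · exact indecomposable_of_mem (by decide)
  · exact indecomposable_of_mem (by decide)
  · exact hasDecomposition_33 t
  · exact hasDecomposition_34 t
  · exact hasDecomposition_35 t
  · exact hasDecomposition_36 t
  · exact hasDecomposition_37 t
  · exact hasDecomposition_38 t
  · exact indecomposable_of_mem (by decide)
  · exact indecomposable_of_mem (by decide)
  · exact indecomposable_of_mem (by decide)
  · exact indecomposable_of_mem (by decide)
  · exact indecomposable_of_mem (by decide)
  · exact indecomposable_of_mem (by decide)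
  · exact indecomposable_of_mem (by decide)
  · exact indecomposable_of_mem (by decide)
  · exact indecomposable_of_mem (by decide)
  · exact indecomposable_of_mem (by decide)
  · exact indecomposable_of_mem (by decide)
  · exact hasDecomposition_50 t
  · exact hasDecomposition_51 t
  · exact indecomposable_of_mem (by decide)
  · exact indecomposable_of_mem (by decide)
  · exact indecomposable_of_mem (by decide)
  · exact indecomposable_of_mem (by decide)
  · exact indecomposable_of_mem (by decide)
  · exact hasDecomposition_57 t
  · exact indecomposable_of_mem (by decide)
  · exact indecomposable_of_mem (by decide)
  · exact indecomposable_of_mem (by decide)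
  · exact indecomposable_of_mem (by decide)
  · exact indecomposable_of_mem (by decide)
  · exact indecomposable_of_mem (by decide)
  · exact indecomposable_of_mem (by decide)
  · exact indecomposable_of_mem (by decide)
  · exact hasDecomposition_66 t
  · exact indecomposable_of_mem (by decide)
  · exact indecomposable_of_mem (by decide)
  · exact indecomposable_of_mem (by decide)
  · exact indecomposable_of_mem (by decide)
  · exact indecomposable_of_mem (by decide)

end JordanSuper

namespace JordanSuper

open Superalgebra

/-! ### The members of the list -/

theorem Table.alg_hasType {m n : ℕ} (c : Table m n) : c.alg.HasType m n := by
  refine ⟨inferInstance, ?_, ?_⟩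
  · have : c.alg.part 0 = (⊤ : Submodule ℂ (Fin m → ℂ)).map (LinearMap.inl ℂ _ (Fin n → ℂ)) :=
      (Submodule.map_inl _).symm
    rw [this, ← LinearEquiv.finrank_eq (Submodule.equivMapOfInjective _ LinearMap.inl_injective _)]
    simp
  · have : c.alg.part 1 = (⊤ : Submodule ℂ (Fin n → ℂ)).map (LinearMap.inr ℂ (Fin m → ℂ) _) :=
      (Submodule.map_inr _).symm
    rw [this, ← LinearEquiv.finrank_eq (Submodule.equivMapOfInjective _ LinearMap.inr_injective _)]
    simp

theorem exists_icoef_ne_zero : ∀ k < 71, ∃ g h : ZMod 2, ∃ i j l : Fin 2,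
    icoef (tableData.getD (k + 1) []) g h i j l ≠ 0 := by
  decide +kernel

theorem coef_eq_zero_of_mul_eq_zero {c : Table 2 2} (h : c.alg.mul = 0) (g g' : ZMod 2)
    (i j k : Fin 2) : c.coef g g' i j k = 0 := by
  have := mul_bas c g g' i j
  rw [h] at this
  exact sum_smul_bas_eq_zero.1 this.symm k

theorem 𝒥_mul_ne_zero {k : ℕ} (hk : k ∈ Finset.Icc 1 71) (t : ℂ) : (𝒥 k t).mul ≠ 0 := by
  intro h
  rcases eq_or_ne k 16 with rfl | h16
  · have := coef_eq_zero_of_mul_eq_zero (c := famTable t) h 0 0 0 0 0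
    simp [famTable_coef] at this
  · rw [𝒥_eq hk h16] at h
    obtain ⟨n, hn, rfl⟩ := mem_Icc_iff_lt.1 hk
    obtain ⟨g, g', i, j, l, hne⟩ := exists_icoef_ne_zero n hn
    refine hne (Int.cast_injective (α := ℂ) ?_)
    rw [icoef_eq, coef_eq_zero_of_mul_eq_zero h, mul_zero, Int.cast_zero]

theorem 𝒥_isJordan {k : ℕ} (hk : k ∈ Finset.Icc 1 71) (t : ℂ) : (𝒥 k t).IsJordan := by
  rcases eq_or_ne k 16 with rfl | h16
  · exact famTable_isJordan t
  · rw [𝒥_eq hk h16]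
    obtain ⟨n, hn, rfl⟩ := mem_Icc_iff_lt.1 hk
    exact isJordan_of_jordanCheck (jordanCheck_tableData n hn)

theorem dimDer_add_orbitDim {k : ℕ} (hk : k ∈ Finset.Icc 1 71) (t : ℂ) :
    (𝒥 k t).dimDer + orbitDim k = 4 ^ 2 := by
  rcases eq_or_ne k 16 with rfl | h16
  · rw [𝒥_sixteen, dimDer, famTable_finrank_zero, famTable_finrank_one]
    rfl
  · rw [𝒥_eq hk h16, dimDer]
    obtain ⟨n, hn, rfl⟩ := mem_Icc_iff_lt.1 hk
    have h1 := codim_derivations (tableData.getD (n + 1) [])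
    have h2 := orbitDim_eq n hn (by omega)
    rw [codimCode_tableData n hn] at h1
    omega

/-! ### Isomorphisms between members of the list -/

theorem eq_of_isomorphic_of_ne_sixteen {k l : ℕ} (hk : k ∈ Finset.Icc 1 71)
    (hl : l ∈ Finset.Icc 1 71) (hk' : k ≠ 16) (hl' : l ≠ 16) {s t : ℂ}
    (h : (𝒥 k s).Isomorphic (𝒥 l t)) : k = l := by
  rw [𝒥_eq hk hk', 𝒥_eq hl hl'] at h
  obtain ⟨k, hk₁, rfl⟩ := mem_Icc_iff_lt.1 hk
  obtain ⟨l, hl₁, rfl⟩ := mem_Icc_iff_lt.1 hl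
  have := codimCode_eq_of_finrank_eq fun s _ => h.finrank_genDer_eq s
  rw [codimCode_tableData k hk₁, codimCode_tableData l hl₁] at this
  rw [codimCodes_injective hk₁ hl₁ (by omega) (by omega) this]

/-- The invariants blind to `f₁f₂` leave number 15 as the only candidate. There the even derivations
have dimension four, whereas in the family the condition from `f₁f₂` cuts them down to three. -/
theorem not_isomorphic_sixteen {l : ℕ} (hl : l ∈ Finset.Icc 1 71) (hl' : l ≠ 16) {s t : ℂ} :
    ¬ (𝒥 16 s).Isomorphic (𝒥 l t) := by
  intro h
  rw [𝒥_eq hl hl', 𝒥_sixteen] at h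
  obtain ⟨l, hl₁, rfl⟩ := mem_Icc_iff_lt.1 hl
  have h1 : codimCode (tableData.getD 15 []) % 100 =
      codimCode (tableData.getD (l + 1) []) % 100 := by
    refine codimCode_mod_eq_of_finrank_eq fun σ hσ => ?_
    rw [← h.finrank_genDer_eq σ]
    simp only [invSpecs, List.drop, List.mem_cons, List.not_mem_nil, or_false] at hσ
    rcases hσ with rfl | rfl <;> rw [(famTable_agreeOffOdd s).genDer_eq rfl rfl rfl rfl]
  rw [codimCode_tableData 14 (by omega), codimCode_tableData l hl₁] at h1
  have h2 : l = 14 := (codimCodes_mod_fifteen l hl₁ (h1.symm.trans (by decide))).resolve_right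
    (by omega)
  subst h2
  have h3 := (codim_derivations (tableData.getD 15 [])).1
  have h4 := h.finrank_genDer_eq (derSpec 0)
  rw [← derivations_eq_genDer, ← derivations_eq_genDer, famTable_finrank_zero] at h4
  rw [codimCode_tableData 14 (by omega), ← h4] at h3
  exact absurd h3 (by decide)

/-- Exchange the idempotents and multiply `f₁` by `t`: then `t(e₁ + se₂) = e₂ + te₁`. -/
theorem famTable_isomorphic_of_mul_eq_one {s t : ℂ} (h : s * t = 1) :
    (famTable s).alg.Isomorphic (famTable t).alg := by
  have ht : t ≠ 0 := right_ne_zero_of_mul_eq_one h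
  refine SuperComm.isomorphic_mult_of_products (famTable_isJordan s).1 (by simp)
    (a := (![0, 1], ![0, 0])) (b := (![1, 0], ![0, 0])) (f := (![0, 0], ![t, 0]))
    (g := (![0, 0], ![0, 1])) ?_
  simp only [famTable_mul]
  simp [Table.alg, Submodule.mem_prod, LinearIndependent.pair_iff, Prod.ext_iff, ht, h]
  ring_nf

/-- The even part is `ℂ × ℂ`, so the two primitive idempotents are fixed or exchanged. On the odd
part, `f₁f₂` is multiplied by a determinant, which cancels from the ratio of its two coordinates. -/
theorem eq_or_mul_eq_one_of_isomorphic {s t : ℂ}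
    (h : (famTable s).alg.Isomorphic (famTable t).alg) : s = t ∨ s * t = 1 := by
  obtain ⟨φ, hmul, hpart⟩ := h
  have hmem : ∀ g, ∀ x ∈ (famTable s).alg.part g, φ x ∈ (famTable t).alg.part g := by
    intro g x hx
    rw [← hpart g]
    exact ⟨x, hx, rfl⟩
  have he : ∀ a b : ℂ, ((![a, b], ![0, 0]) : Model 2 2) ∈ (famTable s).alg.part 0 := fun a b => by
    simp [Table.alg, Submodule.mem_prod]
  have ho : ∀ a b : ℂ, ((![0, 0], ![a, b]) : Model 2 2) ∈ (famTable s).alg.part 1 := fun a b => by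
    simp [Table.alg, Submodule.mem_prod]
  have heven : ∀ x ∈ (famTable t).alg.part 0, ∃ a b, x = (![a, b], ![0, 0]) := fun x hx => by
    obtain ⟨a, b, ⟨-, h⟩ | ⟨h, -⟩⟩ := exists_of_mem_part hx
    exacts [⟨a, b, h⟩, absurd h (by decide)]
  have hodd : ∀ x ∈ (famTable t).alg.part 1, ∃ a b, x = (![0, 0], ![a, b]) := fun x hx => by
    obtain ⟨a, b, ⟨h, -⟩ | ⟨-, h⟩⟩ := exists_of_mem_part hx
    exacts [absurd h (by decide), ⟨a, b, h⟩]
  obtain ⟨a, b, hab⟩ := heven _ (hmem 0 _ (he 1 0))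
  obtain ⟨c, d, hcd⟩ := heven _ (hmem 0 _ (he 0 1))
  obtain ⟨p, q, hpq⟩ := hodd _ (hmem 1 _ (ho 1 0))
  obtain ⟨r, u, hru⟩ := hodd _ (hmem 1 _ (ho 0 1))
  have h1 := hmul (![1, 0], ![0, 0]) (![1, 0], ![0, 0])
  have h2 := hmul (![0, 1], ![0, 0]) (![0, 1], ![0, 0])
  have h3 := hmul (![1, 0], ![0, 0]) (![0, 1], ![0, 0])
  have h4 := hmul (![0, 0], ![1, 0]) (![0, 0], ![0, 1])
  have h0 : ((![0, 0], ![0, 0]) : Model 2 2) = 0 := by simp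
  have h5 : ((![1, s], ![0, 0]) : Model 2 2) = (![1, 0], ![0, 0]) + s • (![0, 1], ![0, 0]) := by
    simp
  have n1 : ¬ (a = 0 ∧ b = 0) := by
    rintro ⟨rfl, rfl⟩
    rw [h0, map_eq_zero_iff φ φ.injective] at hab
    simp at hab
  have n2 : ¬ (c = 0 ∧ d = 0) := by
    rintro ⟨rfl, rfl⟩
    rw [h0, map_eq_zero_iff φ φ.injective] at hcd
    simp at hcd
  simp only [famTable_mul, mul_zero, mul_one, zero_mul, add_zero, zero_add, sub_zero, zero_div,
    hab, hcd, hpq, hru, h5, map_add, map_smul, h0, map_zero] at h1 h2 h3 h4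
  simp at h1 h2 h3 h4
  rw [eq_comm] at h3
  simp at h3
  -- The coordinates of an idempotent of `ℂ × ℂ` are `0` or `1`.
  have hz : ∀ z : ℂ, z = z * z → z = 0 ∨ z = 1 := fun z hz => by
    rcases mul_eq_zero.1 (show z * (z - 1) = 0 by linear_combination -hz) with h | h
    exacts [Or.inl h, Or.inr (sub_eq_zero.1 h)]
  obtain ⟨h4, h6⟩ := h4
  -- The alternatives are that `e₁` is sent to `e₂` or to `e₁`; orthogonality then determines the
  -- image of `e₂`.
  rcases hz a h1.1 with rfl | rfl
  · have hb : b = 1 := (hz b h1.2).resolve_left fun hb => n1 ⟨rfl, hb⟩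
    subst hb
    have hd : d = 0 := by simpa using h3.2
    have hc : c = 1 := (hz c h2.1).resolve_left fun hc => n2 ⟨hc, hd⟩
    subst hd hc
    right
    linear_combination t * h4 - h6
  · have hc : c = 0 := by simpa using h3.1
    have hd : d = 1 := (hz d h2.2).resolve_left fun hd => n2 ⟨hc, hd⟩
    subst hd hc
    have hb : b = 0 := by simpa using h3.2
    subst hb
    left
    linear_combination h6 - t * h4

theorem 𝒥_isomorphic_iff {k l : ℕ} (hk : k ∈ Finset.Icc 1 71) (hl : l ∈ Finset.Icc 1 71)
    (s t : ℂ) : (𝒥 k s).Isomorphic (𝒥 l t) ↔ k = l ∧ (k = 16 → s = t ∨ s * t = 1) := by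
  constructor
  · intro h
    rcases eq_or_ne k 16 with rfl | hk' <;> rcases eq_or_ne l 16 with rfl | hl'
    · exact ⟨rfl, fun _ => eq_or_mul_eq_one_of_isomorphic h⟩
    · exact absurd h (not_isomorphic_sixteen hl hl')
    · exact absurd h.symm (not_isomorphic_sixteen hk hk')
    · exact ⟨eq_of_isomorphic_of_ne_sixteen hk hl hk' hl' h, fun h' => absurd h' hk'⟩
  · rintro ⟨rfl, h⟩
    rcases eq_or_ne k 16 with rfl | hk'
    · rcases h rfl with rfl | h
      · exact Isomorphic.refl _
      · exact famTable_isomorphic_of_mul_eq_one h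
    · rw [𝒥_eq hk hk', 𝒥_eq hk hk']
      exact Isomorphic.refl _

end JordanSuper

namespace JordanSuper

open Superalgebra

/-! ### Coordinates -/

/-- The even element with coordinates `x`, `y`. -/
def ev (x y : ℂ) : Model 2 2 := (![x, y], 0)

/-- The odd element with coordinates `x`, `y`. -/
def od (x y : ℂ) : Model 2 2 := (0, ![x, y])

theorem ev_zero : ev 0 0 = 0 := by
  ext i <;> fin_cases i <;> rfl

theorem od_zero : od 0 0 = 0 := by
  ext i <;> fin_cases i <;> rfl

theorem ev_add (x y x' y' : ℂ) : ev x y + ev x' y' = ev (x + x') (y + y') := by simp [ev]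

theorem od_add (x y x' y' : ℂ) : od x y + od x' y' = od (x + x') (y + y') := by simp [od]

theorem smul_ev (c x y : ℂ) : c • ev x y = ev (c * x) (c * y) := by simp [ev]

theorem smul_od (c x y : ℂ) : c • od x y = od (c * x) (c * y) := by simp [od]

theorem ev_inj {x y x' y' : ℂ} : ev x y = ev x' y' ↔ x = x' ∧ y = y' := by simp [ev]

theorem od_inj {x y x' y' : ℂ} : od x y = od x' y' ↔ x = x' ∧ y = y' := by simp [od]

theorem ev_mem (c : Table 2 2) (x y : ℂ) : ev x y ∈ c.alg.part 0 := by
  simp [ev, Table.alg, Submodule.mem_prod]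

theorem od_mem (c : Table 2 2) (x y : ℂ) : od x y ∈ c.alg.part 1 := by
  simp [od, Table.alg, Submodule.mem_prod]

theorem eq_zero_of_det_ne_zero {x y x' y' s t : ℂ} (h : x * y' - y * x' ≠ 0)
    (h₁ : s * x + t * x' = 0) (h₂ : s * y + t * y' = 0) : s = 0 ∧ t = 0 := by
  constructor
  · refine (mul_eq_zero.1 (?_ : (x * y' - y * x') * s = 0)).resolve_left h
    linear_combination y' * h₁ - x' * h₂
  · refine (mul_eq_zero.1 (?_ : (x * y' - y * x') * t = 0)).resolve_left h
    linear_combination x * h₂ - y * h₁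

theorem linearIndependent_ev {x y x' y' : ℂ} (h : x * y' - y * x' ≠ 0) :
    LinearIndependent ℂ ![ev x y, ev x' y'] := by
  rw [LinearIndependent.pair_iff]
  intro s t hst
  rw [smul_ev, smul_ev, ev_add, ← ev_zero, ev_inj] at hst
  exact eq_zero_of_det_ne_zero h hst.1 hst.2

theorem linearIndependent_od {x y x' y' : ℂ} (h : x * y' - y * x' ≠ 0) :
    LinearIndependent ℂ ![od x y, od x' y'] := by
  rw [LinearIndependent.pair_iff]
  intro s t hst
  rw [smul_od, smul_od, od_add, ← od_zero, od_inj] at hst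
  exact eq_zero_of_det_ne_zero h hst.1 hst.2

section

variable (p₁ p₂ p₃ p₄ p₅ p₆ p₇ p₈ : Fin 2 → ℂ)

theorem mul_ev_ev (x y x' y' : ℂ) : (mult p₁ p₂ p₃ p₄ p₅ p₆ p₇ p₈).alg.mul (ev x y) (ev x' y') =
    ev (x * x' * p₁ 0 + (x * y' + y * x') * p₂ 0 + y * y' * p₃ 0)
      (x * x' * p₁ 1 + (x * y' + y * x') * p₂ 1 + y * y' * p₃ 1) := by
  simp only [ev, Table.alg, mult]
  ext i <;> fin_cases i <;> simp [Fin.sum_univ_two] <;> ring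

theorem mul_ev_od (x y x' y' : ℂ) : (mult p₁ p₂ p₃ p₄ p₅ p₆ p₇ p₈).alg.mul (ev x y) (od x' y') =
    od (x * x' * p₄ 0 + x * y' * p₅ 0 + y * x' * p₆ 0 + y * y' * p₇ 0)
      (x * x' * p₄ 1 + x * y' * p₅ 1 + y * x' * p₆ 1 + y * y' * p₇ 1) := by
  simp only [ev, od, Table.alg, mult]
  ext i <;> fin_cases i <;> simp [Fin.sum_univ_two] <;> ring

theorem mul_od_ev (x y x' y' : ℂ) : (mult p₁ p₂ p₃ p₄ p₅ p₆ p₇ p₈).alg.mul (od x' y') (ev x y) =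
    od (x * x' * p₄ 0 + x * y' * p₅ 0 + y * x' * p₆ 0 + y * y' * p₇ 0)
      (x * x' * p₄ 1 + x * y' * p₅ 1 + y * x' * p₆ 1 + y * y' * p₇ 1) := by
  simp only [ev, od, Table.alg, mult]
  ext i <;> fin_cases i <;> simp [Fin.sum_univ_two] <;> ring

theorem mul_od_od (x y x' y' : ℂ) : (mult p₁ p₂ p₃ p₄ p₅ p₆ p₇ p₈).alg.mul (od x y) (od x' y') =
    ev ((x * y' - y * x') * p₈ 0) ((x * y' - y * x') * p₈ 1) := by
  simp only [ev, od, Table.alg, mult]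
  ext i <;> fin_cases i <;> simp [Fin.sum_univ_two] <;> ring

theorem mult_superComm : (mult p₁ p₂ p₃ p₄ p₅ p₆ p₇ p₈).alg.SuperComm :=
  Table.Symm.superComm ⟨by simp [mult, Fin.forall_fin_two], by simp [mult, Fin.forall_fin_two]⟩

end

/-- Change of bases. -/
theorem mult_isomorphic {p₁ p₂ p₃ p₄ p₅ p₆ p₇ p₈ q₁ q₂ q₃ q₄ q₅ q₆ q₇ q₈ : Fin 2 → ℂ}
    {a a' b b' f f' g g' : ℂ} (hab : a * b' - a' * b ≠ 0) (hfg : f * g' - f' * g ≠ 0)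
    (h₁ : ∀ i, a * a * p₁ i + (a * a' + a' * a) * p₂ i + a' * a' * p₃ i
      = ![q₁ 0 * a + q₁ 1 * b, q₁ 0 * a' + q₁ 1 * b'] i)
    (h₂ : ∀ i, a * b * p₁ i + (a * b' + a' * b) * p₂ i + a' * b' * p₃ i
      = ![q₂ 0 * a + q₂ 1 * b, q₂ 0 * a' + q₂ 1 * b'] i)
    (h₃ : ∀ i, b * b * p₁ i + (b * b' + b' * b) * p₂ i + b' * b' * p₃ i
      = ![q₃ 0 * a + q₃ 1 * b, q₃ 0 * a' + q₃ 1 * b'] i)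
    (h₄ : ∀ i, a * f * p₄ i + a * f' * p₅ i + a' * f * p₆ i + a' * f' * p₇ i
      = ![q₄ 0 * f + q₄ 1 * g, q₄ 0 * f' + q₄ 1 * g'] i)
    (h₅ : ∀ i, a * g * p₄ i + a * g' * p₅ i + a' * g * p₆ i + a' * g' * p₇ i
      = ![q₅ 0 * f + q₅ 1 * g, q₅ 0 * f' + q₅ 1 * g'] i)
    (h₆ : ∀ i, b * f * p₄ i + b * f' * p₅ i + b' * f * p₆ i + b' * f' * p₇ i
      = ![q₆ 0 * f + q₆ 1 * g, q₆ 0 * f' + q₆ 1 * g'] i)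
    (h₇ : ∀ i, b * g * p₄ i + b * g' * p₅ i + b' * g * p₆ i + b' * g' * p₇ i
      = ![q₇ 0 * f + q₇ 1 * g, q₇ 0 * f' + q₇ 1 * g'] i)
    (h₈ : ∀ i, (f * g' - f' * g) * p₈ i = ![q₈ 0 * a + q₈ 1 * b, q₈ 0 * a' + q₈ 1 * b'] i) :
    (mult p₁ p₂ p₃ p₄ p₅ p₆ p₇ p₈).alg.Isomorphic (mult q₁ q₂ q₃ q₄ q₅ q₆ q₇ q₈).alg := by
  -- The new even basis has coordinates `(a, a')`, `(b, b')`, the new odd basis `(f, f')`, `(g,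
  -- g')`.
  refine SuperComm.isomorphic_mult (mult_superComm p₁ p₂ p₃ p₄ p₅ p₆ p₇ p₈) (by simp) (ev_mem _ a a') (ev_mem _ b b')
    (od_mem _ f f') (od_mem _ g g') (linearIndependent_ev hab) (linearIndependent_od hfg)
    ?_ ?_ ?_ ?_ ?_ ?_ ?_ ?_ <;>
  simp only [mul_ev_ev, mul_ev_od, mul_od_od, smul_ev, smul_od, ev_add, od_add, ev_inj, od_inj]
  exacts [⟨h₁ 0, h₁ 1⟩, ⟨h₂ 0, h₂ 1⟩, ⟨h₃ 0, h₃ 1⟩, ⟨h₄ 0, h₄ 1⟩, ⟨h₅ 0, h₅ 1⟩, ⟨h₆ 0, h₆ 1⟩,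
    ⟨h₇ 0, h₇ 1⟩, ⟨h₈ 0, h₈ 1⟩]

theorem Superalgebra.Isomorphic.isJordan {A B : Type*} [AddCommGroup A] [Module ℂ A]
    [AddCommGroup B] [Module ℂ B] {S : Superalgebra A} {T : Superalgebra B}
    (h : S.Isomorphic T) (hS : S.IsJordan) : T.IsJordan := by
  obtain ⟨φ, hm, hp⟩ := h
  have hT : ∀ i, ∀ x ∈ T.part i, ∃ y ∈ S.part i, φ y = x := fun i x hx => by
    rw [← hp i] at hx
    exact hx
  constructor
  · intro i j x hx y hy
    obtain ⟨x, hx', rfl⟩ := hT i x hx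
    obtain ⟨y, hy', rfl⟩ := hT j y hy
    rw [← hm, ← hm, hS.1 i j x hx' y hy', map_smul]
  · intro i j k l x hx y hy z hz t ht
    obtain ⟨x, hx', rfl⟩ := hT i x hx
    obtain ⟨y, hy', rfl⟩ := hT j y hy
    obtain ⟨z, hz', rfl⟩ := hT k z hz
    obtain ⟨t, ht', rfl⟩ := hT l t ht
    have := congrArg φ (hS.2 i j k l x hx' y hy' z hz' t ht')
    simpa only [map_add, LinearEquiv.map_smul, hm] using this

/-! ### Being on the list -/

/-- Superalgebras that are isomorphic to a member of the list. -/
def Superalgebra.Listed {A : Type*} [AddCommGroup A] [Module ℂ A] (S : Superalgebra A) : Prop :=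
  ∃ k ∈ Finset.Icc 1 71, ∃ t : ℂ, S.Isomorphic (𝒥 k t)

theorem Superalgebra.Isomorphic.listed {A B : Type*} [AddCommGroup A] [Module ℂ A]
    [AddCommGroup B] [Module ℂ B] {S : Superalgebra A} {T : Superalgebra B}
    (h : S.Isomorphic T) (hT : T.Listed) : S.Listed := by
  obtain ⟨k, hk, t, h'⟩ := hT
  exact ⟨k, hk, t, h.trans h'⟩

theorem listed_of_eq {c : Table 2 2} (k : ℕ) {t : ℂ} (h : c = table k t)
    (hk : k ∈ Finset.Icc 1 71 := by decide) : c.alg.Listed :=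
  ⟨k, hk, t, by rw [h]; exact Isomorphic.refl _⟩

/-- The table with `e₁² = e₁`, `e₁e₂ = κe₂`, `e₂² = εe₂`, `e₁f₁ = λf₁`, `e₁f₂ = μf₂`,
`e₂f₁ = mf₁ + nf₂`, `e₂f₂ = pf₁ + qf₂`, `f₁f₂ = ae₁ + be₂`. -/
def tab (κ ε l μ m n p q a b : ℂ) : Table 2 2 :=
  mult ![1, 0] ![0, κ] ![0, ε] ![l, 0] ![0, μ] ![m, n] ![p, q] ![a, b]

theorem vec_zero : (![0, 0] : Fin 2 → ℂ) = 0 := by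
  ext i
  fin_cases i <;> rfl

end JordanSuper

namespace JordanSuper

open Superalgebra

set_option linter.unusedSimpArgs false

theorem one_add_one_zmod_two : (1 + 1 : ZMod 2) = 0 := by decide

theorem sign_zero : sign 0 = 1 := by simp [sign]

theorem sign_one : sign 1 = -1 := by simp [sign, show ZMod.val (1 : ZMod 2) = 1 from rfl]

/-! ### The Jordan identity for the tables with an even idempotent -/

/-- Conditions that are linear in the operator of `e₂`, from two or three factors `e₁`. -/
theorem tab_linear {κ ε l μ m n p q a b : ℂ} (hJ : (tab κ ε l μ m n p q a b).alg.IsJordan) :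
    m * (-κ + l + 2 * κ * l - 2 * l ^ 2) = 0 ∧
    n * (κ - μ - 2 * κ * l + 2 * l * μ) = 0 ∧
    p * (-κ + l + 2 * κ * μ - 2 * l * μ) = 0 ∧
    q * (κ - μ - 2 * κ * μ + 2 * μ ^ 2) = 0 ∧
    n * (l - μ - 2 * κ * l + 2 * κ * μ) = 0 ∧
    p * (l - μ - 2 * κ * l + 2 * κ * μ) = 0 := by
  have h1 := hJ.2 0 0 0 1 _ (ev_mem _ 1 0) _ (ev_mem _ 1 0) _ (ev_mem _ 0 1) _ (od_mem _ 1 0)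
  have h2 := hJ.2 0 0 0 1 _ (ev_mem _ 1 0) _ (ev_mem _ 1 0) _ (ev_mem _ 0 1) _ (od_mem _ 0 1)
  have h3 := hJ.2 0 0 1 0 _ (ev_mem _ 1 0) _ (ev_mem _ 1 0) _ (od_mem _ 1 0) _ (ev_mem _ 0 1)
  have h4 := hJ.2 0 0 1 0 _ (ev_mem _ 1 0) _ (ev_mem _ 1 0) _ (od_mem _ 0 1) _ (ev_mem _ 0 1)
  simp only [tab, mul_ev_ev, mul_ev_od, mul_od_ev, mul_od_od, smul_ev, smul_od, ev_add, od_add,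
    ev_inj, od_inj, Matrix.cons_val_zero, Matrix.cons_val_one, zero_add, add_zero, mul_zero, mul_one,
    one_add_one_zmod_two, sign_zero, sign_one, zero_mul, one_mul] at h1 h2 h3 h4
  refine ⟨?_, ?_, ?_, ?_, ?_, ?_⟩
  · linear_combination -h1.1
  · linear_combination h1.2
  · linear_combination -h2.1
  · linear_combination h2.2
  · linear_combination h3.2
  · linear_combination -h4.1

/-- Further conditions on the operators of `e₁` and `e₂`. -/
theorem tab_quadratic {κ ε l μ m n p q a b : ℂ} (hJ : (tab κ ε l μ m n p q a b).alg.IsJordan) :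
    m * (l - κ ^ 2 + 2 * κ * l - 2 * l ^ 2) = 0 ∧
    n * (μ - κ ^ 2 + 2 * κ * l - l ^ 2 - μ ^ 2) = 0 ∧
    p * (l - κ ^ 2 + 2 * κ * μ - l ^ 2 - μ ^ 2) = 0 ∧
    q * (μ - κ ^ 2 + 2 * κ * μ - 2 * μ ^ 2) = 0 ∧
    κ * ε * m - 2 * κ * m ^ 2 - 2 * κ * n * p - ε * l * m + 2 * l * m ^ 2 + 2 * μ * n * p = 0 ∧
    κ * ε * q - 2 * κ * n * p - 2 * κ * q ^ 2 - ε * μ * q + 2 * l * n * p + 2 * μ * q ^ 2 = 0 ∧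
    κ * ε * m - 2 * κ * m ^ 2 - 2 * κ * n * p - ε * l * m + 2 * l * m ^ 2 + 2 * l * n * p = 0 ∧
    -κ * ε * q + 2 * κ * n * p + 2 * κ * q ^ 2 + ε * μ * q - 2 * μ * n * p - 2 * μ * q ^ 2 = 0 := by
  have h1 := hJ.2 0 0 0 1 _ (ev_mem _ 1 0) _ (ev_mem _ 0 1) _ (ev_mem _ 1 0) _ (od_mem _ 1 0)
  have h2 := hJ.2 0 0 0 1 _ (ev_mem _ 1 0) _ (ev_mem _ 0 1) _ (ev_mem _ 1 0) _ (od_mem _ 0 1)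
  have h3 := hJ.2 0 0 0 1 _ (ev_mem _ 0 1) _ (ev_mem _ 0 1) _ (ev_mem _ 1 0) _ (od_mem _ 1 0)
  have h4 := hJ.2 0 0 0 1 _ (ev_mem _ 0 1) _ (ev_mem _ 0 1) _ (ev_mem _ 1 0) _ (od_mem _ 0 1)
  have h5 := hJ.2 0 0 0 1 _ (ev_mem _ 1 0) _ (ev_mem _ 0 1) _ (ev_mem _ 0 1) _ (od_mem _ 1 0)
  have h6 := hJ.2 0 0 0 1 _ (ev_mem _ 1 0) _ (ev_mem _ 0 1) _ (ev_mem _ 0 1) _ (od_mem _ 0 1)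
  simp only [tab, mul_ev_ev, mul_ev_od, mul_od_ev, mul_od_od, smul_ev, smul_od, ev_add, od_add,
    ev_inj, od_inj, Matrix.cons_val_zero, Matrix.cons_val_one, zero_add, add_zero, mul_zero, mul_one,
    one_add_one_zmod_two, sign_zero, sign_one, zero_mul, one_mul] at h1 h2 h3 h4 h5 h6
  refine ⟨?_, ?_, ?_, ?_, ?_, ?_, ?_, ?_⟩
  · linear_combination -h1.1
  · linear_combination -h1.2
  · linear_combination -h2.1
  · linear_combination -h2.2
  · linear_combination h3.1
  · linear_combination h4.2
  · linear_combination h5.1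
  · linear_combination -h6.2

/-- Conditions on the operator of `e₂` alone. -/
theorem tab_cubic {κ ε l μ m n p q a b : ℂ} (hJ : (tab κ ε l μ m n p q a b).alg.IsJordan) :
    ε ^ 2 * m - 3 * ε * m ^ 2 - 3 * ε * n * p + 2 * m ^ 3 + 4 * m * n * p + 2 * n * p * q = 0 ∧
    n * (ε ^ 2 - 3 * ε * m - 3 * ε * q + 2 * m ^ 2 + 2 * m * q + 2 * n * p + 2 * q ^ 2) = 0 ∧
    p * (ε ^ 2 - 3 * ε * m - 3 * ε * q + 2 * m ^ 2 + 2 * m * q + 2 * n * p + 2 * q ^ 2) = 0 ∧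
    ε ^ 2 * q - 3 * ε * n * p - 3 * ε * q ^ 2 + 2 * m * n * p + 4 * n * p * q + 2 * q ^ 3 = 0 := by
  have h1 := hJ.2 0 0 0 1 _ (ev_mem _ 0 1) _ (ev_mem _ 0 1) _ (ev_mem _ 0 1) _ (od_mem _ 1 0)
  have h2 := hJ.2 0 0 0 1 _ (ev_mem _ 0 1) _ (ev_mem _ 0 1) _ (ev_mem _ 0 1) _ (od_mem _ 0 1)
  simp only [tab, mul_ev_ev, mul_ev_od, mul_od_ev, mul_od_od, smul_ev, smul_od, ev_add, od_add,
    ev_inj, od_inj, Matrix.cons_val_zero, Matrix.cons_val_one, zero_add, add_zero, mul_zero, mul_one,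
    one_add_one_zmod_two, sign_zero, sign_one, zero_mul, one_mul] at h1 h2
  refine ⟨?_, ?_, ?_, ?_⟩
  · linear_combination h1.1
  · linear_combination h1.2
  · linear_combination h2.1
  · linear_combination h2.2

/-- Conditions on the product of the odd basis vectors that involve only `e₁`. -/
theorem tab_odd_linear {κ ε l μ m n p q a b : ℂ} (hJ : (tab κ ε l μ m n p q a b).alg.IsJordan) :
    a * (1 - l - 2 * μ + 2 * l * μ) = 0 ∧
    b * (-κ + l + 2 * κ * μ - 2 * l * μ) = 0 ∧
    a * (1 - 2 * l - μ + 2 * l * μ) = 0 ∧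
    b * (κ - μ - 2 * κ * l + 2 * l * μ) = 0 ∧
    b * (κ - κ ^ 2 - l ^ 2 + 2 * l * μ - μ ^ 2) = 0 := by
  have h1 := hJ.2 0 0 1 1 _ (ev_mem _ 1 0) _ (ev_mem _ 1 0) _ (od_mem _ 1 0) _ (od_mem _ 0 1)
  have h2 := hJ.2 0 0 1 1 _ (ev_mem _ 1 0) _ (ev_mem _ 1 0) _ (od_mem _ 0 1) _ (od_mem _ 1 0)
  have h3 := hJ.2 0 1 0 1 _ (ev_mem _ 1 0) _ (od_mem _ 1 0) _ (ev_mem _ 1 0) _ (od_mem _ 0 1)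
  simp only [tab, mul_ev_ev, mul_ev_od, mul_od_ev, mul_od_od, smul_ev, smul_od, ev_add, od_add,
    ev_inj, od_inj, Matrix.cons_val_zero, Matrix.cons_val_one, zero_add, add_zero, mul_zero, mul_one,
    one_add_one_zmod_two, sign_zero, sign_one, zero_mul, one_mul] at h1 h2 h3
  refine ⟨?_, ?_, ?_, ?_, ?_⟩
  · linear_combination -h1.1
  · linear_combination h1.2
  · linear_combination h2.1
  · linear_combination h2.2
  · linear_combination -h3.2

/-- Conditions on the product of the odd basis vectors that involve the operator of `e₂`. -/
theorem tab_odd_mixed {κ ε l μ m n p q a b : ℂ} (hJ : (tab κ ε l μ m n p q a b).alg.IsJordan) :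
    n * a * (1 - κ) = 0 ∧
    n * (2 * κ * a + ε * b) = 0 ∧
    κ ^ 2 * a + κ * ε * b - κ * μ * a - κ * m * b - κ * q * b - ε * μ * b + l * q * b + μ * m * b = 0 ∧
    κ * a - κ ^ 2 * a + l * m * b - l * q * b - μ * m * b + μ * q * b = 0 := by
  have h1 := hJ.2 0 0 1 1 _ (ev_mem _ 1 0) _ (ev_mem _ 0 1) _ (od_mem _ 1 0) _ (od_mem _ 1 0)
  have h2 := hJ.2 0 0 1 1 _ (ev_mem _ 0 1) _ (ev_mem _ 0 1) _ (od_mem _ 1 0) _ (od_mem _ 1 0)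
  have h3 := hJ.2 0 0 1 1 _ (ev_mem _ 1 0) _ (ev_mem _ 0 1) _ (od_mem _ 1 0) _ (od_mem _ 0 1)
  have h4 := hJ.2 0 1 0 1 _ (ev_mem _ 0 1) _ (od_mem _ 1 0) _ (ev_mem _ 1 0) _ (od_mem _ 0 1)
  simp only [tab, mul_ev_ev, mul_ev_od, mul_od_ev, mul_od_od, smul_ev, smul_od, ev_add, od_add,
    ev_inj, od_inj, Matrix.cons_val_zero, Matrix.cons_val_one, zero_add, add_zero, mul_zero, mul_one,
    one_add_one_zmod_two, sign_zero, sign_one, zero_mul, one_mul] at h1 h2 h3 h4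
  refine ⟨?_, ?_, ?_, ?_⟩
  · linear_combination h1.1
  · linear_combination h2.2
  · linear_combination -h3.2
  · linear_combination h4.2

end JordanSuper

namespace JordanSuper

open Superalgebra

set_option linter.unusedSimpArgs false
set_option linter.unusedVariables false

/-! ### Normal forms of tables with an even idempotent -/

/-- Interchanging `f₁` and `f₂`. -/
theorem tab_swap (κ ε l μ m n p q a b : ℂ) :
    (tab κ ε l μ m n p q a b).alg.Isomorphic (tab κ ε μ l q p n m (-a) (-b)).alg := by
  refine mult_isomorphic (a := 1) (a' := 0) (b := 0) (b' := 1) (f := 0) (f' := 1) (g := 1) (g' := 0)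
    ?_ ?_ ?_ ?_ ?_ ?_ ?_ ?_ ?_ ?_ <;> simp [Fin.forall_fin_two]

/-- Rescaling `e₂`, `f₁` and `f₂`. -/
theorem tab_scale (κ l μ n p a b : ℂ) {x y z : ℂ} (hx : x ≠ 0) (hy : y ≠ 0) (hz : z ≠ 0) :
    (tab κ 0 l μ 0 n p 0 a b).alg.Isomorphic
      (tab κ 0 l μ 0 (z * x * n / y) (z * y * p / x) 0 (x * y * a) (x * y * b / z)).alg := by
  refine mult_isomorphic (a := 1) (a' := 0) (b := 0) (b' := z) (f := x) (f' := 0) (g := 0) (g' := y)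
    ?_ ?_ ?_ ?_ ?_ ?_ ?_ ?_ ?_ ?_ <;> simp [Fin.forall_fin_two, hx, hy, hz, mul_comm] <;> field_simp

/-- When `e₁` acts on the odd part as a scalar, the odd basis may be changed freely. The hypotheses
say that `e₂` acts nilpotently, so its operator can be put into Jordan form. -/
theorem tab_conj (κ ε l a b : ℂ) {m n p q : ℂ} (ht : m + q = 0) (hd : m * q - n * p = 0) :
    ∃ n' a' b', (tab κ ε l l m n p q a b).alg.Isomorphic (tab κ ε l l 0 n' 0 0 a' b').alg := by
  obtain rfl : q = -m := by linear_combination ht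
  by_cases hn : n = 0
  · obtain rfl : m = 0 := by
      rw [hn] at hd
      simpa using hd
    by_cases hp : p = 0
    · rw [hn, hp, neg_zero]
      exact ⟨0, a, b, Isomorphic.refl _⟩
    · refine ⟨p, -a, -b, ?_⟩
      rw [hn]
      simpa using tab_swap κ ε l l 0 0 p 0 a b
  -- The new `f₂` is `e₂f₁ = mf₁ + nf₂`, which multiplies `f₁f₂` by `n`.
  · refine ⟨1, n * a, n * b, ?_⟩
    refine mult_isomorphic (a := 1) (a' := 0) (b := 0) (b' := 1) (f := 1) (f' := 0) (g := m) (g' := n)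
      ?_ ?_ ?_ ?_ ?_ ?_ ?_ ?_ ?_ ?_ <;> simp [Fin.forall_fin_two, hn]
    · exact ⟨mul_comm _ _, mul_comm _ _⟩
    · exact ⟨by linear_combination -hd, by ring⟩

/-- The hypotheses are entries of `M³ = 0` for the matrix `M` with columns `(m, n)` and `(p, q)`.
The conclusion follows from `det(M³) = (det M)³` and `(tr M)³ = tr(M³) + 3 tr M det M`. -/
theorem trace_eq_zero_and_det_eq_zero {m n p q : ℂ}
    (c₁ : m ^ 3 + 2 * m * n * p + n * p * q = 0) (c₂ : n * (m ^ 2 + m * q + n * p + q ^ 2) = 0)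
    (c₃ : m * n * p + 2 * n * p * q + q ^ 3 = 0) : m + q = 0 ∧ m * q - n * p = 0 := by
  have hd : m * q - n * p = 0 := pow_eq_zero_iff three_ne_zero |>.1 <| by
    linear_combination (m * n * p + 2 * n * p * q + q ^ 3) * c₁
      - p * (m ^ 2 + m * q + n * p + q ^ 2) * c₂
  have ht : m + q = 0 := pow_eq_zero_iff three_ne_zero |>.1 <| by
    linear_combination c₁ + c₃ + 3 * (m + q) * hd
  exact ⟨ht, hd⟩

/-- Since `e₂² = 0`, the Jordan identity with three factors `e₂` says that the cube of its operator
vanishes. -/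
theorem tab_nilpotent {κ l μ m n p q a b : ℂ} (hJ : (tab κ 0 l μ m n p q a b).alg.IsJordan) :
    m + q = 0 ∧ m * q - n * p = 0 := by
  obtain ⟨c₁, c₂, -, c₄⟩ := tab_cubic hJ
  exact trace_eq_zero_and_det_eq_zero (by linear_combination (1 / 2) * c₁)
    (by linear_combination (1 / 2) * c₂) (by linear_combination (1 / 2) * c₄)

/-- Since `np = 0`, at most two of the constants are nonzero, and rescaling `f₁` and `f₂` makes both
equal to one. -/
theorem exists_scale (κ l μ b : ℂ) {n p : ℂ} (hnp : n * p = 0) :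
    ∃ n' p' b' : ℂ, (n' = 0 ∨ n' = 1) ∧ (p' = 0 ∨ p' = 1) ∧ (b' = 0 ∨ b' = 1) ∧ (p = 0 → p' = 0) ∧
      n' * p' = 0 ∧
      (tab κ 0 l μ 0 n p 0 0 b).alg.Isomorphic (tab κ 0 l μ 0 n' p' 0 0 b').alg := by
  -- Normalising `n` (or `p`) ties the two scale factors together, so `b` is multiplied by a square
  -- and a square root is needed.
  have hsq : ∀ c : ℂ, c ≠ 0 → ∃ x : ℂ, x ≠ 0 ∧ x * x * c = 1 := fun c hc => by
    obtain ⟨x, hx⟩ := IsAlgClosed.exists_pow_nat_eq c⁻¹ (n := 2) (by norm_num)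
    have : x * x * c = 1 := by rw [← sq, hx, inv_mul_cancel₀ hc]
    exact ⟨x, by rintro rfl; simp at this, this⟩
  by_cases hn : n = 0
  · by_cases hp : p = 0
    · subst hn hp
      by_cases hb : b = 0
      · subst hb
        exact ⟨0, 0, 0, by simp [Isomorphic.refl]⟩
      · refine ⟨0, 0, 1, by simp, by simp, by simp, by simp, by simp, ?_⟩
        simpa [hb] using tab_scale κ l μ 0 0 0 b (inv_ne_zero hb) one_ne_zero one_ne_zero
    · subst hn
      by_cases hb : b = 0
      · subst hb
        refine ⟨0, 1, 0, by simp, by simp, by simp, by simp [hp], by simp, ?_⟩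
        simpa [hp] using tab_scale κ l μ 0 p 0 0 hp one_ne_zero one_ne_zero
      · obtain ⟨y, hy, hyc⟩ := hsq (p * b) (mul_ne_zero hp hb)
        refine ⟨0, 1, 1, by simp, by simp, by simp, by simp [hp], by simp, ?_⟩
        have := tab_scale κ l μ 0 p 0 b (mul_ne_zero hy hp) hy one_ne_zero
        have h1 : y * p * y * b = 1 := by linear_combination hyc
        simpa [hp, hy, h1] using this
  · obtain rfl : p = 0 := (mul_eq_zero.1 hnp).resolve_left hn
    by_cases hb : b = 0
    · subst hb
      refine ⟨1, 0, 0, by simp, by simp, by simp, by simp, by simp, ?_⟩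
      simpa [hn] using tab_scale κ l μ n 0 0 0 one_ne_zero hn one_ne_zero
    · obtain ⟨x, hx, hxc⟩ := hsq (n * b) (mul_ne_zero hn hb)
      refine ⟨1, 0, 1, by simp, by simp, by simp, by simp, by simp, ?_⟩
      have := tab_scale κ l μ n 0 0 b hx (mul_ne_zero hx hn) one_ne_zero
      have h1 : x * (x * n) * b = 1 := by linear_combination hxc
      simpa [hn, hx, h1] using this

/-- If `e₂` annihilates the odd part, `e₂` can be rescaled as well. Scaling `f₁` normalises `a`, and
scaling `e₂` absorbs what is left of `b`. -/
theorem exists_scale_odd (κ l μ a b : ℂ) :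
    ∃ a' b' : ℂ, (a' = 0 ∨ a' = 1) ∧ (b' = 0 ∨ b' = 1) ∧ (a = 0 → a' = 0) ∧ (b = 0 → b' = 0) ∧
      (tab κ 0 l μ 0 0 0 0 a b).alg.Isomorphic (tab κ 0 l μ 0 0 0 0 a' b').alg := by
  by_cases ha : a = 0
  · subst ha
    by_cases hb : b = 0
    · subst hb
      exact ⟨0, 0, by simp [Isomorphic.refl]⟩
    · refine ⟨0, 1, by simp, by simp, by simp, by simp [hb], ?_⟩
      simpa [hb] using tab_scale κ l μ 0 0 0 b (inv_ne_zero hb) one_ne_zero one_ne_zero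
  · by_cases hb : b = 0
    · subst hb
      refine ⟨1, 0, by simp, by simp, by simp [ha], by simp, ?_⟩
      simpa [ha] using tab_scale κ l μ 0 0 a 0 (inv_ne_zero ha) one_ne_zero one_ne_zero
    · refine ⟨1, 1, by simp, by simp, by simp [ha], by simp [hb], ?_⟩
      have := tab_scale κ l μ 0 0 a b (inv_ne_zero ha) one_ne_zero
        (mul_ne_zero (inv_ne_zero ha) hb)
      simpa [ha, hb] using this

/-- Each lemma of this kind fixes the eigenvalues of `e₁` on `e₂`, `f₁`, `f₂`, in this order. At
these values the linear conditions become Peirce rules that kill the constants between incompatible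
eigenspaces. A diagonal entry that survives is removed by the quadratic or cubic conditions, or by
passing to a Jordan basis. -/
theorem listed_tab_zero_zero_half {m n p q a b : ℂ}
    (hJ : (tab 0 0 0 (1 / 2) m n p q a b).alg.IsJordan) :
    (tab 0 0 0 (1 / 2) m n p q a b).alg.Listed := by
  obtain ⟨-, r₂, -, -, -, r₆⟩ := tab_linear hJ
  obtain ⟨c₁, -, -, c₄⟩ := tab_cubic hJ
  obtain ⟨-, -, w₃, w₄, -⟩ := tab_odd_linear hJ
  obtain rfl : n = 0 := by linear_combination (-2) * r₂
  obtain rfl : p = 0 := by linear_combination (-2) * r₆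
  obtain rfl : a = 0 := by linear_combination 2 * w₃
  obtain rfl : b = 0 := by linear_combination (-2) * w₄
  obtain rfl : m = 0 := by simpa using c₁
  obtain rfl : q = 0 := by simpa using c₄
  exact listed_of_eq 25 (t := 0) (by simp [tab, table, vec_zero, e₁, e₂, f₁, f₂])

theorem listed_tab_zero_zero_one {m n p q a b : ℂ}
    (hJ : (tab 0 0 0 1 m n p q a b).alg.IsJordan) :
    (tab 0 0 0 1 m n p q a b).alg.Listed := by
  obtain ⟨-, r₂, -, r₄, -, r₆⟩ := tab_linear hJ
  obtain ⟨c₁, -, -, -⟩ := tab_cubic hJ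
  obtain ⟨w₁, -, -, w₄, -⟩ := tab_odd_linear hJ
  obtain rfl : n = 0 := by linear_combination -r₂
  obtain rfl : p = 0 := by linear_combination -r₆
  obtain rfl : q = 0 := by linear_combination r₄
  obtain rfl : a = 0 := by linear_combination -w₁
  obtain rfl : b = 0 := by linear_combination -w₄
  obtain rfl : m = 0 := by simpa using c₁
  exact listed_of_eq 26 (t := 0) (by simp [tab, table, vec_zero, e₁, e₂, f₁, f₂])

theorem listed_tab_zero_half_one {m n p q a b : ℂ}
    (hJ : (tab 0 0 (1 / 2) 1 m n p q a b).alg.IsJordan) :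
    (tab 0 0 (1 / 2) 1 m n p q a b).alg.Listed := by
  obtain ⟨-, -, r₃, r₄, r₅, -⟩ := tab_linear hJ
  obtain ⟨c₁, -, -, -⟩ := tab_cubic hJ
  obtain ⟨w₁, w₂, -, -, -⟩ := tab_odd_linear hJ
  obtain rfl : n = 0 := by linear_combination (-2) * r₅
  obtain rfl : p = 0 := by linear_combination (-2) * r₃
  obtain rfl : q = 0 := by linear_combination r₄
  obtain rfl : a = 0 := by linear_combination (-2) * w₁
  obtain rfl : b = 0 := by linear_combination (-2) * w₂
  obtain rfl : m = 0 := by simpa using c₁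
  exact listed_of_eq 33 (t := 0) (by simp [tab, table, vec_zero, e₁, e₂, f₁, f₂])

theorem listed_tab_one_zero_zero {m n p q a b : ℂ}
    (hJ : (tab 1 0 0 0 m n p q a b).alg.IsJordan) :
    (tab 1 0 0 0 m n p q a b).alg.Listed := by
  obtain ⟨r₁, r₂, r₃, r₄, -, -⟩ := tab_linear hJ
  obtain ⟨w₁, w₂, -, -, -⟩ := tab_odd_linear hJ
  obtain rfl : m = 0 := by linear_combination -r₁
  obtain rfl : n = 0 := by linear_combination r₂
  obtain rfl : p = 0 := by linear_combination -r₃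
  obtain rfl : q = 0 := by linear_combination r₄
  obtain rfl : a = 0 := by linear_combination w₁
  obtain rfl : b = 0 := by linear_combination -w₂
  exact listed_of_eq 36 (t := 0) (by simp [tab, table, vec_zero, e₁, e₂, f₁, f₂])

theorem listed_tab_one_zero_half {m n p q a b : ℂ}
    (hJ : (tab 1 0 0 (1 / 2) m n p q a b).alg.IsJordan) :
    (tab 1 0 0 (1 / 2) m n p q a b).alg.Listed := by
  obtain ⟨r₁, r₂, -, -, -, r₆⟩ := tab_linear hJ
  obtain ⟨-, -, -, c₄⟩ := tab_cubic hJ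
  obtain ⟨-, -, w₃, w₄, -⟩ := tab_odd_linear hJ
  obtain rfl : m = 0 := by linear_combination -r₁
  obtain rfl : n = 0 := by linear_combination 2 * r₂
  obtain rfl : p = 0 := by linear_combination 2 * r₆
  obtain rfl : a = 0 := by linear_combination 2 * w₃
  obtain rfl : b = 0 := by linear_combination 2 * w₄
  obtain rfl : q = 0 := by simpa using c₄
  exact listed_of_eq 37 (t := 0) (by simp [tab, table, vec_zero, e₁, e₂, f₁, f₂])

theorem listed_tab_one_zero_one {m n p q a b : ℂ}
    (hJ : (tab 1 0 0 1 m n p q a b).alg.IsJordan) :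
    (tab 1 0 0 1 m n p q a b).alg.Listed := by
  obtain ⟨r₁, -, r₃, -, r₅, -⟩ := tab_linear hJ
  obtain ⟨-, -, -, c₄⟩ := tab_cubic hJ
  obtain ⟨w₁, w₂, -, -, -⟩ := tab_odd_linear hJ
  obtain rfl : m = 0 := by linear_combination -r₁
  obtain rfl : n = 0 := by linear_combination r₅
  obtain rfl : p = 0 := by linear_combination r₃
  obtain rfl : a = 0 := by linear_combination -w₁
  obtain rfl : b = 0 := by linear_combination w₂
  obtain rfl : q = 0 := by simpa using c₄
  exact listed_of_eq 38 (t := 0) (by simp [tab, table, vec_zero, e₁, e₂, f₁, f₂])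

theorem listed_tab_one_half_one {m n p q a b : ℂ}
    (hJ : (tab 1 0 (1 / 2) 1 m n p q a b).alg.IsJordan) :
    (tab 1 0 (1 / 2) 1 m n p q a b).alg.Listed := by
  obtain ⟨-, -, r₃, -, r₅, -⟩ := tab_linear hJ
  obtain ⟨c₁, -, -, c₄⟩ := tab_cubic hJ
  obtain ⟨w₁, w₂, -, -, -⟩ := tab_odd_linear hJ
  obtain rfl : n = 0 := by linear_combination 2 * r₅
  obtain rfl : p = 0 := by linear_combination 2 * r₃
  obtain rfl : a = 0 := by linear_combination (-2) * w₁
  obtain rfl : b = 0 := by linear_combination 2 * w₂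
  obtain rfl : m = 0 := by simpa using c₁
  obtain rfl : q = 0 := by simpa using c₄
  exact listed_of_eq 43 (t := 0) (by simp [tab, table, vec_zero, e₁, e₂, f₁, f₂])

theorem listed_tab_half_zero_zero {m n p q a b : ℂ}
    (hJ : (tab (1 / 2) 0 0 0 m n p q a b).alg.IsJordan) :
    (tab (1 / 2) 0 0 0 m n p q a b).alg.Listed := by
  obtain ⟨r₁, r₂, r₃, r₄, -, -⟩ := tab_linear hJ
  obtain ⟨w₁, w₂, -, -, -⟩ := tab_odd_linear hJ
  obtain rfl : m = 0 := by linear_combination (-2) * r₁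
  obtain rfl : n = 0 := by linear_combination 2 * r₂
  obtain rfl : p = 0 := by linear_combination (-2) * r₃
  obtain rfl : q = 0 := by linear_combination 2 * r₄
  obtain rfl : a = 0 := by linear_combination w₁
  obtain rfl : b = 0 := by linear_combination (-2) * w₂
  exact listed_of_eq 50 (t := 0) (by simp [tab, table, vec_zero, e₁, e₂, f₁, f₂])

/-- The operator of `e₂` may exchange the two eigenlines of `e₁`, but only in one direction since
`np = 0`. Together with the free choice of `b` this gives six normal forms. -/
theorem listed_tab_half_zero_half {m n p q a b : ℂ}
    (hJ : (tab (1 / 2) 0 0 (1 / 2) m n p q a b).alg.IsJordan) :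
    (tab (1 / 2) 0 0 (1 / 2) m n p q a b).alg.Listed := by
  obtain ⟨r₁, -, -, -, -, -⟩ := tab_linear hJ
  obtain ⟨-, -, -, q₄, -, q₆, -, -⟩ := tab_quadratic hJ
  obtain ⟨-, -, w₃, -, -⟩ := tab_odd_linear hJ
  obtain rfl : m = 0 := by linear_combination (-2) * r₁
  obtain rfl : q = 0 := by linear_combination 4 * q₄
  obtain rfl : a = 0 := by linear_combination 2 * w₃
  have hnp : n * p = 0 := by linear_combination -q₆
  obtain ⟨n, p, b, hn, hp, hb, -, hnp, h⟩ := exists_scale (1 / 2) 0 (1 / 2) b hnp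
  refine h.listed ?_
  rcases hn with rfl | rfl <;> rcases hp with rfl | rfl <;> rcases hb with rfl | rfl
  · exact listed_of_eq 51 (t := 0) (by simp [tab, table, vec_zero, e₁, e₂, f₁, f₂])
  · exact listed_of_eq 52 (t := 0) (by simp [tab, table, vec_zero, e₁, e₂, f₁, f₂])
  · exact listed_of_eq 53 (t := 0) (by simp [tab, table, vec_zero, e₁, e₂, f₁, f₂])
  · exact listed_of_eq 54 (t := 0) (by simp [tab, table, vec_zero, e₁, e₂, f₁, f₂])
  · exact listed_of_eq 55 (t := 0) (by simp [tab, table, vec_zero, e₁, e₂, f₁, f₂])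
  · exact listed_of_eq 56 (t := 0) (by simp [tab, table, vec_zero, e₁, e₂, f₁, f₂])
  all_goals simp at hnp

theorem listed_tab_half_zero_one {m n p q a b : ℂ}
    (hJ : (tab (1 / 2) 0 0 1 m n p q a b).alg.IsJordan) :
    (tab (1 / 2) 0 0 1 m n p q a b).alg.Listed := by
  obtain ⟨r₁, r₂, r₃, r₄, -, -⟩ := tab_linear hJ
  obtain ⟨w₁, w₂, -, -, -⟩ := tab_odd_linear hJ
  obtain rfl : m = 0 := by linear_combination (-2) * r₁
  obtain rfl : n = 0 := by linear_combination (-2) * r₂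
  obtain rfl : p = 0 := by linear_combination 2 * r₃
  obtain rfl : q = 0 := by linear_combination 2 * r₄
  obtain rfl : a = 0 := by linear_combination -w₁
  obtain rfl : b = 0 := by linear_combination 2 * w₂
  exact listed_of_eq 57 (t := 0) (by simp [tab, table, vec_zero, e₁, e₂, f₁, f₂])

/-- All of `e₂`, `f₁`, `f₂` have Peirce eigenvalue `1/2`, and products of such elements avoid this
eigenvalue. So at most a multiple of `e₁` remains for `f₁f₂`, and an identity involving `e₂`
excludes it. -/
theorem listed_tab_half_half_half {m n p q a b : ℂ}
    (hJ : (tab (1 / 2) 0 (1 / 2) (1 / 2) m n p q a b).alg.IsJordan) :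
    (tab (1 / 2) 0 (1 / 2) (1 / 2) m n p q a b).alg.Listed := by
  obtain ⟨q₁, q₂, q₃, q₄, -, -, -, -⟩ := tab_quadratic hJ
  obtain ⟨-, -, -, -, w₅⟩ := tab_odd_linear hJ
  obtain ⟨-, -, -, x₄⟩ := tab_odd_mixed hJ
  obtain rfl : m = 0 := by linear_combination 4 * q₁
  obtain rfl : n = 0 := by linear_combination 4 * q₂
  obtain rfl : p = 0 := by linear_combination 4 * q₃
  obtain rfl : q = 0 := by linear_combination 4 * q₄
  obtain rfl : b = 0 := by linear_combination 4 * w₅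
  obtain rfl : a = 0 := by linear_combination 4 * x₄
  exact listed_of_eq 58 (t := 0) (by simp [tab, table, vec_zero, e₁, e₂, f₁, f₂])

theorem listed_tab_half_half_one {m n p q a b : ℂ}
    (hJ : (tab (1 / 2) 0 (1 / 2) 1 m n p q a b).alg.IsJordan) :
    (tab (1 / 2) 0 (1 / 2) 1 m n p q a b).alg.Listed := by
  obtain ⟨-, -, -, r₄, -, -⟩ := tab_linear hJ
  obtain ⟨q₁, -, -, -, q₅, -, -, -⟩ := tab_quadratic hJ
  obtain ⟨w₁, -, -, -, -⟩ := tab_odd_linear hJ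
  obtain rfl : m = 0 := by linear_combination 4 * q₁
  obtain rfl : q = 0 := by linear_combination 2 * r₄
  obtain rfl : a = 0 := by linear_combination (-2) * w₁
  have hnp : n * p = 0 := by linear_combination q₅
  obtain ⟨n, p, b, hn, hp, hb, -, hnp, h⟩ := exists_scale (1 / 2) (1 / 2) 1 b hnp
  refine h.listed ?_
  rcases hn with rfl | rfl <;> rcases hp with rfl | rfl <;> rcases hb with rfl | rfl
  · exact listed_of_eq 59 (t := 0) (by simp [tab, table, vec_zero, e₁, e₂, f₁, f₂])
  · exact listed_of_eq 60 (t := 0) (by simp [tab, table, vec_zero, e₁, e₂, f₁, f₂])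
  · exact listed_of_eq 61 (t := 0) (by simp [tab, table, vec_zero, e₁, e₂, f₁, f₂])
  · exact listed_of_eq 62 (t := 0) (by simp [tab, table, vec_zero, e₁, e₂, f₁, f₂])
  · exact listed_of_eq 63 (t := 0) (by simp [tab, table, vec_zero, e₁, e₂, f₁, f₂])
  · exact listed_of_eq 64 (t := 0) (by simp [tab, table, vec_zero, e₁, e₂, f₁, f₂])
  all_goals simp at hnp

theorem listed_tab_half_one_one {m n p q a b : ℂ}
    (hJ : (tab (1 / 2) 0 1 1 m n p q a b).alg.IsJordan) :
    (tab (1 / 2) 0 1 1 m n p q a b).alg.Listed := by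
  obtain ⟨r₁, r₂, r₃, r₄, -, -⟩ := tab_linear hJ
  obtain ⟨-, w₂, -, -, -⟩ := tab_odd_linear hJ
  obtain ⟨-, -, -, x₄⟩ := tab_odd_mixed hJ
  obtain rfl : m = 0 := by linear_combination (-2) * r₁
  obtain rfl : n = 0 := by linear_combination 2 * r₂
  obtain rfl : p = 0 := by linear_combination (-2) * r₃
  obtain rfl : q = 0 := by linear_combination 2 * r₄
  obtain rfl : b = 0 := by linear_combination (-2) * w₂
  obtain rfl : a = 0 := by linear_combination 4 * x₄
  exact listed_of_eq 65 (t := 0) (by simp [tab, table, vec_zero, e₁, e₂, f₁, f₂])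

theorem listed_tab_zero_one_one {m n p q a b : ℂ} (hJ : (tab 0 0 1 1 m n p q a b).alg.IsJordan) :
    (tab 0 0 1 1 m n p q a b).alg.Listed := by
  obtain ⟨r₁, r₂, r₃, r₄, -, -⟩ := tab_linear hJ
  obtain ⟨-, w₂, -, -, -⟩ := tab_odd_linear hJ
  obtain rfl : m = 0 := by linear_combination -r₁
  obtain rfl : n = 0 := by linear_combination r₂
  obtain rfl : p = 0 := by linear_combination -r₃
  obtain rfl : q = 0 := by linear_combination r₄
  obtain rfl : b = 0 := by linear_combination -w₂
  obtain ⟨a, b, ha, hb, -, hb', h⟩ := exists_scale_odd 0 1 1 a 0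
  obtain rfl := hb' rfl
  refine h.listed ?_
  rcases ha with rfl | rfl
  · exact listed_of_eq 34 (t := 0) (by simp [tab, table, vec_zero, e₁, e₂, f₁, f₂])
  · exact listed_of_eq 35 (t := 0) (by simp [tab, table, vec_zero, e₁, e₂, f₁, f₂])

theorem listed_tab_zero_zero_zero {m n p q a b : ℂ}
    (hJ : (tab 0 0 0 0 m n p q a b).alg.IsJordan) : (tab 0 0 0 0 m n p q a b).alg.Listed := by
  obtain ⟨ht, hd⟩ := tab_nilpotent hJ
  obtain ⟨n, a, b, h⟩ := tab_conj 0 0 0 a b ht hd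
  obtain ⟨w₁, -, -, -, -⟩ := tab_odd_linear (h.isJordan hJ)
  obtain rfl : a = 0 := by linear_combination w₁
  obtain ⟨n, p, b, hn, -, hb, hp, -, h'⟩ := exists_scale 0 0 0 b (mul_zero n)
  obtain rfl := hp rfl
  refine h.listed (h'.listed ?_)
  rcases hn with rfl | rfl <;> rcases hb with rfl | rfl
  · exact listed_of_eq 21 (t := 0) (by simp [tab, table, vec_zero, e₁, e₂, f₁, f₂])
  · exact listed_of_eq 22 (t := 0) (by simp [tab, table, vec_zero, e₁, e₂, f₁, f₂])
  · exact listed_of_eq 23 (t := 0) (by simp [tab, table, vec_zero, e₁, e₂, f₁, f₂])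
  · exact listed_of_eq 24 (t := 0) (by simp [tab, table, vec_zero, e₁, e₂, f₁, f₂])

theorem listed_tab_zero_half_half {m n p q a b : ℂ}
    (hJ : (tab 0 0 (1 / 2) (1 / 2) m n p q a b).alg.IsJordan) :
    (tab 0 0 (1 / 2) (1 / 2) m n p q a b).alg.Listed := by
  obtain ⟨ht, hd⟩ := tab_nilpotent hJ
  obtain ⟨n, a, b, h⟩ := tab_conj 0 0 (1 / 2) a b ht hd
  refine h.listed ?_
  obtain ⟨x₁, -, -, -⟩ := tab_odd_mixed (h.isJordan hJ)
  -- Here `na = 0`. Either `e₂` kills the odd part and both coordinates of `f₁f₂` are free, or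
  -- `f₁f₂` is a multiple of `e₂`.
  rcases eq_or_ne n 0 with rfl | hn
  · obtain ⟨a, b, ha, hb, -, -, h'⟩ := exists_scale_odd 0 (1 / 2) (1 / 2) a b
    refine h'.listed ?_
    rcases ha with rfl | rfl <;> rcases hb with rfl | rfl
    · exact listed_of_eq 27 (t := 0) (by simp [tab, table, vec_zero, e₁, e₂, f₁, f₂])
    · exact listed_of_eq 28 (t := 0) (by simp [tab, table, vec_zero, e₁, e₂, f₁, f₂])
    · exact listed_of_eq 29 (t := 0) (by simp [tab, table, vec_zero, e₁, e₂, f₁, f₂])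
    · exact listed_of_eq 30 (t := 0) (by simp [tab, table, vec_zero, e₁, e₂, f₁, f₂])
  · obtain rfl : a = 0 := by simpa [hn] using x₁
    obtain ⟨n, p, b, hn, -, hb, hp, -, h'⟩ := exists_scale 0 (1 / 2) (1 / 2) b (mul_zero n)
    obtain rfl := hp rfl
    refine h'.listed ?_
    -- `exists_scale` does not record that `n` stays nonzero, so the value `n = 0` reappears here
    -- and is harmlessly matched again.
    rcases hn with rfl | rfl <;> rcases hb with rfl | rfl
    · exact listed_of_eq 27 (t := 0) (by simp [tab, table, vec_zero, e₁, e₂, f₁, f₂])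
    · exact listed_of_eq 28 (t := 0) (by simp [tab, table, vec_zero, e₁, e₂, f₁, f₂])
    · exact listed_of_eq 31 (t := 0) (by simp [tab, table, vec_zero, e₁, e₂, f₁, f₂])
    · exact listed_of_eq 32 (t := 0) (by simp [tab, table, vec_zero, e₁, e₂, f₁, f₂])

theorem listed_tab_one_half_half {m n p q a b : ℂ}
    (hJ : (tab 1 0 (1 / 2) (1 / 2) m n p q a b).alg.IsJordan) :
    (tab 1 0 (1 / 2) (1 / 2) m n p q a b).alg.Listed := by
  obtain ⟨ht, hd⟩ := tab_nilpotent hJ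
  obtain ⟨n, a, b, h⟩ := tab_conj 1 0 (1 / 2) a b ht hd
  obtain ⟨-, -, x₃, -⟩ := tab_odd_mixed (h.isJordan hJ)
  obtain rfl : a = 0 := by linear_combination 2 * x₃
  obtain ⟨n, p, b, hn, -, hb, hp, -, h'⟩ := exists_scale 1 (1 / 2) (1 / 2) b (mul_zero n)
  obtain rfl := hp rfl
  refine h.listed (h'.listed ?_)
  rcases hn with rfl | rfl <;> rcases hb with rfl | rfl
  · exact listed_of_eq 39 (t := 0) (by simp [tab, table, vec_zero, e₁, e₂, f₁, f₂])
  · exact listed_of_eq 40 (t := 0) (by simp [tab, table, vec_zero, e₁, e₂, f₁, f₂])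
  · exact listed_of_eq 41 (t := 0) (by simp [tab, table, vec_zero, e₁, e₂, f₁, f₂])
  · exact listed_of_eq 42 (t := 0) (by simp [tab, table, vec_zero, e₁, e₂, f₁, f₂])

theorem listed_tab_one_one_one {m n p q a b : ℂ}
    (hJ : (tab 1 0 1 1 m n p q a b).alg.IsJordan) : (tab 1 0 1 1 m n p q a b).alg.Listed := by
  obtain ⟨ht, hd⟩ := tab_nilpotent hJ
  obtain ⟨n, a, b, h⟩ := tab_conj 1 0 1 a b ht hd
  refine h.listed ?_
  obtain ⟨-, x₂, -, -⟩ := tab_odd_mixed (h.isJordan hJ)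
  -- As before `na = 0`, this time from the identity with two factors `e₂` and two factors `f₁`.
  rcases eq_or_ne n 0 with rfl | hn
  · obtain ⟨a, b, ha, hb, -, -, h'⟩ := exists_scale_odd 1 1 1 a b
    refine h'.listed ?_
    rcases ha with rfl | rfl <;> rcases hb with rfl | rfl
    · exact listed_of_eq 44 (t := 0) (by simp [tab, table, vec_zero, e₁, e₂, f₁, f₂])
    · exact listed_of_eq 45 (t := 0) (by simp [tab, table, vec_zero, e₁, e₂, f₁, f₂])
    · exact listed_of_eq 46 (t := 0) (by simp [tab, table, vec_zero, e₁, e₂, f₁, f₂])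
    · exact listed_of_eq 47 (t := 0) (by simp [tab, table, vec_zero, e₁, e₂, f₁, f₂])
  · obtain rfl : a = 0 := by simpa [hn] using x₂
    obtain ⟨n, p, b, hn, -, hb, hp, -, h'⟩ := exists_scale 1 1 1 b (mul_zero n)
    obtain rfl := hp rfl
    refine h'.listed ?_
    rcases hn with rfl | rfl <;> rcases hb with rfl | rfl
    · exact listed_of_eq 44 (t := 0) (by simp [tab, table, vec_zero, e₁, e₂, f₁, f₂])
    · exact listed_of_eq 45 (t := 0) (by simp [tab, table, vec_zero, e₁, e₂, f₁, f₂])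
    · exact listed_of_eq 48 (t := 0) (by simp [tab, table, vec_zero, e₁, e₂, f₁, f₂])
    · exact listed_of_eq 49 (t := 0) (by simp [tab, table, vec_zero, e₁, e₂, f₁, f₂])

end JordanSuper

/-! ### Assembly of the eigenvalue cases, and the case of two orthogonal idempotents -/

namespace JordanSuper

open Superalgebra

set_option linter.unusedSimpArgs false
set_option linter.unusedVariables false

/-- Interchanging `f₁` and `f₂` allows the two odd eigenvalues to be ordered, which reduces the 27
cases to 18. -/
theorem listed_tab_of_eps_eq_zero {κ l μ m n p q a b : ℂ} (hκ : κ = 0 ∨ κ = 1 ∨ κ = 1 / 2)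
    (hl : l = 0 ∨ l = 1 / 2 ∨ l = 1) (hμ : μ = 0 ∨ μ = 1 / 2 ∨ μ = 1)
    (hJ : (tab κ 0 l μ m n p q a b).alg.IsJordan) : (tab κ 0 l μ m n p q a b).alg.Listed := by
  have hs := tab_swap κ 0 l μ m n p q a b
  have hJ' := hs.isJordan hJ
  rcases hκ with rfl | rfl | rfl <;> rcases hl with rfl | rfl | rfl <;>
    rcases hμ with rfl | rfl | rfl
  · exact listed_tab_zero_zero_zero hJ
  · exact listed_tab_zero_zero_half hJ
  · exact listed_tab_zero_zero_one hJ
  · exact hs.listed (listed_tab_zero_zero_half hJ')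
  · exact listed_tab_zero_half_half hJ
  · exact listed_tab_zero_half_one hJ
  · exact hs.listed (listed_tab_zero_zero_one hJ')
  · exact hs.listed (listed_tab_zero_half_one hJ')
  · exact listed_tab_zero_one_one hJ
  · exact listed_tab_one_zero_zero hJ
  · exact listed_tab_one_zero_half hJ
  · exact listed_tab_one_zero_one hJ
  · exact hs.listed (listed_tab_one_zero_half hJ')
  · exact listed_tab_one_half_half hJ
  · exact listed_tab_one_half_one hJ
  · exact hs.listed (listed_tab_one_zero_one hJ')
  · exact hs.listed (listed_tab_one_half_one hJ')
  · exact listed_tab_one_one_one hJ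
  · exact listed_tab_half_zero_zero hJ
  · exact listed_tab_half_zero_half hJ
  · exact listed_tab_half_zero_one hJ
  · exact hs.listed (listed_tab_half_zero_half hJ')
  · exact listed_tab_half_half_half hJ
  · exact listed_tab_half_half_one hJ
  · exact hs.listed (listed_tab_half_zero_one hJ')
  · exact hs.listed (listed_tab_half_half_one hJ')
  · exact listed_tab_half_one_one hJ

/-! ### Two orthogonal even idempotents -/

/-- Interchanging `e₁` and `e₂`. -/
theorem tab_swap_even (l μ m q a b : ℂ) :
    (tab 0 1 l μ m 0 0 q a b).alg.Isomorphic (tab 0 1 m q l 0 0 μ b a).alg := by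
  refine mult_isomorphic (a := 0) (a' := 1) (b := 1) (b' := 0) (f := 1) (f' := 0) (g := 0) (g' := 1)
    ?_ ?_ ?_ ?_ ?_ ?_ ?_ ?_ ?_ ?_ <;> simp [Fin.forall_fin_two]

theorem tab_scale_odd (κ ε l μ m q a b : ℂ) {x : ℂ} (hx : x ≠ 0) :
    (tab κ ε l μ m 0 0 q a b).alg.Isomorphic (tab κ ε l μ m 0 0 q (x * a) (x * b)).alg := by
  refine mult_isomorphic (a := 1) (a' := 0) (b := 0) (b' := 1) (f := x) (f' := 0) (g := 0) (g' := 1)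
    ?_ ?_ ?_ ?_ ?_ ?_ ?_ ?_ ?_ ?_ <;> simp [Fin.forall_fin_two, hx, mul_comm]

theorem listed_diag_swap {l μ m q : ℂ} (h : (tab 0 1 μ l q 0 0 m 0 0).alg.Listed) :
    (tab 0 1 l μ m 0 0 q 0 0).alg.Listed := by
  have := tab_swap 0 1 l μ m 0 0 q 0 0
  rw [neg_zero] at this
  exact this.listed h

theorem listed_diag_eswap {l μ m q : ℂ} (h : (tab 0 1 m q l 0 0 μ 0 0).alg.Listed) :
    (tab 0 1 l μ m 0 0 q 0 0).alg.Listed :=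
  (tab_swap_even l μ m q 0 0).listed h

theorem listed_diag_1 : (tab 0 1 0 0 0 0 0 0 0 0).alg.Listed :=
  listed_of_eq 1 (t := 0) (by simp [tab, table, vec_zero, e₁, e₂, f₁, f₂])

theorem listed_diag_2 : (tab 0 1 0 0 0 0 0 1 0 0).alg.Listed :=
  listed_of_eq 2 (t := 0) (by simp [tab, table, vec_zero, e₁, e₂, f₁, f₂])

theorem listed_diag_3 : (tab 0 1 0 0 0 0 0 (1 / 2) 0 0).alg.Listed :=
  listed_of_eq 3 (t := 0) (by simp [tab, table, vec_zero, e₁, e₂, f₁, f₂])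

theorem listed_diag_4 : (tab 0 1 0 0 1 0 0 1 0 0).alg.Listed :=
  listed_of_eq 4 (t := 0) (by simp [tab, table, vec_zero, e₁, e₂, f₁, f₂])

theorem listed_diag_5 : (tab 0 1 0 0 1 0 0 (1 / 2) 0 0).alg.Listed :=
  listed_of_eq 5 (t := 0) (by simp [tab, table, vec_zero, e₁, e₂, f₁, f₂])

theorem listed_diag_7 : (tab 0 1 0 0 (1 / 2) 0 0 (1 / 2) 0 0).alg.Listed :=
  listed_of_eq 7 (t := 0) (by simp [tab, table, vec_zero, e₁, e₂, f₁, f₂])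

theorem listed_diag_9 : (tab 0 1 0 (1 / 2) 0 0 0 (1 / 2) 0 0).alg.Listed :=
  listed_of_eq 9 (t := 0) (by simp [tab, table, vec_zero, e₁, e₂, f₁, f₂])

theorem listed_diag_10 : (tab 0 1 0 (1 / 2) 1 0 0 0 0 0).alg.Listed :=
  listed_of_eq 10 (t := 0) (by simp [tab, table, vec_zero, e₁, e₂, f₁, f₂])

theorem listed_diag_11 : (tab 0 1 0 (1 / 2) 1 0 0 (1 / 2) 0 0).alg.Listed :=
  listed_of_eq 11 (t := 0) (by simp [tab, table, vec_zero, e₁, e₂, f₁, f₂])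

theorem listed_diag_12 : (tab 0 1 0 (1 / 2) (1 / 2) 0 0 0 0 0).alg.Listed :=
  listed_of_eq 12 (t := 0) (by simp [tab, table, vec_zero, e₁, e₂, f₁, f₂])

theorem listed_diag_13 : (tab 0 1 0 (1 / 2) (1 / 2) 0 0 (1 / 2) 0 0).alg.Listed :=
  listed_of_eq 13 (t := 0) (by simp [tab, table, vec_zero, e₁, e₂, f₁, f₂])

theorem listed_diag_14 : (tab 0 1 0 1 1 0 0 0 0 0).alg.Listed :=
  listed_of_eq 14 (t := 0) (by simp [tab, table, vec_zero, e₁, e₂, f₁, f₂])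

theorem listed_diag_15 : (tab 0 1 (1 / 2) (1 / 2) (1 / 2) 0 0 (1 / 2) 0 0).alg.Listed :=
  listed_of_eq 15 (t := 0) (by simp [tab, table, vec_zero, e₁, e₂, f₁, f₂])

/-- The admissible pairs are those from `{0, 1/2, 1}` with sum at most one, as expected because `e₁
+ e₂` is idempotent too. -/
theorem eigenvalue_cases {l m : ℂ} (hl : l = 0 ∨ l = 1 / 2 ∨ l = 1)
    (h₁ : m * (l - 2 * l ^ 2) = 0) (h₂ : l * m * (1 - 2 * m) = 0)
    (h₃ : m * (1 - m) * (1 - 2 * m) = 0) :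
    (l = 0 ∧ m = 0) ∨ (l = 0 ∧ m = 1 / 2) ∨ (l = 0 ∧ m = 1) ∨ (l = 1 / 2 ∧ m = 0) ∨
      (l = 1 / 2 ∧ m = 1 / 2) ∨ (l = 1 ∧ m = 0) := by
  have hhalf : 1 - 2 * m = 0 → m = 1 / 2 := fun h => by linear_combination -(1 / 2) * h
  rcases hl with rfl | rfl | rfl
  · rcases mul_eq_zero.1 h₃ with h | h
    · rcases mul_eq_zero.1 h with h | h
      · simp [h]
      · have : m = 1 := by linear_combination -h
        simp [this]
    · simp [hhalf h]
  · rcases mul_eq_zero.1 h₂ with h | h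
    · have : m = 0 := by linear_combination 2 * h
      simp [this]
    · simp [hhalf h]
  · have : m = 0 := by linear_combination -h₁
    simp [this]

/-- The two odd vectors carry one of six joint eigenvalues each. Interchanging the odd vectors and
interchanging the idempotents leaves thirteen orbits among the 36 combinations. -/
theorem listed_diag {l μ m q : ℂ}
    (h : (l = 0 ∧ m = 0) ∨ (l = 0 ∧ m = 1 / 2) ∨ (l = 0 ∧ m = 1) ∨ (l = 1 / 2 ∧ m = 0) ∨
      (l = 1 / 2 ∧ m = 1 / 2) ∨ (l = 1 ∧ m = 0))
    (h' : (μ = 0 ∧ q = 0) ∨ (μ = 0 ∧ q = 1 / 2) ∨ (μ = 0 ∧ q = 1) ∨ (μ = 1 / 2 ∧ q = 0) ∨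
      (μ = 1 / 2 ∧ q = 1 / 2) ∨ (μ = 1 ∧ q = 0)) :
    (tab 0 1 l μ m 0 0 q 0 0).alg.Listed := by
  rcases h with ⟨rfl, rfl⟩ | ⟨rfl, rfl⟩ | ⟨rfl, rfl⟩ | ⟨rfl, rfl⟩ | ⟨rfl, rfl⟩ | ⟨rfl, rfl⟩ <;>
    rcases h' with ⟨rfl, rfl⟩ | ⟨rfl, rfl⟩ | ⟨rfl, rfl⟩ | ⟨rfl, rfl⟩ | ⟨rfl, rfl⟩ | ⟨rfl, rfl⟩
  · exact listed_diag_1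
  · exact listed_diag_3
  · exact listed_diag_2
  · exact listed_diag_eswap listed_diag_3
  · exact listed_diag_9
  · exact listed_diag_eswap listed_diag_2
  · exact listed_diag_swap listed_diag_3
  · exact listed_diag_7
  · exact listed_diag_swap listed_diag_5
  · exact listed_diag_12
  · exact listed_diag_13
  · exact listed_diag_eswap (listed_diag_swap listed_diag_10)
  · exact listed_diag_swap listed_diag_2
  · exact listed_diag_5
  · exact listed_diag_4
  · exact listed_diag_10
  · exact listed_diag_11
  · exact listed_diag_14
  · exact listed_diag_eswap (listed_diag_swap listed_diag_3)
  · exact listed_diag_swap listed_diag_12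
  · exact listed_diag_swap listed_diag_10
  · exact listed_diag_eswap listed_diag_7
  · exact listed_diag_eswap listed_diag_13
  · exact listed_diag_eswap (listed_diag_swap listed_diag_5)
  · exact listed_diag_swap listed_diag_9
  · exact listed_diag_swap listed_diag_13
  · exact listed_diag_swap listed_diag_11
  · exact listed_diag_eswap (listed_diag_swap listed_diag_13)
  · exact listed_diag_15
  · exact listed_diag_eswap (listed_diag_swap listed_diag_11)
  · exact listed_diag_eswap (listed_diag_swap listed_diag_2)
  · exact listed_diag_eswap listed_diag_10
  · exact listed_diag_swap listed_diag_14
  · exact listed_diag_eswap listed_diag_5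
  · exact listed_diag_eswap listed_diag_11
  · exact listed_diag_eswap listed_diag_4

/-- Each coordinate of `f₁f₂` is annihilated by two polynomials in the eigenvalues, and these differ
by `±(l - μ)` up to sign conventions, so a nonzero coordinate forces `l = μ`. -/
theorem eq_zero_of_eigenvalue_ne {l μ m n p q a b : ℂ} (hl : l = 0 ∨ l = 1 / 2 ∨ l = 1)
    (hμ : μ = 0 ∨ μ = 1 / 2 ∨ μ = 1) (hne : l ≠ μ)
    (hJ : (tab 0 1 l μ m n p q a b).alg.IsJordan) : a = 0 ∧ b = 0 := by
  obtain ⟨w₁, w₂, w₃, w₄, -⟩ := tab_odd_linear hJ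
  constructor
  · by_contra ha
    have k₁ := (mul_eq_zero.1 w₁).resolve_left ha
    have k₃ := (mul_eq_zero.1 w₃).resolve_left ha
    exact hne (by linear_combination k₁ - k₃)
  · by_contra hb
    have k₂ := (mul_eq_zero.1 w₂).resolve_left hb
    have k₄ := (mul_eq_zero.1 w₄).resolve_left hb
    exact hne (by linear_combination k₂ + k₄)

/-- If `f₁` and `f₂` have different joint eigenvalues, then `f₁f₂ = 0`. If they agree, the common
pair decides which coordinates of `f₁f₂` may be nonzero. -/
theorem listed_tab_diag {l μ m q a b : ℂ} (hl : l = 0 ∨ l = 1 / 2 ∨ l = 1)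
    (hμ : μ = 0 ∨ μ = 1 / 2 ∨ μ = 1) (hJ : (tab 0 1 l μ m 0 0 q a b).alg.IsJordan) :
    (tab 0 1 l μ m 0 0 q a b).alg.Listed := by
  obtain ⟨r₁, -, -, r₄, -, -⟩ := tab_linear hJ
  obtain ⟨-, -, -, -, q₅, q₆, -, -⟩ := tab_quadratic hJ
  obtain ⟨c₁, -, -, c₄⟩ := tab_cubic hJ
  have hlm := eigenvalue_cases (m := m) hl (by linear_combination r₁)
    (by linear_combination -q₅) (by linear_combination c₁)
  have hμq := eigenvalue_cases (m := q) hμ (by linear_combination -r₄)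
    (by linear_combination -q₆) (by linear_combination c₄)
  have hJ' := (tab_swap_even l μ m q a b).isJordan hJ
  have hm : m = 0 ∨ m = 1 / 2 ∨ m = 1 := by
    rcases hlm with ⟨-, h⟩ | ⟨-, h⟩ | ⟨-, h⟩ | ⟨-, h⟩ | ⟨-, h⟩ | ⟨-, h⟩ <;> simp [h]
  have hq : q = 0 ∨ q = 1 / 2 ∨ q = 1 := by
    rcases hμq with ⟨-, h⟩ | ⟨-, h⟩ | ⟨-, h⟩ | ⟨-, h⟩ | ⟨-, h⟩ | ⟨-, h⟩ <;> simp [h]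
  by_cases hne : l = μ ∧ m = q
  · obtain ⟨rfl, rfl⟩ := hne
    by_cases hab : a = 0 ∧ b = 0
    · obtain ⟨rfl, rfl⟩ := hab
      exact listed_diag hlm hμq
    obtain ⟨w₁, w₂, -, -, -⟩ := tab_odd_linear hJ
    obtain ⟨v₁, v₂, -, -, -⟩ := tab_odd_linear hJ'
    rcases hlm with ⟨rfl, rfl⟩ | ⟨rfl, rfl⟩ | ⟨rfl, rfl⟩ | ⟨rfl, rfl⟩ | ⟨rfl, rfl⟩ | ⟨rfl, rfl⟩
    · exact absurd ⟨by linear_combination w₁, by linear_combination v₁⟩ hab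
    · obtain rfl : a = 0 := by linear_combination w₁
      have hb : b ≠ 0 := by simpa using hab
      refine (tab_scale_odd _ _ _ _ _ _ _ _ (inv_ne_zero hb)).listed (listed_of_eq 8 (t := 0) ?_)
      simp [tab, table, vec_zero, e₁, e₂, f₁, f₂, hb]
    · obtain rfl : a = 0 := by linear_combination w₁
      have hb : b ≠ 0 := by simpa using hab
      refine (tab_scale_odd _ _ _ _ _ _ _ _ (inv_ne_zero hb)).listed (listed_of_eq 6 (t := 0) ?_)
      simp [tab, table, vec_zero, e₁, e₂, f₁, f₂, hb]
    · obtain rfl : b = 0 := by linear_combination v₁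
      have ha : a ≠ 0 := by simpa using hab
      refine (tab_swap_even _ _ _ _ _ _).listed ((tab_scale_odd _ _ _ _ _ _ _ _
        (inv_ne_zero ha)).listed (listed_of_eq 8 (t := 0) ?_))
      simp [tab, table, vec_zero, e₁, e₂, f₁, f₂, ha]
    -- For the pair `(1/2, 1/2)` both coordinates are free and only their ratio is invariant under
    -- scaling. This produces the family; `a = 0` becomes the member `t = 0` after the idempotents
    -- are exchanged.
    · by_cases ha : a = 0
      · have hb : b ≠ 0 := fun hb => hab ⟨ha, hb⟩
        refine (tab_swap_even _ _ _ _ _ _).listed ((tab_scale_odd _ _ _ _ _ _ _ _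
          (inv_ne_zero hb)).listed (listed_of_eq 16 (t := 0) ?_))
        simp [tab, table, vec_zero, e₁, e₂, f₁, f₂, ha, hb]
      · refine (tab_scale_odd _ _ _ _ _ _ _ _ (inv_ne_zero ha)).listed
          (listed_of_eq 16 (t := a⁻¹ * b) ?_)
        simp [tab, table, vec_zero, e₁, e₂, f₁, f₂, ha]
    · obtain rfl : b = 0 := by linear_combination v₁
      have ha : a ≠ 0 := by simpa using hab
      refine (tab_swap_even _ _ _ _ _ _).listed ((tab_scale_odd _ _ _ _ _ _ _ _
        (inv_ne_zero ha)).listed (listed_of_eq 6 (t := 0) ?_))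
      simp [tab, table, vec_zero, e₁, e₂, f₁, f₂, ha]
  · obtain ⟨rfl, rfl⟩ : a = 0 ∧ b = 0 := by
      by_cases hlμ : l = μ
      · exact (eq_zero_of_eigenvalue_ne hm hq (fun h => hne ⟨hlμ, h⟩) hJ').symm
      · exact eq_zero_of_eigenvalue_ne hl hμ hlμ hJ
    exact listed_diag hlm hμq

end JordanSuper

namespace JordanSuper

open Superalgebra

/-! ### The even part -/

section

variable {A : Type*} [AddCommGroup A] [Module ℂ A] {S : Superalgebra A}

theorem Superalgebra.IsJordan.comm (hS : S.IsJordan) {x y : A} (hx : x ∈ S.part 0) {i : ZMod 2}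
    (hy : y ∈ S.part i) : S.mul y x = S.mul x y := by
  have := hS.1 i 0 y hy x hx
  rwa [mul_zero, sign_zero, one_smul] at this

theorem Superalgebra.mul_mem_even {x y : A} (hx : x ∈ S.part 0) {i : ZMod 2}
    (hy : y ∈ S.part i) : S.mul x y ∈ S.part i := by
  simpa using S.mul_mem hx hy

/-- Putting all four arguments equal in the Jordan identity gives this relation three times. -/
theorem Superalgebra.IsJordan.mul_sq_sq (hS : S.IsJordan) {x : A} (hx : x ∈ S.part 0) :
    S.mul (S.mul x x) (S.mul x x) = S.mul x (S.mul x (S.mul x x)) := by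
  have hxx := mul_mem_even hx hx
  have := hS.2 0 0 0 0 x hx x hx x hx x hx
  simp only [mul_zero, add_zero, sign_zero, one_smul] at this
  rw [hS.comm hx hxx, hS.comm hx (mul_mem_even hx hxx)] at this
  have h3 : (3 : ℂ) • S.mul (S.mul x x) (S.mul x x) = (3 : ℂ) • S.mul x (S.mul x (S.mul x x)) := by
    linear_combination (norm := module) -this
  exact smul_right_injective A (three_ne_zero : (3 : ℂ) ≠ 0) h3

theorem Superalgebra.exists_linearIndependent {g : ZMod 2} (h : Module.finrank ℂ (S.part g) = 2)
    [Module.Finite ℂ A] : ∃ u ∈ S.part g, ∃ v ∈ S.part g, LinearIndependent ℂ ![u, v] := by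
  let b := Module.finBasisOfFinrankEq ℂ (S.part g) h
  refine ⟨b 0, (b 0).2, b 1, (b 1).2, ?_⟩
  have := b.linearIndependent.map' (Submodule.subtype _) (Submodule.ker_subtype _)
  have hb : ![(b 0 : A), (b 1 : A)] = Submodule.subtype _ ∘ b := by
    ext i
    fin_cases i <;> rfl
  rw [hb]
  exact this

theorem Superalgebra.exists_coordinates {g : ZMod 2} (h : Module.finrank ℂ (S.part g) = 2)
    [Module.Finite ℂ A] {u v : A} (hu : u ∈ S.part g) (hv : v ∈ S.part g)
    (huv : LinearIndependent ℂ ![u, v]) {x : A} (hx : x ∈ S.part g) :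
    ∃ c d : ℂ, x = c • u + d • v := by
  have hle : Submodule.span ℂ {u, v} ≤ S.part g := by
    rw [Submodule.span_le]
    rintro _ (rfl | rfl)
    exacts [hu, hv]
  have hr : Module.finrank ℂ (Submodule.span ℂ {u, v}) = 2 := by
    have h := finrank_span_eq_card huv
    rwa [Matrix.range_cons, Matrix.range_cons, Matrix.range_empty, Set.union_empty] at h
  rw [← Submodule.eq_of_le_of_finrank_eq hle (hr.trans h.symm), Submodule.mem_span_pair] at hx
  obtain ⟨c, d, hcd⟩ := hx
  exact ⟨c, d, hcd.symm⟩

/-- Products of even basis vectors in normal form. -/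
def Superalgebra.EvenNormal (S : Superalgebra A) (a b : A) : Prop :=
  (S.mul a a = b ∧ S.mul a b = 0 ∧ S.mul b b = 0) ∨
  (S.mul a a = 0 ∧ S.mul a b = 0 ∧ S.mul b b = 0) ∨
  (S.mul a a = a ∧ S.mul a b = 0 ∧ S.mul b b = b) ∨
  ∃ κ : ℂ, (κ = 0 ∨ κ = 1 ∨ κ = 1 / 2) ∧ S.mul a a = a ∧ S.mul a b = κ • b ∧ S.mul b b = 0

theorem linearIndependent_of_det_ne_zero {x y : A} (hli : LinearIndependent ℂ ![x, y])
    {a b c d : ℂ} (h : a * d - b * c ≠ 0) :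
    LinearIndependent ℂ ![a • x + b • y, c • x + d • y] := by
  rw [LinearIndependent.pair_iff] at hli ⊢
  intro s t hst
  obtain ⟨h1, h2⟩ := hli (s * a + t * c) (s * b + t * d) (by
    linear_combination (norm := module) hst)
  exact eq_zero_of_det_ne_zero h h1 h2

theorem pair_ext {x y : A} {s t s' t' : ℂ} (hs : s = s') (ht : t = t') :
    s • x + t • y = s' • x + t' • y := by
  rw [hs, ht]

/-- With `x·x² = αx + βx²` and `x²·x² = x(x·x²)`, products are those of polynomials without constant
term modulo `X(X² - βX - α)`. The cases are the possible coincidences among the roots. -/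
theorem exists_evenNormal_of_linearIndependent (hS : S.IsJordan) [Module.Finite ℂ A]
    (h : Module.finrank ℂ (S.part 0) = 2) {x : A} (hx : x ∈ S.part 0)
    (hli : LinearIndependent ℂ ![x, S.mul x x]) :
    ∃ a ∈ S.part 0, ∃ b ∈ S.part 0, LinearIndependent ℂ ![a, b] ∧ S.EvenNormal a b := by
  obtain ⟨y, hy⟩ : ∃ y, S.mul x x = y := ⟨_, rfl⟩
  have hsq := hS.mul_sq_sq hx
  have hy0 : y ∈ S.part 0 := hy ▸ mul_mem_even hx hx
  rw [hy] at hsq hli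
  obtain ⟨α, β, hxy⟩ := exists_coordinates h hx hy0 hli (mul_mem_even hx hy0)
  have hyx : S.mul y x = α • x + β • y := (hS.comm hx hy0).trans hxy
  have hyy : S.mul y y = (α * β) • x + (α + β ^ 2) • y := by
    rw [hsq, hxy, map_add, map_smul, map_smul, hy, hxy]
    module
  have hprod : ∀ c₁ c₂ c₃ c₄ : ℂ, S.mul (c₁ • x + c₂ • y) (c₃ • x + c₄ • y) =
      ((c₁ * c₄ + c₂ * c₃) * α + c₂ * c₄ * (α * β)) • x
        + (c₁ * c₃ + (c₁ * c₄ + c₂ * c₃) * β + c₂ * c₄ * (α + β ^ 2)) • y := by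
    intro c₁ c₂ c₃ c₄
    simp only [map_add, map_smul, LinearMap.add_apply, LinearMap.smul_apply, hy, hxy, hyx, hyy]
    module
  have hmem : ∀ c d : ℂ, c • x + d • y ∈ S.part 0 := fun c d =>
    add_mem (Submodule.smul_mem _ _ hx) (Submodule.smul_mem _ _ hy0)
  have hz : (0 : A) = (0 : ℂ) • x + (0 : ℂ) • y := by simp
  by_cases hα : α = 0
  · by_cases hβ : β = 0
    · refine ⟨x, hx, y, hy0, hli, Or.inl ⟨hy, ?_, ?_⟩⟩
      · simp [hxy, hα, hβ]
      · simp [hyy, hα, hβ]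
    -- The roots are `0, 0, β`: `X²/β²` is idempotent and `X - X²/β` squares to zero.
    · refine ⟨(0 : ℂ) • x + (1 / β ^ 2) • y, hmem _ _, (1 : ℂ) • x + (-1 / β) • y, hmem _ _,
        linearIndependent_of_det_ne_zero hli (by simp [hβ]), Or.inr (Or.inr (Or.inr
        ⟨0, Or.inl rfl, ?_, ?_, ?_⟩))⟩
      · rw [hprod]
        apply pair_ext <;> simp [hα] <;> field_simp
      · rw [hprod, zero_smul, hz]
        apply pair_ext <;> simp [hα] <;> field_simp <;> ring
      · rw [hprod, hz]
        apply pair_ext <;> simp [hα] <;> field_simp <;> ring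
  · obtain ⟨r, s, hβ, hα'⟩ : ∃ r s : ℂ, β = r + s ∧ α = -(r * s) := by
      obtain ⟨d, hd⟩ := IsAlgClosed.exists_pow_nat_eq (β ^ 2 + 4 * α) (n := 2) (by norm_num)
      exact ⟨(β + d) / 2, (β - d) / 2, by ring, by linear_combination (-1 / 4) * hd⟩
    have hr : r ≠ 0 := by
      rintro rfl
      exact hα (by simp [hα'])
    have hs : s ≠ 0 := by
      rintro rfl
      exact hα (by simp [hα'])
    by_cases hrs : r = s
    · subst hrs
      -- At a nonzero double root `r`, the polynomial `2X/r - X²/r²` has value one and derivative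
      -- zero and acts as the unit; `-X + X²/r` vanishes at `0` and `r`.
      refine ⟨(2 / r) • x + (-1 / r ^ 2) • y, hmem _ _, (-1 : ℂ) • x + (1 / r) • y, hmem _ _,
        linearIndependent_of_det_ne_zero hli ?_, Or.inr (Or.inr (Or.inr
        ⟨1, Or.inr (Or.inl rfl), ?_, ?_, ?_⟩))⟩
      · field_simp
        norm_num [hr]
      · rw [hprod]
        apply pair_ext <;> rw [hα', hβ] <;> field_simp <;> ring
      · rw [hprod, one_smul ℂ]
        apply pair_ext <;> rw [hα', hβ] <;> field_simp <;> ring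
      · rw [hprod, hz]
        apply pair_ext <;> rw [hα', hβ] <;> field_simp <;> ring
    · have hrs' : r - s ≠ 0 := sub_ne_zero.2 hrs
      have hsr' : s - r ≠ 0 := sub_ne_zero.2 (Ne.symm hrs)
      -- Lagrange interpolation at `0, r, s`: the polynomials taking the value one at `r`,
      -- respectively `s`, and zero at the other two nodes.
      refine ⟨(-s / (r * (r - s))) • x + (1 / (r * (r - s))) • y, hmem _ _,
        (r / (s * (r - s))) • x + (-1 / (s * (r - s))) • y, hmem _ _,
        linearIndependent_of_det_ne_zero hli ?_, Or.inr (Or.inr (Or.inl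
        ⟨?_, ?_, ?_⟩))⟩
      · field_simp
        simp [hr, hs, hrs', hsr']
      · rw [hprod]
        apply pair_ext <;> rw [hα', hβ] <;> field_simp <;> ring
      · rw [hprod, hz]
        apply pair_ext <;> rw [hα', hβ] <;> field_simp <;> ring
      · rw [hprod]
        apply pair_ext <;> rw [hα', hβ] <;> field_simp <;> ring

/-- The hypotheses describe squares of the form `x² = φ(x)x` with `φ` linear. Dividing `a` by `φ(a)`
gives an idempotent, and `αb - βa` spans the kernel of `φ`. -/
theorem evenNormal_of_sq {a b : A} (hba : S.mul b a = S.mul a b) (hli : LinearIndependent ℂ ![a, b]) {α β : ℂ}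
    (hα : α ≠ 0) (ha : S.mul a a = α • a) (hb : S.mul b b = β • b)
    (hab : (2 : ℂ) • S.mul a b = β • a + α • b) :
    LinearIndependent ℂ ![(1 / α) • a + (0 : ℂ) • b, (-β) • a + α • b] ∧
      S.EvenNormal ((1 / α) • a + (0 : ℂ) • b) ((-β) • a + α • b) := by
  refine ⟨linearIndependent_of_det_ne_zero hli (by simp [hα]), Or.inr (Or.inr (Or.inr
    ⟨1 / 2, Or.inr (Or.inr rfl), ?_, ?_, ?_⟩))⟩ <;>
  have hab' : S.mul a b = (β / 2) • a + (α / 2) • b := by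
    linear_combination (norm := module) (1 / 2 : ℂ) • hab
  · simp only [map_add, map_smul, LinearMap.add_apply, LinearMap.smul_apply, hba, hab', ha, hb]
    simp [hα]
  · have : S.mul ((1 / α) • a + (0 : ℂ) • b) ((-β) • a + α • b) =
        (-β * (1 / α * α) + α * (1 / α * (β / 2))) • a + (α * (1 / α * (α / 2))) • b := by
      simp only [map_add, map_smul, LinearMap.add_apply, LinearMap.smul_apply, hba, hab', ha, hb]
      module
    rw [this, smul_add, smul_smul, smul_smul]
    apply pair_ext <;> field_simp
    ring
  · simp only [map_add, map_smul, LinearMap.add_apply, LinearMap.smul_apply, hba, hab', ha, hb]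
    module

/-- If no `x` is independent of `x²`, every square is a multiple of its root. Comparing the squares
of `a + b` and `a - b` shows that the multiplier is additive, which determines `ab`. -/
theorem exists_evenNormal (hS : S.IsJordan) [Module.Finite ℂ A]
    (h : Module.finrank ℂ (S.part 0) = 2) :
    ∃ a ∈ S.part 0, ∃ b ∈ S.part 0, LinearIndependent ℂ ![a, b] ∧ S.EvenNormal a b := by
  by_cases hx : ∃ x ∈ S.part 0, LinearIndependent ℂ ![x, S.mul x x]
  · obtain ⟨x, hx, hli⟩ := hx
    exact exists_evenNormal_of_linearIndependent hS h hx hli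
  have hsq : ∀ x ∈ S.part 0, ∃ φ : ℂ, S.mul x x = φ • x := by
    intro x hx'
    by_cases h0 : x = 0
    · exact ⟨0, by simp [h0]⟩
    · by_contra! hne
      exact hx ⟨x, hx', (LinearIndependent.pair_iff' h0).2 fun c hc => hne c hc.symm⟩
  obtain ⟨a, ha, b, hb, hli⟩ := exists_linearIndependent h
  obtain ⟨α, haa⟩ := hsq a ha
  obtain ⟨β, hbb⟩ := hsq b hb
  obtain ⟨γ, hγ⟩ := hsq (a + b) (add_mem ha hb)
  obtain ⟨δ, hδ⟩ := hsq (a - b) (sub_mem ha hb)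
  have hba := hS.comm ha hb
  simp only [map_add, map_sub, LinearMap.add_apply, LinearMap.sub_apply, haa, hbb, hba] at hγ hδ
  have h1 := LinearIndependent.pair_iff.1 hli (2 * α - γ - δ) (2 * β - γ + δ) (by
    linear_combination (norm := module) hγ + hδ)
  have hγ' : γ = α + β := by linear_combination (-1 / 2) * h1.1 - (1 / 2) * h1.2
  subst hγ'
  have hab : (2 : ℂ) • S.mul a b = β • a + α • b := by
    linear_combination (norm := module) hγ
  by_cases hα : α = 0
  · by_cases hβ : β = 0
    · refine ⟨a, ha, b, hb, hli, Or.inr (Or.inl ⟨by simp [haa, hα], ?_, by simp [hbb, hβ]⟩)⟩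
      simpa [hα, hβ] using hab
    · have hli' : LinearIndependent ℂ ![b, a] := by
        rw [LinearIndependent.pair_iff] at hli ⊢
        exact fun s t hst => (hli t s (by rwa [add_comm])).symm
      refine ⟨_, ?_, _, ?_, evenNormal_of_sq hba.symm hli' hβ hbb haa ?_⟩
      · exact add_mem (Submodule.smul_mem _ _ hb) (Submodule.smul_mem _ _ ha)
      · exact add_mem (Submodule.smul_mem _ _ hb) (Submodule.smul_mem _ _ ha)
      · rw [hba, hab, add_comm]
  · refine ⟨_, ?_, _, ?_, evenNormal_of_sq hba hli hα haa hbb hab⟩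
    · exact add_mem (Submodule.smul_mem _ _ ha) (Submodule.smul_mem _ _ hb)
    · exact add_mem (Submodule.smul_mem _ _ ha) (Submodule.smul_mem _ _ hb)

/-! ### Eigenvectors of an even idempotent -/

/-- The Jordan identity with three factors `e` gives `2E³ - 3E² + E = 0` for the operator `E` of `e`
on the odd part; its roots `0, 1/2, 1` are distinct. -/
theorem exists_eigenbasis (hS : S.IsJordan) [Module.Finite ℂ A]
    (h : Module.finrank ℂ (S.part 1) = 2) {e : A} (he : e ∈ S.part 0) (hee : S.mul e e = e) :
    ∃ f ∈ S.part 1, ∃ g ∈ S.part 1, LinearIndependent ℂ ![f, g] ∧ ∃ l μ : ℂ,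
      (l = 0 ∨ l = 1 / 2 ∨ l = 1) ∧ (μ = 0 ∨ μ = 1 / 2 ∨ μ = 1) ∧
      S.mul e f = l • f ∧ S.mul e g = μ • g := by
  have hE : ∀ x ∈ S.part 1, S.mul e x ∈ S.part 1 := fun x hx => mul_mem_even he hx
  have hcub : ∀ x ∈ S.part 1, (2 : ℂ) • S.mul e (S.mul e (S.mul e x))
      = (3 : ℂ) • S.mul e (S.mul e x) - S.mul e x := by
    intro x hx
    have := hS.2 0 0 0 1 e he e he e he x hx
    simp only [mul_zero, zero_mul, add_zero, sign_zero, one_smul, hee] at this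
    rw [hS.comm he (hE x hx), hS.comm he (hE _ (hE x hx))] at this
    linear_combination (norm := module) this
  let s : Set A := {x | x ∈ S.part 1 ∧ ∃ l : ℂ, (l = 0 ∨ l = 1 / 2 ∨ l = 1) ∧ S.mul e x = l • x}
  have hspan : S.part 1 ≤ Submodule.span ℂ s := by
    intro x hx
    have h1 : S.mul e x ∈ S.part 1 := hE x hx
    have h2 := hE _ h1
    have hc := hcub x hx
    -- The projections onto the eigenspaces are `1 - 3E + 2E²`, `4E - 4E²` and `2E² - E`, and their
    -- sum is the identity.
    have e0 : x - (3 : ℂ) • S.mul e x + (2 : ℂ) • S.mul e (S.mul e x) ∈ s := by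
      refine ⟨add_mem (sub_mem hx (Submodule.smul_mem _ _ h1)) (Submodule.smul_mem _ _ h2), 0,
        Or.inl rfl, ?_⟩
      simp only [map_add, map_sub, map_smul, hc]
      module
    have e1 : (4 : ℂ) • S.mul e x - (4 : ℂ) • S.mul e (S.mul e x) ∈ s := by
      refine ⟨sub_mem (Submodule.smul_mem _ _ h1) (Submodule.smul_mem _ _ h2), 1 / 2,
        Or.inr (Or.inl rfl), ?_⟩
      simp only [map_sub, map_smul]
      linear_combination (norm := module) (-2 : ℂ) • hc
    have e2 : (2 : ℂ) • S.mul e (S.mul e x) - S.mul e x ∈ s := by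
      refine ⟨sub_mem (Submodule.smul_mem _ _ h2) h1, 1, Or.inr (Or.inr rfl), ?_⟩
      simp only [map_sub, map_smul, hc]
      module
    have := add_mem (add_mem (Submodule.subset_span (R := ℂ) e0) (Submodule.subset_span e1))
      (Submodule.subset_span e2)
    convert this using 1
    module
  -- Eigenvectors span a two-dimensional space, so they are neither all zero nor all multiples of
  -- one of them.
  obtain ⟨f, hf, hf0⟩ : ∃ f ∈ s, f ≠ 0 := by
    by_contra! h0
    have : S.part 1 ≤ ⊥ := hspan.trans (Submodule.span_le.2 fun x hx => h0 x hx)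
    rw [le_bot_iff.1 this, finrank_bot] at h
    omega
  obtain ⟨g, hg, hgf⟩ : ∃ g ∈ s, ∀ c : ℂ, c • f ≠ g := by
    by_contra! h0
    have hle : S.part 1 ≤ Submodule.span ℂ {f} := hspan.trans (Submodule.span_le.2 fun x hx =>
      Submodule.mem_span_singleton.2 (h0 x hx))
    have := Submodule.finrank_mono hle
    rw [h, finrank_span_singleton hf0] at this
    omega
  obtain ⟨hf, l, hl, hef⟩ := hf
  obtain ⟨hg, μ, hμ, heg⟩ := hg
  exact ⟨f, hf, g, hg, (LinearIndependent.pair_iff' hf0).2 hgf, l, μ, hl, hμ, hef, heg⟩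

theorem Superalgebra.HasType.finrank_eq_four (h : S.HasType 2 2) : Module.finrank ℂ A = 4 := by
  have := h.1
  rw [← Submodule.finrank_add_eq_of_isCompl S.isCompl, h.2.1, h.2.2]

end

end JordanSuper

namespace JordanSuper

open Superalgebra

set_option linter.unusedSimpArgs false
set_option linter.unusedVariables false

/-! ### Tables with nilpotent even part -/

/-- The table with `e₁² = θe₂`, `e₁f₁ = m₁f₁ + n₁f₂`, `e₁f₂ = p₁f₁ + q₁f₂`, `e₂f₁ = mf₁ + nf₂`,
`e₂f₂ = pf₁ + qf₂`, `f₁f₂ = ae₁ + be₂`. -/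
def nilTab (θ m₁ n₁ p₁ q₁ m n p q a b : ℂ) : Table 2 2 :=
  mult ![0, θ] ![0, 0] ![0, 0] ![m₁, n₁] ![p₁, q₁] ![m, n] ![p, q] ![a, b]

/-- Conditions on the operator of `e₂`. -/
theorem nilTab_cubic {θ m₁ n₁ p₁ q₁ m n p q a b : ℂ}
    (hJ : (nilTab θ m₁ n₁ p₁ q₁ m n p q a b).alg.IsJordan) :
    m ^ 3 + 2 * m * n * p + n * p * q = 0 ∧
    n * (m ^ 2 + m * q + n * p + q ^ 2) = 0 ∧
    m * n * p + 2 * n * p * q + q ^ 3 = 0 := by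
  have h1 := hJ.2 0 0 0 1 _ (ev_mem _ 0 1) _ (ev_mem _ 0 1) _ (ev_mem _ 0 1) _ (od_mem _ 1 0)
  have h2 := hJ.2 0 0 0 1 _ (ev_mem _ 0 1) _ (ev_mem _ 0 1) _ (ev_mem _ 0 1) _ (od_mem _ 0 1)
  simp only [nilTab, mul_ev_ev, mul_ev_od, mul_od_ev, mul_od_od, smul_ev, smul_od, ev_add, od_add,
    ev_inj, od_inj, Matrix.cons_val_zero, Matrix.cons_val_one, zero_add, add_zero, mul_zero, mul_one,
    one_add_one_zmod_two, sign_zero, sign_one, zero_mul, one_mul] at h1 h2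
  refine ⟨?_, ?_, ?_⟩
  · linear_combination (1/2) * h1.1
  · linear_combination (1/2) * h1.2
  · linear_combination (1/2) * h2.2

/-- Conditions on the operator of `e₁` if that of `e₂` vanishes. -/
theorem nilTab_cubic_of_eq_zero {θ m n p q a b : ℂ}
    (hJ : (nilTab θ m n p q 0 0 0 0 a b).alg.IsJordan) :
    m ^ 3 + 2 * m * n * p + n * p * q = 0 ∧
    n * (m ^ 2 + m * q + n * p + q ^ 2) = 0 ∧
    m * n * p + 2 * n * p * q + q ^ 3 = 0 ∧
    θ * n * a = 0 := by
  have h1 := hJ.2 0 0 0 1 _ (ev_mem _ 1 0) _ (ev_mem _ 1 0) _ (ev_mem _ 1 0) _ (od_mem _ 1 0)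
  have h2 := hJ.2 0 0 0 1 _ (ev_mem _ 1 0) _ (ev_mem _ 1 0) _ (ev_mem _ 1 0) _ (od_mem _ 0 1)
  have h3 := hJ.2 0 0 1 1 _ (ev_mem _ 1 0) _ (ev_mem _ 1 0) _ (od_mem _ 1 0) _ (od_mem _ 1 0)
  simp only [nilTab, mul_ev_ev, mul_ev_od, mul_od_ev, mul_od_od, smul_ev, smul_od, ev_add, od_add,
    ev_inj, od_inj, Matrix.cons_val_zero, Matrix.cons_val_one, zero_add, add_zero, mul_zero, mul_one,
    one_add_one_zmod_two, sign_zero, sign_one, zero_mul, one_mul] at h1 h2 h3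
  refine ⟨?_, ?_, ?_, ?_⟩
  · linear_combination (1/2) * h1.1
  · linear_combination (1/2) * h1.2
  · linear_combination (1/2) * h2.2
  · linear_combination (1/2) * h3.2

/-- Conditions on the operator of `e₁` if that of `e₂` is in normal form. -/
theorem nilTab_of_eq_one {θ m n p q a b : ℂ}
    (hJ : (nilTab θ m n p q 0 1 0 0 a b).alg.IsJordan) :
    p = 0 ∧
    m ^ 3 + 2 * m * n * p + n * p * q = 0 ∧
    3 * θ * p - 2 * m * n * p - 4 * n * p * q - 2 * q ^ 3 = 0 ∧
    θ * a = 0 ∧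
    θ * (b - 2 * n * a) = 0 := by
  have h1 := hJ.2 0 0 0 1 _ (ev_mem _ 0 1) _ (ev_mem _ 0 1) _ (ev_mem _ 1 0) _ (od_mem _ 1 0)
  have h2 := hJ.2 0 0 0 1 _ (ev_mem _ 1 0) _ (ev_mem _ 1 0) _ (ev_mem _ 1 0) _ (od_mem _ 1 0)
  have h3 := hJ.2 0 0 0 1 _ (ev_mem _ 1 0) _ (ev_mem _ 1 0) _ (ev_mem _ 1 0) _ (od_mem _ 0 1)
  have h4 := hJ.2 0 0 1 1 _ (ev_mem _ 1 0) _ (ev_mem _ 1 0) _ (od_mem _ 1 0) _ (od_mem _ 1 0)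
  simp only [nilTab, mul_ev_ev, mul_ev_od, mul_od_ev, mul_od_od, smul_ev, smul_od, ev_add, od_add,
    ev_inj, od_inj, Matrix.cons_val_zero, Matrix.cons_val_one, zero_add, add_zero, mul_zero, mul_one,
    one_add_one_zmod_two, sign_zero, sign_one, zero_mul, one_mul] at h1 h2 h3 h4
  refine ⟨?_, ?_, ?_, ?_, ?_⟩
  · linear_combination (1/2) * h1.2
  · linear_combination (1/2) * h2.1
  · linear_combination -h3.2
  · linear_combination -h4.1
  · linear_combination -h4.2

theorem nilTab_swap (θ m₁ n₁ p₁ q₁ m n p q a b : ℂ) :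
    (nilTab θ m₁ n₁ p₁ q₁ m n p q a b).alg.Isomorphic
      (nilTab θ q₁ p₁ n₁ m₁ q p n m (-a) (-b)).alg := by
  refine mult_isomorphic (a := 1) (a' := 0) (b := 0) (b' := 1) (f := 0) (f' := 1) (g := 1) (g' := 0)
    ?_ ?_ ?_ ?_ ?_ ?_ ?_ ?_ ?_ ?_ <;> simp [Fin.forall_fin_two]

/-- Interchanging `e₁` and `e₂`. -/
theorem nilTab_swap_even (m₁ n₁ p₁ q₁ m n p q a b : ℂ) :
    (nilTab 0 m₁ n₁ p₁ q₁ m n p q a b).alg.Isomorphic (nilTab 0 m n p q m₁ n₁ p₁ q₁ b a).alg := by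
  refine mult_isomorphic (a := 0) (a' := 1) (b := 1) (b' := 0) (f := 1) (f' := 0) (g := 0) (g' := 1)
    ?_ ?_ ?_ ?_ ?_ ?_ ?_ ?_ ?_ ?_ <;> simp [Fin.forall_fin_two]

/-- Replacing `f₂` by `e₂f₁`. -/
theorem nilTab_conj (θ m₁ n₁ p₁ q₁ a b : ℂ) {m n p : ℂ} (hn : n ≠ 0) (hd : m * m + n * p = 0) :
    ∃ m' n' p' q' a' b', (nilTab θ m₁ n₁ p₁ q₁ m n p (-m) a b).alg.Isomorphic
      (nilTab θ m' n' p' q' 0 1 0 0 a' b').alg := by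
  refine ⟨m₁ - m * n₁ / n, n₁ / n, m * m₁ + n * p₁ - m * (m * n₁ + n * q₁) / n,
    (m * n₁ + n * q₁) / n, n * a, n * b, ?_⟩
  refine mult_isomorphic (a := 1) (a' := 0) (b := 0) (b' := 1) (f := 1) (f' := 0) (g := m) (g' := n)
    ?_ ?_ ?_ ?_ ?_ ?_ ?_ ?_ ?_ ?_ <;> simp [Fin.forall_fin_two, hn]
  · field_simp
    ring
  · ring
  · exact ⟨hd, by ring⟩

/-- Replacing `f₂` by `e₁f₁` if the operator of `e₂` vanishes. -/
theorem nilTab_conj_of_eq_zero (θ a b : ℂ) {m n p : ℂ} (hn : n ≠ 0) (hd : m * m + n * p = 0) :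
    (nilTab θ m n p (-m) 0 0 0 0 a b).alg.Isomorphic
      (nilTab θ 0 1 0 0 0 0 0 0 (n * a) (n * b)).alg := by
  refine mult_isomorphic (a := 1) (a' := 0) (b := 0) (b' := 1) (f := 1) (f' := 0) (g := m) (g' := n)
    ?_ ?_ ?_ ?_ ?_ ?_ ?_ ?_ ?_ ?_ <;> simp [Fin.forall_fin_two, hn]
  exact ⟨hd, by ring⟩

/-- Subtracting a multiple of `e₂` from `e₁`. -/
theorem nilTab_shear (θ n a b : ℂ) : (nilTab θ 0 n 0 0 0 1 0 0 a b).alg.Isomorphic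
    (nilTab θ 0 0 0 0 0 1 0 0 a (b + n * a)).alg := by
  refine mult_isomorphic (a := 1) (a' := -n) (b := 0) (b' := 1) (f := 1) (f' := 0) (g := 0) (g' := 1)
    ?_ ?_ ?_ ?_ ?_ ?_ ?_ ?_ ?_ ?_ <;> simp [Fin.forall_fin_two]
  ring

/-- The operator of `e₂` is nilpotent and nonzero, so some odd basis has the form `f₁, e₂f₁`. The
Jordan identity then leaves only `e₁f₁ = n'f₂`, which is removed by subtracting a multiple of `e₂`
from `e₁`. -/
theorem exists_nilTab_conj {θ m₁ n₁ p₁ q₁ m n p q a b : ℂ}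
    (hJ : (nilTab θ m₁ n₁ p₁ q₁ m n p q a b).alg.IsJordan)
    (hne : ¬ (m = 0 ∧ n = 0 ∧ p = 0 ∧ q = 0)) :
    ∃ a' b', (nilTab θ m₁ n₁ p₁ q₁ m n p q a b).alg.Isomorphic
      (nilTab θ 0 0 0 0 0 1 0 0 a' b').alg := by
  obtain ⟨c₁, c₂, c₃⟩ := nilTab_cubic hJ
  obtain ⟨ht, hd⟩ := trace_eq_zero_and_det_eq_zero c₁ c₂ c₃
  obtain rfl : q = -m := by linear_combination ht
  obtain ⟨m', n', p', q', a', b', h⟩ : ∃ m' n' p' q' a' b',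
      (nilTab θ m₁ n₁ p₁ q₁ m n p (-m) a b).alg.Isomorphic
        (nilTab θ m' n' p' q' 0 1 0 0 a' b').alg := by
    by_cases hn : n = 0
    · have hm : m = 0 := by simpa [hn] using hd
      have hp : p ≠ 0 := fun hp => hne ⟨hm, hn, hp, by simp [hm]⟩
      obtain ⟨m', n', p', q', a', b', h⟩ :=
        nilTab_conj θ q₁ p₁ n₁ m₁ (-a) (-b) (m := -m) hp (by simp [hm, hn] : -m * -m + p * n = 0)
      refine ⟨m', n', p', q', a', b', (nilTab_swap ..).trans ?_⟩
      rwa [neg_neg] at h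
    · exact nilTab_conj θ m₁ n₁ p₁ q₁ a b hn (by linear_combination -hd)
  obtain ⟨d₁, d₂, d₃, -, -⟩ := nilTab_of_eq_one (h.isJordan hJ)
  obtain rfl : p' = 0 := d₁
  obtain rfl : m' = 0 := by simpa using d₂
  obtain rfl : q' = 0 := by simpa using d₃
  exact ⟨a', _, h.trans (nilTab_shear θ n' a' b')⟩

theorem exists_nilTab_conj_of_eq_zero {θ m n p q a b : ℂ}
    (hJ : (nilTab θ m n p q 0 0 0 0 a b).alg.IsJordan)
    (hne : ¬ (m = 0 ∧ n = 0 ∧ p = 0 ∧ q = 0)) :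
    ∃ a' b', (nilTab θ m n p q 0 0 0 0 a b).alg.Isomorphic
      (nilTab θ 0 1 0 0 0 0 0 0 a' b').alg := by
  obtain ⟨c₁, c₂, c₃, -⟩ := nilTab_cubic_of_eq_zero hJ
  obtain ⟨ht, hd⟩ := trace_eq_zero_and_det_eq_zero c₁ c₂ c₃
  obtain rfl : q = -m := by linear_combination ht
  by_cases hn : n = 0
  · have hm : m = 0 := by simpa [hn] using hd
    have hp : p ≠ 0 := fun hp => hne ⟨hm, hn, hp, by simp [hm]⟩
    have h := nilTab_conj_of_eq_zero θ (-a) (-b) (m := -m) hp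
      (by simp [hm, hn] : -m * -m + p * n = 0)
    rw [neg_neg] at h
    exact ⟨_, _, (nilTab_swap ..).trans h⟩
  · exact ⟨_, _, nilTab_conj_of_eq_zero θ a b hn (by linear_combination -hd)⟩

/-- Since `e₁` acts as zero, `f₁f₂` may itself serve as the new `e₂` when its coordinate `b` is
nonzero, up to a scaling that needs a square root of `b⁻¹`. Otherwise it is a multiple of `e₁`. -/
theorem nilTab_zero_of_eq_one (a b : ℂ) : (nilTab 0 0 0 0 0 0 1 0 0 a b).alg.Listed := by
  by_cases hb : b = 0
  · subst hb
    by_cases ha : a = 0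
    · exact listed_of_eq 18 (t := 0) (by simp [nilTab, table, vec_zero, e₁, e₂, f₁, f₂, ha])
    · refine Isomorphic.listed (T := (table 19 0).alg) (mult_isomorphic (a := a) (a' := 0) (b := 0)
        (b' := 1) (f := 1) (f' := 0) (g := 0) (g' := 1) ?_ ?_ ?_ ?_ ?_ ?_ ?_ ?_ ?_ ?_)
        (listed_of_eq 19 rfl) <;> simp [Fin.forall_fin_two, ha]
  · obtain ⟨x, hx⟩ := IsAlgClosed.exists_pow_nat_eq b⁻¹ (n := 2) (by norm_num)
    have hxb : x * (x * b) = 1 := by rw [← mul_assoc, ← sq, hx, inv_mul_cancel₀ hb]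
    have hx0 : x ≠ 0 := left_ne_zero_of_mul_eq_one hxb
    refine Isomorphic.listed (T := (table 20 0).alg) (mult_isomorphic (a := 1) (a' := 0) (b := a)
      (b' := b) (f := x) (f' := 0) (g := 0) (g' := x * b) ?_ ?_ ?_ ?_ ?_ ?_ ?_ ?_ ?_ ?_)
      (listed_of_eq 20 rfl) <;> simp [Fin.forall_fin_two, hb, hx0, hxb, mul_comm b]

/-- All even products vanish, so `e₁` and `e₂` play symmetric roles and one that acts nontrivially
can be taken as `e₂`. If neither does, nonvanishing of the multiplication forces `f₁f₂ ≠ 0`. -/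
theorem listed_nilTab_zero {m₁ n₁ p₁ q₁ m n p q a b : ℂ}
    (hJ : (nilTab 0 m₁ n₁ p₁ q₁ m n p q a b).alg.IsJordan)
    (hm : (nilTab 0 m₁ n₁ p₁ q₁ m n p q a b).alg.mul ≠ 0) :
    (nilTab 0 m₁ n₁ p₁ q₁ m n p q a b).alg.Listed := by
  by_cases h2 : m = 0 ∧ n = 0 ∧ p = 0 ∧ q = 0
  · by_cases h1 : m₁ = 0 ∧ n₁ = 0 ∧ p₁ = 0 ∧ q₁ = 0
    · obtain ⟨rfl, rfl, rfl, rfl⟩ := h2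
      obtain ⟨rfl, rfl, rfl, rfl⟩ := h1
      have key : ∀ a b : ℂ, a ≠ 0 → (nilTab 0 0 0 0 0 0 0 0 0 a b).alg.Listed := by
        intro a b ha
        refine Isomorphic.listed (T := (table 17 0).alg) (mult_isomorphic (a := a) (a' := b)
          (b := 0) (b' := 1) (f := 1) (f' := 0) (g := 0) (g' := 1) ?_ ?_ ?_ ?_ ?_ ?_ ?_ ?_ ?_ ?_)
          (listed_of_eq 17 rfl) <;> simp [Fin.forall_fin_two, ha]
      by_cases ha : a = 0
      · refine (nilTab_swap_even ..).listed (key b a fun hb => hm ?_)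
        refine ext_bas fun g i => ext_bas fun g' j => ?_
        rw [mul_bas]
        rcases zmod_two_cases g with rfl | rfl <;> rcases zmod_two_cases g' with rfl | rfl <;>
          fin_cases i <;> fin_cases j <;> simp [Table.coef, nilTab, mult, ha, hb]
      · exact key a b ha
    · obtain ⟨a', b', h⟩ := exists_nilTab_conj ((nilTab_swap_even ..).isJordan hJ) h1
      exact (nilTab_swap_even ..).listed (h.listed (nilTab_zero_of_eq_one a' b'))
  · obtain ⟨a', b', h⟩ := exists_nilTab_conj hJ h2
    exact h.listed (nilTab_zero_of_eq_one a' b')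

theorem listed_nilTab_one {m₁ n₁ p₁ q₁ m n p q a b : ℂ}
    (hJ : (nilTab 1 m₁ n₁ p₁ q₁ m n p q a b).alg.IsJordan) :
    (nilTab 1 m₁ n₁ p₁ q₁ m n p q a b).alg.Listed := by
  by_cases h2 : m = 0 ∧ n = 0 ∧ p = 0 ∧ q = 0
  · obtain ⟨rfl, rfl, rfl, rfl⟩ := h2
    by_cases h1 : m₁ = 0 ∧ n₁ = 0 ∧ p₁ = 0 ∧ q₁ = 0
    · obtain ⟨rfl, rfl, rfl, rfl⟩ := h1
      by_cases ha : a = 0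
      · by_cases hb : b = 0
        · exact listed_of_eq 66 (t := 0) (by simp [nilTab, table, vec_zero, e₁, e₂, f₁, f₂, ha, hb])
        · refine Isomorphic.listed (T := (table 67 0).alg) (mult_isomorphic (a := 1) (a' := 0)
            (b := 0) (b' := 1) (f := b⁻¹) (f' := 0) (g := 0) (g' := 1)
            ?_ ?_ ?_ ?_ ?_ ?_ ?_ ?_ ?_ ?_)
            (listed_of_eq 67 rfl) <;> simp [Fin.forall_fin_two, ha, hb]
      -- The new `e₁` is `f₁f₂ = ae₁ + be₂`, whose square is `a²e₂`.
      · refine Isomorphic.listed (T := (table 68 0).alg) (mult_isomorphic (a := a) (a' := b)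
          (b := 0) (b' := a * a) (f := 1) (f' := 0) (g := 0) (g' := 1)
          ?_ ?_ ?_ ?_ ?_ ?_ ?_ ?_ ?_ ?_)
          (listed_of_eq 68 rfl) <;> simp [Fin.forall_fin_two, ha]
    · obtain ⟨a', b', h⟩ := exists_nilTab_conj_of_eq_zero hJ h1
      refine h.listed ?_
      obtain ⟨-, -, -, d⟩ := nilTab_cubic_of_eq_zero (h.isJordan hJ)
      obtain rfl : a' = 0 := by simpa using d
      by_cases hb : b' = 0
      · exact listed_of_eq 70 (t := 0) (by simp [nilTab, table, vec_zero, e₁, e₂, f₁, f₂, hb])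
      -- Scaling `e₁` by `b'` scales `e₂ = e₁²` by its square and `f₂ = e₁f₁` by `b'`; then `f₁f₂`
      -- becomes the new `e₂`.
      · refine Isomorphic.listed (T := (table 71 0).alg) (mult_isomorphic (a := b') (a' := 0)
          (b := 0) (b' := b' * b') (f := 1) (f' := 0) (g := 0) (g' := b')
          ?_ ?_ ?_ ?_ ?_ ?_ ?_ ?_ ?_ ?_)
          (listed_of_eq 71 rfl) <;> simp [Fin.forall_fin_two, hb]
  · obtain ⟨a', b', h⟩ := exists_nilTab_conj hJ h2
    refine h.listed ?_
    -- With `e₁² = e₂` acting nontrivially, both coordinates of `f₁f₂` are forced to vanish.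
    obtain ⟨-, -, -, d₁, d₂⟩ := nilTab_of_eq_one (h.isJordan hJ)
    obtain rfl : a' = 0 := by simpa using d₁
    obtain rfl : b' = 0 := by simpa using d₂
    exact listed_of_eq 69 (t := 0) (by simp [nilTab, table, vec_zero, e₁, e₂, f₁, f₂])

/-! ### Completeness of the list -/

theorem exists_isomorphic_𝒥 {A : Type*} [AddCommGroup A] [Module ℂ A] (S : Superalgebra A)
    (hS : S.IsJordan) (hT : S.HasType 2 2) (hm : S.mul ≠ 0) : S.Listed := by
  have := hT.1
  have hdim := hT.finrank_eq_four
  have hev : ∀ {a b x : A}, a ∈ S.part 0 → b ∈ S.part 0 → LinearIndependent ℂ ![a, b] →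
      x ∈ S.part 0 → ∃ c d : ℂ, x = c • a + d • b := fun ha hb hab hx =>
    exists_coordinates hT.2.1 ha hb hab hx
  have hod : ∀ {f g x : A}, f ∈ S.part 1 → g ∈ S.part 1 → LinearIndependent ℂ ![f, g] →
      x ∈ S.part 1 → ∃ c d : ℂ, x = c • f + d • g := fun hf hg hfg hx =>
    exists_coordinates hT.2.2 hf hg hfg hx
  have hww : ∀ {f g : A}, f ∈ S.part 1 → g ∈ S.part 1 → S.mul f g ∈ S.part 0 := fun hf hg => by
    simpa only [one_add_one_zmod_two] using S.mul_mem hf hg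
  have htab : ∀ {κ ε : ℂ} {a b f g : A} {l μ : ℂ}, a ∈ S.part 0 → b ∈ S.part 0 →
      f ∈ S.part 1 → g ∈ S.part 1 → LinearIndependent ℂ ![a, b] → LinearIndependent ℂ ![f, g] →
      S.mul a a = a → S.mul a b = κ • b → S.mul b b = ε • b → S.mul a f = l • f →
      S.mul a g = μ • g → ∀ m n p q : ℂ, S.mul b f = m • f + n • g → S.mul b g = p • f + q • g →
      ∃ c d : ℂ, S.Isomorphic (tab κ ε l μ m n p q c d).alg := by
    intro κ ε a b f g l μ ha hb hf hg hab hfg haa hab' hbb haf hag m n p q hbf hbg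
    obtain ⟨c, d, hw⟩ := hev ha hb hab (hww hf hg)
    refine ⟨c, d, SuperComm.isomorphic_mult hS.1 hdim ha hb hf hg hab hfg
      ?_ ?_ ?_ ?_ ?_ ?_ ?_ ?_⟩ <;> simp [*]
  obtain ⟨a, ha, b, hb, hab, hN⟩ := exists_evenNormal hS hT.2.1
  rcases hN with ⟨h₁, h₂, h₃⟩ | ⟨h₁, h₂, h₃⟩ | ⟨h₁, h₂, h₃⟩ | ⟨κ, hκ, h₁, h₂, h₃⟩
  · obtain ⟨f, hf, g, hg, hfg⟩ := exists_linearIndependent hT.2.2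
    obtain ⟨m₁, n₁, haf⟩ := hod hf hg hfg (mul_mem_even ha hf)
    obtain ⟨p₁, q₁, hag⟩ := hod hf hg hfg (mul_mem_even ha hg)
    obtain ⟨m, n, hbf⟩ := hod hf hg hfg (mul_mem_even hb hf)
    obtain ⟨p, q, hbg⟩ := hod hf hg hfg (mul_mem_even hb hg)
    obtain ⟨c, d, hw⟩ := hev ha hb hab (hww hf hg)
    have h : S.Isomorphic (nilTab 1 m₁ n₁ p₁ q₁ m n p q c d).alg := by
      refine SuperComm.isomorphic_mult hS.1 hdim ha hb hf hg hab hfg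
        ?_ ?_ ?_ ?_ ?_ ?_ ?_ ?_ <;> simp [*]
    exact h.listed (listed_nilTab_one (h.isJordan hS))
  · obtain ⟨f, hf, g, hg, hfg⟩ := exists_linearIndependent hT.2.2
    obtain ⟨m₁, n₁, haf⟩ := hod hf hg hfg (mul_mem_even ha hf)
    obtain ⟨p₁, q₁, hag⟩ := hod hf hg hfg (mul_mem_even ha hg)
    obtain ⟨m, n, hbf⟩ := hod hf hg hfg (mul_mem_even hb hf)
    obtain ⟨p, q, hbg⟩ := hod hf hg hfg (mul_mem_even hb hg)
    obtain ⟨c, d, hw⟩ := hev ha hb hab (hww hf hg)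
    have h : S.Isomorphic (nilTab 0 m₁ n₁ p₁ q₁ m n p q c d).alg := by
      refine SuperComm.isomorphic_mult hS.1 hdim ha hb hf hg hab hfg
        ?_ ?_ ?_ ?_ ?_ ?_ ?_ ?_ <;> simp [*]
    refine h.listed (listed_nilTab_zero (h.isJordan hS) fun h0 => hm ?_)
    obtain ⟨φ, hφ, -⟩ := h
    ext x y
    apply φ.injective
    rw [hφ, h0]
    simp
  · obtain ⟨f, hf, g, hg, hfg, l, μ, hl, hμ, haf, hag⟩ := exists_eigenbasis hS hT.2.2 ha h₁
    -- If `e₁` has a single eigenvalue on the odd part it acts there as a scalar, so an eigenbasis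
    -- of `e₂` serves both idempotents. If the eigenvalues differ, the linear conditions make the
    -- operator of `e₂` diagonal already.
    by_cases hlμ : l = μ
    · subst hlμ
      have hscal : ∀ x ∈ S.part 1, S.mul a x = l • x := fun x hx => by
        obtain ⟨c, d, rfl⟩ := hod hf hg hfg hx
        rw [map_add, map_smul, map_smul, haf, hag]
        module
      obtain ⟨f, hf, g, hg, hfg, m, q, hm, hq, hbf, hbg⟩ := exists_eigenbasis hS hT.2.2 hb h₃
      obtain ⟨c, d, h⟩ := htab (κ := 0) (ε := 1) ha hb hf hg hab hfg h₁ (by simp [h₂])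
        (by simp [h₃]) (hscal f hf) (hscal g hg) m 0 0 q (by simp [hbf]) (by simp [hbg])
      exact h.listed (listed_tab_diag hl hl (h.isJordan hS))
    · obtain ⟨m, n, hbf⟩ := hod hf hg hfg (mul_mem_even hb hf)
      obtain ⟨p, q, hbg⟩ := hod hf hg hfg (mul_mem_even hb hg)
      obtain ⟨c, d, h⟩ := htab (κ := 0) (ε := 1) ha hb hf hg hab hfg h₁ (by simp [h₂])
        (by simp [h₃]) haf hag m n p q hbf hbg
      obtain ⟨-, -, -, -, r₅, r₆⟩ := tab_linear (h.isJordan hS)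
      have hsub := sub_ne_zero.2 hlμ
      obtain rfl : n = 0 := by simpa [hsub] using r₅
      obtain rfl : p = 0 := by simpa [hsub] using r₆
      exact h.listed (listed_tab_diag hl hμ (h.isJordan hS))
  · obtain ⟨f, hf, g, hg, hfg, l, μ, hl, hμ, haf, hag⟩ := exists_eigenbasis hS hT.2.2 ha h₁
    obtain ⟨m, n, hbf⟩ := hod hf hg hfg (mul_mem_even hb hf)
    obtain ⟨p, q, hbg⟩ := hod hf hg hfg (mul_mem_even hb hg)
    obtain ⟨c, d, h⟩ := htab (ε := 0) ha hb hf hg hab hfg h₁ h₂ (by simp [h₃]) haf hag m n p q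
      hbf hbg
    exact h.listed (listed_tab_of_eps_eq_zero hκ hl hμ (h.isJordan hS))

end JordanSuper

/-- The classification of the Jordan superalgebras of type `(2, 2)` over `ℂ` with nonzero product. -/
theorem mainTheorem4 :
    -- every member of the list is such a superalgebra, with the stated additional information
    (∀ k ∈ Finset.Icc 1 71, ∀ t : ℂ,
      (JordanSuper.𝒥 k t).IsJordan ∧ (JordanSuper.𝒥 k t).HasType 2 2 ∧
      (JordanSuper.𝒥 k t).mul ≠ 0 ∧
      (JordanSuper.𝒥 k t).dimDer + JordanSuper.orbitDim k = 4 ^ 2 ∧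
      JordanSuper.HasDecomposition (JordanSuper.𝒥 k t) k) ∧
    -- the list is complete
    (∀ (A : Type*) [AddCommGroup A] [Module ℂ A] (S : JordanSuper.Superalgebra A),
      S.IsJordan → S.HasType 2 2 → S.mul ≠ 0 →
        ∃ k ∈ Finset.Icc 1 71, ∃ t : ℂ, S.Isomorphic (JordanSuper.𝒥 k t)) ∧
    -- the list has no repetitions, except that the parameters `t` and `1 / t` give isomorphic
    -- members of the family
    (∀ k ∈ Finset.Icc 1 71, ∀ l ∈ Finset.Icc 1 71, ∀ s t : ℂ,
      (JordanSuper.𝒥 k s).Isomorphic (JordanSuper.𝒥 l t) ↔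
        k = l ∧ (k = 16 → s = t ∨ s * t = 1)) := by
  refine ⟨fun k hk t => ⟨JordanSuper.𝒥_isJordan hk t, JordanSuper.Table.alg_hasType _,
    JordanSuper.𝒥_mul_ne_zero hk t, JordanSuper.dimDer_add_orbitDim hk t,
    JordanSuper.hasDecomposition hk t⟩, fun A _ _ S hS hT hm => ?_,
    fun k hk l hl s t => JordanSuper.𝒥_isomorphic_iff hk hl s t⟩
  exact JordanSuper.exists_isomorphic_𝒥 S hS hT hm
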